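/- An instance of the multiplicative assignment problem with upgrades consists of finite sets $I$ (suppliers) and $J$ (customers) with $|I|=|J|$, costs $0\le b_i\le c_i$ for $i\in I$, demands $d_j\ge 0$ for $j\in J$, and an integer $k$ with $0\le k\le |I|$. Let $P(k)$ be the polytope of all $(x,y)\in\mathbb{R}^{I\times J}\times\mathbb{R}^{I\times J}$ with $x,y\ge 0$, $$\sum_{i\in I}(x_{i,j}+y_{i,j})=1\ \ (j\in J),\qquad \sum_{j\in J}(x_{i,j}+y_{i,j})=1\ \ (i\in I),\qquad \sum_{(i,j)\in I\times J}x_{i,j}\le k .$$ (The variable $x_{i,j}$ belongs to a red edge, i.e. assigning $j$ to the upgraded supplier $i$, and $y_{i,j}$ to a blue edge, i.e. assigning $j$ to the supplier $i$ without upgrade; thus $P(k)$ is the bipartite perfect matching polytope cut by the single constraint "at most $k$ red edges".) A vertex of $P(k)$ is optimal if it minimizes $\sum_{(i,j)\in I\times J}\left(b_id_jx_{i,j}+c_id_jy_{i,j}\right)$ over $P(k)$. **Theorem.** (a) For every instance with real data, $P(k)$ has an optimal vertex that is integral. (b) On the other hand, there are instances for which $P(k)$ has an optimal vertex that is not integral.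 (c) An integral optimal vertex can be computed in polynomial time: there are a program and a polynomial $p$ such that for every instance with rational $b_i,c_i,d_j$ the program outputs an integral optimal vertex of $P(k)$ after time at most $p(L)$, where $L$ is the total bit length of the numbers of the instance. Here programs are random access programs over the integers with the operations $+,-,\cdot$ and integer division, and time is logarithmic cost, i.e. every operation is charged the bit lengths of the integers it handles, including addresses. -/

import Mathlib

namespace Upgrade

/-! ### Instances and the linear program -/

/-- An instance of the multiplicative assignment problem with upgrades, with data in `K`:
suppliers `I`, customers `J` with `|I| = |J|`, upgraded costs `b`, regular costs `c`,
demands `d`, and the number `k` of suppliers that may be upgraded. -/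
structure Problem (K : Type*) [Zero K] [LE K] (I J : Type*) [Fintype I] [Fintype J] where
  b : I → K
  c : I → K
  d : J → K
  k : ℕ
  b_nonneg : ∀ i, 0 ≤ b i
  b_le_c : ∀ i, b i ≤ c i
  d_nonneg : ∀ j, 0 ≤ d j
  card_eq : Fintype.card I = Fintype.card J
  k_le : k ≤ Fintype.card I

/-- The space of the variables `(x, y)` of the linear program: `x (i, j)` belongs to the red
(upgraded) edge between `i` and `j`, and `y (i, j)` to the blue (regular) edge. -/
abbrev Point (I J : Type*) : Type _ := (I × J → ℝ) × (I × J → ℝ)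

section LinearProgram

variable {I J : Type*} [Fintype I] [Fintype J]

/-- The bipartite perfect matching polytope of the red/blue multigraph, by its inequalities. -/
def matchingPolytope (I J : Type*) [Fintype I] [Fintype J] : Set (Point I J) :=
  {z | (∀ j, ∑ i, (z.1 (i, j) + z.2 (i, j)) = 1) ∧
       (∀ i, ∑ j, (z.1 (i, j) + z.2 (i, j)) = 1) ∧
       (∀ e, 0 ≤ z.1 e) ∧ (∀ e, 0 ≤ z.2 e)}

/-- The polytope `P(k)`: at most `k` red edges. -/
def polytope (I J : Type*) [Fintype I] [Fintype J] (k : ℕ) : Set (Point I J) :=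
  {z | z ∈ matchingPolytope I J ∧ ∑ e, z.1 e ≤ (k : ℝ)}

/-- The objective function of the linear program. -/
def Problem.objective (Q : Problem ℝ I J) (z : Point I J) : ℝ :=
  ∑ e : I × J, (Q.b e.1 * Q.d e.2 * z.1 e + Q.c e.1 * Q.d e.2 * z.2 e)

/-- `z` is an optimal vertex of `P(k)`: an extreme point at which the objective is minimal. -/
def Problem.IsOptimalVertex (Q : Problem ℝ I J) (z : Point I J) : Prop :=
  z ∈ (polytope I J Q.k).extremePoints ℝ ∧ IsMinOn Q.objective (polytope I J Q.k) z

/-- All coordinates of the point are integers. -/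
def IsIntegral (z : Point I J) : Prop :=
  (∀ e, ∃ m : ℤ, z.1 e = m) ∧ (∀ e, ∃ m : ℤ, z.2 e = m)

/-- A rational instance, viewed as a real one. -/
def Problem.toReal (Q : Problem ℚ I J) : Problem ℝ I J where
  b i := (Q.b i : ℝ)
  c i := (Q.c i : ℝ)
  d j := (Q.d j : ℝ)
  k := Q.k
  b_nonneg i := by exact_mod_cast Q.b_nonneg i
  b_le_c i := by exact_mod_cast Q.b_le_c i
  d_nonneg j := by exact_mod_cast Q.d_nonneg j
  card_eq := Q.card_eq
  k_le := Q.k_le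

end LinearProgram

/-! ### The machine model: random access programs over the integers with logarithmic cost

A program uses finitely many integer variables and finitely many integer arrays (each named by a
natural number). Every operation is charged the bit lengths of all the integers that it
handles, addresses included. -/

/-- The number of binary digits of `|z|`. -/
def bitLength (z : ℤ) : ℕ := Nat.size z.natAbs

/-- The memory: integer variables and integer arrays. -/
structure Memory where
  var : ℕ → ℤ
  arr : ℕ → ℤ → ℤ

/-- Arithmetic expressions; `get a e` reads array `a` at the address given by `e`, and `div` is
integer division with remainder (with value `0` when the divisor is `0`). -/
inductive Expr where
  | const (z : ℤ)
  | var (v : ℕ)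
  | get (a : ℕ) (e : Expr)
  | add (e f : Expr)
  | sub (e f : Expr)
  | mul (e f : Expr)
  | div (e f : Expr)

/-- The value of an expression. -/
def Expr.eval (s : Memory) : Expr → ℤ
  | .const z => z
  | .var v => s.var v
  | .get a e => s.arr a (e.eval s)
  | .add e f => e.eval s + f.eval s
  | .sub e f => e.eval s - f.eval s
  | .mul e f => e.eval s * f.eval s
  | .div e f => e.eval s / f.eval s

/-- The time for evaluating an expression: every node of the expression costs one plus the bit
length of its value. -/
def Expr.cost (s : Memory) : Expr → ℕ
  | .const z => 1 + bitLength z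
  | .var v => 1 + bitLength (s.var v)
  | .get a e => e.cost s + 1 + bitLength (s.arr a (e.eval s))
  | .add e f => e.cost s + f.cost s + 1 + bitLength (e.eval s + f.eval s)
  | .sub e f => e.cost s + f.cost s + 1 + bitLength (e.eval s - f.eval s)
  | .mul e f => e.cost s + f.cost s + 1 + bitLength (e.eval s * f.eval s)
  | .div e f => e.cost s + f.cost s + 1 + bitLength (e.eval s / f.eval s)

/-- Programs. Tests are of the form `0 < e`. -/
inductive Program where
  | skip
  | assign (v : ℕ) (e : Expr)
  | store (a : ℕ) (i e : Expr)
  | seq (p q : Program)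
  | ifPos (e : Expr) (p q : Program)
  | whilePos (e : Expr) (p : Program)

/-- Write a variable. -/
def Memory.setVar (s : Memory) (v : ℕ) (z : ℤ) : Memory :=
  { s with var := Function.update s.var v z }

/-- Write an array cell. -/
def Memory.setArr (s : Memory) (a : ℕ) (i z : ℤ) : Memory :=
  { s with arr := Function.update s.arr a (Function.update (s.arr a) i z) }

/-- `Runs p s t s'`: the program `p`, started in memory `s`, halts after time `t` with
memory `s'`. -/
inductive Runs : Program → Memory → ℕ → Memory → Prop
  | skip (s : Memory) : Runs .skip s 1 s
  | assign (s : Memory) (v : ℕ) (e : Expr) :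
      Runs (.assign v e) s (1 + e.cost s) (s.setVar v (e.eval s))
  | store (s : Memory) (a : ℕ) (i e : Expr) :
      Runs (.store a i e) s (1 + i.cost s + e.cost s) (s.setArr a (i.eval s) (e.eval s))
  | seq {p q : Program} {s₁ s₂ s₃ : Memory} {t u : ℕ} :
      Runs p s₁ t s₂ → Runs q s₂ u s₃ → Runs (.seq p q) s₁ (t + u) s₃
  | ifTrue {e : Expr} {p q : Program} {s₁ s₂ : Memory} {t : ℕ} :
      0 < e.eval s₁ → Runs p s₁ t s₂ → Runs (.ifPos e p q) s₁ (1 + e.cost s₁ + t) s₂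
  | ifFalse {e : Expr} {p q : Program} {s₁ s₂ : Memory} {t : ℕ} :
      ¬ 0 < e.eval s₁ → Runs q s₁ t s₂ → Runs (.ifPos e p q) s₁ (1 + e.cost s₁ + t) s₂
  | whileTrue {e : Expr} {p : Program} {s₁ s₂ s₃ : Memory} {t u : ℕ} :
      0 < e.eval s₁ → Runs p s₁ t s₂ → Runs (.whilePos e p) s₂ u s₃ →
      Runs (.whilePos e p) s₁ (1 + e.cost s₁ + t + u) s₃
  | whileFalse {e : Expr} {p : Program} {s : Memory} :
      ¬ 0 < e.eval s → Runs (.whilePos e p) s (1 + e.cost s) s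

/-! ### Input and output -/

/-- The bit length of a rational number, given by numerator and denominator. -/
def ratLength (q : ℚ) : ℕ := bitLength q.num + bitLength q.den

/-- The bit length of a rational instance with `n` suppliers and `n` customers. Each of the `3 * n`
rational numbers contributes at least `1`, so that this is at least `3 * n`. -/
def Problem.inputLength {n : ℕ} (Q : Problem ℚ (Fin n) (Fin n)) : ℕ :=
  bitLength n + bitLength Q.k +
    ∑ i, (ratLength (Q.b i) + ratLength (Q.c i) + ratLength (Q.d i))

/-- The array that holds `f 0, …, f (n - 1)` in the cells `0, …, n - 1`, and `0` elsewhere. -/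
def toArray {n : ℕ} (f : Fin n → ℤ) (z : ℤ) : ℤ :=
  if h : 0 ≤ z ∧ z < n then f ⟨z.toNat, by omega⟩ else 0

/-- The memory that presents the instance: `n` and `k` in the variables `0` and `1`, and the
numerators and denominators of `b`, `c`, `d` in the arrays `0` to `5`. All else is `0`. -/
def Problem.inputMemory {n : ℕ} (Q : Problem ℚ (Fin n) (Fin n)) : Memory where
  var
    | 0 => n
    | 1 => Q.k
    | _ => 0
  arr
    | 0 => toArray fun i => (Q.b i).num
    | 1 => toArray fun i => ((Q.b i).den : ℤ)
    | 2 => toArray fun i => (Q.c i).num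
    | 3 => toArray fun i => ((Q.c i).den : ℤ)
    | 4 => toArray fun j => (Q.d j).num
    | 5 => toArray fun j => ((Q.d j).den : ℤ)
    | _ => fun _ => 0

/-- The point `(x, y)` that is read off from a memory: `x (i, j)` and `y (i, j)` are the
entries at the address `i * n + j` of the arrays `6` and `7`. -/
def outputPoint (n : ℕ) (s : Memory) : Point (Fin n) (Fin n) :=
  (fun e => ((s.arr 6 ((e.1 : ℕ) * (n : ℤ) + (e.2 : ℕ)) : ℤ) : ℝ),
   fun e => ((s.arr 7 ((e.1 : ℕ) * (n : ℤ) + (e.2 : ℕ)) : ℤ) : ℝ))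

end Upgrade

/-! Let f(k) be the smallest cost of a perfect matching with exactly k upgrades (`minCost`).
Everything rests on the convexity of f. Given convexity, a slope of f at k is a price r per upgrade,
nonnegative because b ≤ c makes f nonincreasing. A cheapest matching with k upgrades then minimizes
cost plus r times the number of upgrades over all matchings, and by Birkhoff's theorem over all
fractional matchings as well (`IsPenalizedMin.le`). Since r ≥ 0 and P(k) allows at most k red edges,
it is optimal over P(k). Its incidence vector has 0/1 coordinates, hence is a vertex
(`isOptimalVertex_matchingPoint`).

If f were not convex, some price r > 0 would be optimal for counts j < k < l but not for k. This is
refuted by exchanging two optimal solutions M, M' for the price r into two optimal solutions with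
balanced counts (`IsPenalizedMin.exchange`). An uncrossing argument on the midpoint of M and M'
shows that the suppliers upgraded in only one of them are ordered simultaneously by b and by c
(`chain`). Distribute these suppliers alternately along this order. For every threshold τ, the
numbers of suppliers of cost at least τ in the two new solutions then have the same total as before
and differ by at most one. Given the upgrades, a cheapest assignment gives the smallest demands to
the most expensive suppliers. By the layer cake formula its cost is therefore an integral over τ of
the sum of the p(τ) smallest demands, where p(τ) counts the suppliers above τ. That sum is convex in
p, so balancing does not increase the total cost (`cost_add_cost_le`).

A fractional optimal vertex exists already for n = 2: when all optimal points use the budget fully,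
the budget constraint can cut an edge of the matching polytope in its middle
(`halfPoint_isOptimalVertex`).

For the algorithm, denominators are cleared and the integer data are perturbed, within the
multiplicative form, so that the cost modulo 2 ^ n reveals the set of upgrades (`perturb_generic`).
The exchange then makes f strictly convex with integer slopes. At each half-integral price all
optimal solutions have the same count, and every count k occurs. A binary search finds the price
(`card_eq_of_search`). Each relaxation is an ordinary assignment problem, solved by an auction with
cost scaling; a bound on how far prices rise within one phase (`Bidding.price_le`) makes it
polynomial. The program is verified by Hoare-style rules for `Ends`, which bound the number of steps
and the size of all stored numbers at once. -/

namespace Upgrade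

set_option linter.unusedSectionVars false

/-! ### Matchings with upgrades and their Lagrangian relaxation -/

section Matchings

variable {I J : Type*} [Fintype I] [Fintype J] [DecidableEq I] [DecidableEq J]

/-- The cost of the perfect matching `M.1` in which the suppliers in `M.2` are upgraded. -/
def Problem.matchingCost (Q : Problem ℝ I J) (M : (I ≃ J) × Finset I) : ℝ :=
  ∑ i, (if i ∈ M.2 then Q.b i else Q.c i) * Q.d (M.1 i)

/-- The cost of a matching, plus the price `r` for every upgrade. -/
def Problem.penalized (Q : Problem ℝ I J) (r : ℝ) (M : (I ≃ J) × Finset I) : ℝ :=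
  Q.matchingCost M + r * M.2.card

/-- `M` minimizes the cost plus `r` times the number of upgrades among all matchings. -/
def Problem.IsPenalizedMin (Q : Problem ℝ I J) (r : ℝ) (M : (I ≃ J) × Finset I) : Prop :=
  ∀ M', Q.penalized r M ≤ Q.penalized r M'

/-- The incidence vector of a matching. -/
def matchingPoint (M : (I ≃ J) × Finset I) : Point I J :=
  (fun e => if M.1 e.1 = e.2 ∧ e.1 ∈ M.2 then 1 else 0,
   fun e => if M.1 e.1 = e.2 ∧ e.1 ∉ M.2 then 1 else 0)

lemma matchingPoint_add (M : (I ≃ J) × Finset I) (e : I × J) :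
    (matchingPoint M).1 e + (matchingPoint M).2 e = if M.1 e.1 = e.2 then 1 else 0 := by
  by_cases h : M.1 e.1 = e.2 <;> by_cases h' : e.1 ∈ M.2 <;> simp [matchingPoint, h, h']

lemma matchingPoint_mem (M : (I ≃ J) × Finset I) : matchingPoint M ∈ matchingPolytope I J := by
  refine ⟨fun j => ?_, fun i => ?_, fun e => ?_, fun e => ?_⟩
  · simp_rw [matchingPoint_add]
    simp [← Equiv.eq_symm_apply]
  · simp_rw [matchingPoint_add]
    simp
  · simp only [matchingPoint]; split_ifs <;> norm_num
  · simp only [matchingPoint]; split_ifs <;> norm_num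

lemma sum_matchingPoint_fst (M : (I ≃ J) × Finset I) :
    ∑ e, (matchingPoint M).1 e = (M.2.card : ℝ) := by
  rw [Fintype.sum_prod_type]
  simp [matchingPoint, ite_and]

lemma objective_matchingPoint (Q : Problem ℝ I J) (M : (I ≃ J) × Finset I) :
    Q.objective (matchingPoint M) = Q.matchingCost M := by
  unfold Problem.objective Problem.matchingCost
  rw [Fintype.sum_prod_type]
  refine Finset.sum_congr rfl fun i _ => ?_
  rw [Finset.sum_eq_single (M.1 i)]
  · by_cases h : i ∈ M.2 <;> simp [matchingPoint, h]
  · intro j _ hj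
    simp [matchingPoint, hj.symm]
  · simp

/-- The Lagrangian relaxation is integral: this is the theorem of Birkhoff. -/
lemma Problem.IsPenalizedMin.le {Q : Problem ℝ I J} {r : ℝ} {M : (I ≃ J) × Finset I}
    (hM : Q.IsPenalizedMin r M) {z : Point I J} (hz : z ∈ matchingPolytope I J) :
    Q.penalized r M ≤ Q.objective z + r * ∑ e, z.1 e := by
  obtain ⟨h1, h2, h3, h4⟩ := hz
  -- For fixed assignment the colours can be chosen edge by edge, so only an assignment problem with
  -- the weights `w` remains.
  set w : I → J → ℝ := fun i j => min (Q.b i * Q.d j + r) (Q.c i * Q.d j) with hw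
  have key : ∀ σ : I ≃ J, Q.penalized r M ≤ ∑ i, w i (σ i) := by
    intro σ
    refine (hM (σ, Finset.univ.filter fun i =>
      Q.b i * Q.d (σ i) + r ≤ Q.c i * Q.d (σ i))).trans (le_of_eq ?_)
    unfold Problem.penalized Problem.matchingCost
    rw [Finset.card_filter, Nat.cast_sum, Finset.mul_sum, ← Finset.sum_add_distrib]
    refine Finset.sum_congr rfl fun i _ => ?_
    by_cases h : Q.b i * Q.d (σ i) + r ≤ Q.c i * Q.d (σ i)
    · simp [hw, h]
    · simp [hw, h, (not_le.1 h).le]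
  have e1 : ∑ e : I × J, w e.1 e.2 * (z.1 e + z.2 e) ≤ Q.objective z + r * ∑ e, z.1 e := by
    unfold Problem.objective
    rw [Finset.mul_sum, ← Finset.sum_add_distrib]
    refine Finset.sum_le_sum fun e _ => ?_
    have a1 := mul_le_mul_of_nonneg_right
      (min_le_left (Q.b e.1 * Q.d e.2 + r) (Q.c e.1 * Q.d e.2)) (h3 e)
    have a2 := mul_le_mul_of_nonneg_right
      (min_le_right (Q.b e.1 * Q.d e.2 + r) (Q.c e.1 * Q.d e.2)) (h4 e)
    simp only [hw]
    linarith
  refine le_trans ?_ e1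
  -- `M.1` serves here only to identify `J` with `I`, so that the matrix becomes square.
  set A : Matrix I I ℝ := fun i i' => z.1 (i, M.1 i') + z.2 (i, M.1 i') with hA
  have hAm : A ∈ doublyStochastic ℝ I := by
    rw [mem_doublyStochastic_iff_sum]
    refine ⟨fun i j => add_nonneg (h3 _) (h4 _), fun i => ?_, fun j => h1 _⟩
    rw [← h2 i]
    exact Equiv.sum_comp M.1 fun j => z.1 (i, j) + z.2 (i, j)
  obtain ⟨u, hu0, hu1, hu⟩ := exists_eq_sum_perm_of_mem_doublyStochastic hAm
  have e2 : ∑ e : I × J, w e.1 e.2 * (z.1 e + z.2 e) = ∑ i, ∑ i', w i (M.1 i') * A i i' := by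
    rw [Fintype.sum_prod_type]
    refine Finset.sum_congr rfl fun i _ => ?_
    exact (Equiv.sum_comp M.1 fun j => w i j * (z.1 (i, j) + z.2 (i, j))).symm
  have e3 : ∑ i, ∑ i', w i (M.1 i') * A i i' = ∑ σ, u σ * ∑ i, w i (M.1 (σ i)) := by
    have : ∀ i i', A i i' = ∑ σ : Equiv.Perm I, u σ * if σ i = i' then 1 else 0 := by
      intro i i'
      rw [← hu]
      simp [Matrix.sum_apply, Equiv.Perm.permMatrix, PEquiv.toMatrix_apply, eq_comm]
    have hi : ∀ i, ∑ i', w i (M.1 i') * A i i' = ∑ σ, u σ * w i (M.1 (σ i)) := by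
      intro i
      simp_rw [this, Finset.mul_sum]
      rw [Finset.sum_comm]
      refine Finset.sum_congr rfl fun σ _ => ?_
      simp [mul_comm]
    simp_rw [hi, Finset.mul_sum]
    exact Finset.sum_comm
  rw [e2, e3]
  calc Q.penalized r M = ∑ σ, u σ * Q.penalized r M := by rw [← Finset.sum_mul, hu1, one_mul]
    _ ≤ _ := Finset.sum_le_sum fun σ _ =>
      mul_le_mul_of_nonneg_left (key (σ.trans M.1)) (hu0 σ)


/-- In an optimal solution of the Lagrangian relaxation for a positive price, a supplier with a
regular edge and a supplier with an upgraded edge are never strictly nested the wrong way. -/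
lemma Problem.IsPenalizedMin.not_nested {Q : Problem ℝ I J} {r : ℝ} {M : (I ≃ J) × Finset I}
    (hM : Q.IsPenalizedMin r M) (hr : 0 < r) {z : Point I J} (hz : z ∈ matchingPolytope I J)
    (hv : Q.objective z + r * ∑ e, z.1 e = Q.penalized r M) {i i' : I} {j j' : J}
    (hij : 0 < z.2 (i, j)) (hij' : 0 < z.1 (i', j')) (hc : Q.c i' < Q.c i) :
    Q.b i' ≤ Q.b i := by
  by_contra! hb
  have hne : i ≠ i' := by rintro rfl; exact lt_irrefl _ hc
  -- Mass `t` moves from blue `(i, j)` and red `(i', j')` to red `(i, j')` and blue `(i', j)`. Row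
  -- sums, column sums and the red total do not change, and the cost strictly decreases unless `d j'
  -- = 0` (and then need not).
  set t := min (z.2 (i, j)) (z.1 (i', j')) with ht
  have ht0 : 0 < t := lt_min hij hij'
  have ht1 : t ≤ z.2 (i, j) := min_le_left _ _
  have ht2 : t ≤ z.1 (i', j') := min_le_right _ _
  have hcol := hz.1
  have hrow := hz.2.1
  have hx := hz.2.2.1
  have hy := hz.2.2.2
  -- the exchange
  have k1 := hM.le (z := (fun e => z.1 e + t * ((if e = (i, j') then 1 else 0) -
      if e = (i', j') then 1 else 0), fun e => z.2 e + t * ((if e = (i', j) then 1 else 0) -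
      if e = (i, j) then 1 else 0))) (by
    refine ⟨fun l => ?_, fun l => ?_, fun e => ?_, fun e => ?_⟩
    · refine Eq.trans ?_ (hcol l)
      simp only [Finset.sum_add_distrib, ← Finset.mul_sum, Finset.sum_sub_distrib, Prod.mk.injEq,
        ite_and]
      simp
    · refine Eq.trans ?_ (hrow l)
      simp only [Finset.sum_add_distrib, ← Finset.mul_sum, Finset.sum_sub_distrib, Prod.mk.injEq,
        ite_and]
      by_cases h1 : l = i <;> by_cases h2 : l = i' <;> simp [h1, h2] <;> ring
    · have := hx e
      by_cases h : e = (i', j')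
      · subst h
        simp only [Prod.mk.injEq, hne.symm, false_and, if_false, if_true]
        linarith
      · simp only [h, if_false]
        split_ifs <;> linarith
    · have := hy e
      by_cases h : e = (i, j)
      · subst h
        simp only [Prod.mk.injEq, hne, false_and, if_false, if_true]
        linarith
      · simp only [h, if_false]
        split_ifs <;> linarith)
  -- The second competitor turns red `(i', j')` into blue. It settles the case `d j' = 0`, where the
  -- upgrade saves nothing but costs `r > 0`.
  have k2 := hM.le (z := (fun e => z.1 e - t * (if e = (i', j') then 1 else 0),
      fun e => z.2 e + t * (if e = (i', j') then 1 else 0))) (by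
    refine ⟨fun l => ?_, fun l => ?_, fun e => ?_, fun e => ?_⟩
    · rw [← hcol l]
      exact Finset.sum_congr rfl fun _ _ => by ring
    · rw [← hrow l]
      exact Finset.sum_congr rfl fun _ _ => by ring
    · have := hx e
      by_cases h : e = (i', j')
      · subst h
        simp only [if_true]
        linarith
      · simp only [h, if_false]
        linarith
    · have := hy e
      dsimp only
      split_ifs <;> linarith)
  rw [← hv] at k1 k2
  unfold Problem.objective at k1 k2
  simp only [mul_add, mul_sub, Finset.sum_add_distrib, Finset.sum_sub_distrib, mul_ite, mul_one,
    mul_zero, Finset.sum_ite_eq', Finset.mem_univ, if_true] at k1 k2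
  have hdj := Q.d_nonneg j
  have hdj' := Q.d_nonneg j'
  have e1 : 0 ≤ t * ((Q.c i' - Q.c i) * Q.d j + (Q.b i - Q.b i') * Q.d j') := by linarith
  have e2 := nonneg_of_mul_nonneg_right e1 ht0
  have e3 : 0 ≤ t * ((Q.c i' - Q.b i') * Q.d j' - r) := by linarith
  have e4 := nonneg_of_mul_nonneg_right e3 ht0
  have e5 : Q.d j' = 0 := by
    by_contra h
    have : 0 < Q.d j' := lt_of_le_of_ne hdj' (Ne.symm h)
    nlinarith [mul_pos (sub_pos.2 hb) this, mul_nonneg (sub_pos.2 hc).le hdj]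
  rw [e5] at e4
  linarith

/-- Upgraded sets of two optimal solutions of the Lagrangian relaxation for a positive price: the
suppliers outside the intersection and inside the union are ordered by both costs. -/
lemma Problem.IsPenalizedMin.chain {Q : Problem ℝ I J} {r : ℝ} {M M' : (I ≃ J) × Finset I}
    (hM : Q.IsPenalizedMin r M) (hM' : Q.IsPenalizedMin r M') (hr : 0 < r) {i i' : I}
    (hi : i ∉ M.2 ∨ i ∉ M'.2) (hi' : i' ∈ M.2 ∨ i' ∈ M'.2) (hc : Q.c i' < Q.c i) :
    Q.b i' ≤ Q.b i := by
  have hE : Q.penalized r M' = Q.penalized r M := le_antisymm (hM' _) (hM _)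
  set p := matchingPoint M with hp
  set p' := matchingPoint M' with hp'
  obtain ⟨a1, a2, a3, a4⟩ := matchingPoint_mem M
  obtain ⟨b1, b2, b3, b4⟩ := matchingPoint_mem M'
  -- The midpoint is optimal too and contains the edges of both matchings, so edges of different
  -- matchings can be compared.
  set z : Point I J := (fun e => (p.1 e + p'.1 e) / 2, fun e => (p.2 e + p'.2 e) / 2) with hz
  have hzm : z ∈ matchingPolytope I J := by
    refine ⟨fun l => ?_, fun l => ?_, fun e => ?_, fun e => ?_⟩
    · have : ∀ i, z.1 (i, l) + z.2 (i, l) =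
        (p.1 (i, l) + p.2 (i, l)) / 2 + (p'.1 (i, l) + p'.2 (i, l)) / 2 := fun i => by
          simp only [hz]; ring
      simp_rw [this, Finset.sum_add_distrib, ← Finset.sum_div]
      rw [a1, b1]; norm_num
    · have : ∀ j, z.1 (l, j) + z.2 (l, j) =
        (p.1 (l, j) + p.2 (l, j)) / 2 + (p'.1 (l, j) + p'.2 (l, j)) / 2 := fun i => by
          simp only [hz]; ring
      simp_rw [this, Finset.sum_add_distrib, ← Finset.sum_div]
      rw [a2, b2]; norm_num
    · have := a3 e; have := b3 e; simp only [hz]; positivity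
    · have := a4 e; have := b4 e; simp only [hz]; positivity
  have hval : Q.objective z + r * ∑ e, z.1 e = Q.penalized r M := by
    have o1 : Q.objective z = (Q.objective p + Q.objective p') / 2 := by
      unfold Problem.objective
      rw [← Finset.sum_add_distrib, Finset.sum_div]
      exact Finset.sum_congr rfl fun e _ => by simp only [hz]; ring
    have o2 : ∑ e, z.1 e = (∑ e, p.1 e + ∑ e, p'.1 e) / 2 := by
      rw [← Finset.sum_add_distrib, Finset.sum_div]
    rw [o1, o2, hp, hp', objective_matchingPoint, objective_matchingPoint,
      sum_matchingPoint_fst, sum_matchingPoint_fst]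
    unfold Problem.penalized at hE ⊢
    linarith
  obtain ⟨j, hj⟩ : ∃ j, 0 < z.2 (i, j) := by
    rcases hi with h | h
    · refine ⟨M.1 i, ?_⟩
      have : p.2 (i, M.1 i) = 1 := by simp [hp, matchingPoint, h]
      have := b4 (i, M.1 i)
      simp only [hz]; linarith
    · refine ⟨M'.1 i, ?_⟩
      have : p'.2 (i, M'.1 i) = 1 := by simp [hp', matchingPoint, h]
      have := a4 (i, M'.1 i)
      simp only [hz]; linarith
  obtain ⟨j', hj'⟩ : ∃ j, 0 < z.1 (i', j) := by
    rcases hi' with h | h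
    · refine ⟨M.1 i', ?_⟩
      have : p.1 (i', M.1 i') = 1 := by simp [hp, matchingPoint, h]
      have := b3 (i', M.1 i')
      simp only [hz]; linarith
    · refine ⟨M'.1 i', ?_⟩
      have : p'.1 (i', M'.1 i') = 1 := by simp [hp', matchingPoint, h]
      have := a3 (i', M'.1 i')
      simp only [hz]; linarith
  exact hM.not_nested hr hzm hval hj hj' hc

/-! ### Layer cake -/

/-- Comparison of two weighted sums by their superlevel sets. -/
lemma sum_mul_le_sum_mul_of_superlevel {ι κ : Type*} [Fintype ι] [Fintype κ] {a y : ι → ℝ}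
    {a' y' : κ → ℝ} (ha : ∀ x, 0 ≤ a x) (ha' : ∀ x, 0 ≤ a' x)
    (h : ∀ τ, (∑ x with τ ≤ a x, y x) ≤ ∑ x with τ ≤ a' x, y' x) :
    ∑ x, a x * y x ≤ ∑ x, a' x * y' x := by
  obtain ⟨C, hC⟩ : ∃ C : ℝ, (∀ x, a x ≤ C) ∧ (∀ x, a' x ≤ C) ∧ 0 ≤ C := by
    refine ⟨∑ x, a x + ∑ x, a' x, fun x => ?_, fun x => ?_, ?_⟩
    · have := Finset.single_le_sum (fun i _ => ha i) (Finset.mem_univ x)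
      have := Finset.sum_nonneg fun i (_ : i ∈ Finset.univ) => ha' i
      linarith
    · have := Finset.single_le_sum (fun i _ => ha' i) (Finset.mem_univ x)
      have := Finset.sum_nonneg fun i (_ : i ∈ Finset.univ) => ha i
      linarith
    · exact add_nonneg (Finset.sum_nonneg fun i _ => ha i) (Finset.sum_nonneg fun i _ => ha' i)
  have int1 : ∀ v w : ℝ, IntervalIntegrable (fun τ : ℝ => if τ ≤ v then w else 0)
      MeasureTheory.volume 0 C := by
    intro v w
    rw [intervalIntegrable_iff]
    exact ((intervalIntegrable_iff (f := fun _ : ℝ => w)).1 intervalIntegrable_const).indicator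
      (measurableSet_Iic (a := v))
  have val : ∀ v w : ℝ, 0 ≤ v → v ≤ C → ∫ τ in (0:ℝ)..C, (if τ ≤ v then w else 0) = v * w := by
    intro v w h0 h1
    have := intervalIntegral.integral_indicator (f := fun _ : ℝ => w)
      (μ := MeasureTheory.volume) (Set.mem_Icc.2 ⟨h0, h1⟩)
    simpa [Set.indicator_apply] using this
  have t1 : ∑ x, a x * y x = ∫ τ in (0:ℝ)..C, ∑ x with τ ≤ a x, y x := by
    simp_rw [Finset.sum_filter]
    rw [intervalIntegral.integral_finsetSum fun x _ => int1 _ _]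
    exact Finset.sum_congr rfl fun x _ => (val _ _ (ha x) (hC.1 x)).symm
  have t2 : ∑ x, a' x * y' x = ∫ τ in (0:ℝ)..C, ∑ x with τ ≤ a' x, y' x := by
    simp_rw [Finset.sum_filter]
    rw [intervalIntegral.integral_finsetSum fun x _ => int1 _ _]
    exact Finset.sum_congr rfl fun x _ => (val _ _ (ha' x) (hC.2.1 x)).symm
  rw [t1, t2]
  refine intervalIntegral.integral_mono hC.2.2 ?_ ?_ h
  · simp_rw [Finset.sum_filter]
    simpa only [Finset.sum_fn] using IntervalIntegrable.sum Finset.univ fun x _ => int1 (a x) (y x)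
  · simp_rw [Finset.sum_filter]
    simpa only [Finset.sum_fn] using IntervalIntegrable.sum Finset.univ fun x _ => int1 (a' x) (y' x)

/-! ### Sums over smallest demands -/

/-- The smallest total weight of `p` elements. -/
noncomputable def minSum (d : J → ℝ) (p : ℕ) : ℝ :=
  ⨅ T : {T : Finset J // T.card = p}, ∑ j ∈ T.1, d j

lemma minSum_le (d : J → ℝ) (T : Finset J) : minSum d T.card ≤ ∑ j ∈ T, d j :=
  ciInf_le (Set.finite_range _).bddBelow (⟨T, rfl⟩ : {T' : Finset J // T'.card = T.card})

lemma exists_minSum_eq (d : J → ℝ) {p : ℕ} (hp : p ≤ Fintype.card J) :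
    ∃ T : Finset J, T.card = p ∧ ∑ j ∈ T, d j = minSum d p := by
  obtain ⟨T, -, hT⟩ := Finset.exists_subset_card_eq (s := (Finset.univ : Finset J)) hp
  have : Nonempty {T : Finset J // T.card = p} := ⟨⟨T, hT⟩⟩
  obtain ⟨T', hT'⟩ := exists_eq_ciInf_of_finite
    (f := fun T : {T : Finset J // T.card = p} => ∑ j ∈ T.1, d j)
  exact ⟨T'.1, T'.2, hT'⟩

/-- For p ≤ x ≤ y ≤ q, take optimal sets `T` of size p and `U` of size q and move x - p elements of
`U \ T` from `U` to `T`. The total weight is unchanged. -/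
lemma minSum_balanced_of_le (d : J → ℝ) {p q x y : ℕ} (h : x + y = p + q) (hxy : x ≤ y + 1)
    (hyx : y ≤ x + 1) (hpq : p ≤ q) (hq : q ≤ Fintype.card J) :
    minSum d x + minSum d y ≤ minSum d p + minSum d q := by
  wlog hle : x ≤ y generalizing x y
  · have := this (x := y) (y := x) (by omega) hyx hxy (by omega)
    linarith
  obtain ⟨T, hT, hTs⟩ := exists_minSum_eq d (hpq.trans hq)
  obtain ⟨U, hU, hUs⟩ := exists_minSum_eq d hq
  by_cases hpx : p ≤ x
  · have : x - p ≤ (U \ T).card := by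
      have := Finset.le_card_sdiff T U
      omega
    obtain ⟨A, hA, hAc⟩ := Finset.exists_subset_card_eq this
    have hAU : A ⊆ U := hA.trans Finset.sdiff_subset
    have hAT : Disjoint T A := Finset.disjoint_of_subset_right hA Finset.disjoint_sdiff
    have e1 := minSum_le d (T ∪ A)
    have e2 := minSum_le d (U \ A)
    rw [Finset.card_union_of_disjoint hAT, hT, hAc, Finset.sum_union hAT,
      show p + (x - p) = x by omega] at e1
    rw [Finset.card_sdiff_of_subset hAU, hU, hAc, show q - (x - p) = y by omega] at e2
    have := Finset.sum_sdiff (f := d) hAU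
    linarith
  · have h1 : x = q ∧ y = p ∨ x = p ∧ y = q := by omega
    rcases h1 with ⟨rfl, rfl⟩ | ⟨rfl, rfl⟩ <;> linarith

/-- Balancing the sizes decreases the total of the smallest demands. -/
lemma minSum_balanced (d : J → ℝ) {p q x y : ℕ} (h : x + y = p + q) (hxy : x ≤ y + 1)
    (hyx : y ≤ x + 1) (hp : p ≤ Fintype.card J) (hq : q ≤ Fintype.card J) :
    minSum d x + minSum d y ≤ minSum d p + minSum d q := by
  rcases le_total p q with hpq | hpq
  · exact minSum_balanced_of_le d h hxy hyx hpq hq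
  · rw [add_comm (minSum d p)]
    exact minSum_balanced_of_le d (by omega) hxy hyx hpq hp

/-- Against an optimal set `U` of the same size, `T \ U` and `U \ T` have equally many elements, and
the largest weight in `T \ U` separates them. -/
lemma sum_eq_minSum (d : J → ℝ) {T : Finset J} (h : ∀ j ∈ T, ∀ j' ∉ T, d j ≤ d j') :
    ∑ j ∈ T, d j = minSum d T.card := by
  refine le_antisymm ?_ (minSum_le d T)
  obtain ⟨U, hU, hUs⟩ := exists_minSum_eq d (Finset.card_le_univ T)
  rw [← hUs, ← Finset.sum_sdiff_le_sum_sdiff]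
  have hc : (T \ U).card = (U \ T).card := Finset.card_sdiff_comm hU.symm
  rcases (T \ U).eq_empty_or_nonempty with he | he
  · have : U \ T = ∅ := by rw [← Finset.card_eq_zero, ← hc, he, Finset.card_empty]
    rw [he, this]
  · obtain ⟨m, hm, hmax⟩ := Finset.exists_max_image (T \ U) d he
    calc ∑ j ∈ T \ U, d j ≤ (T \ U).card • d m := Finset.sum_le_card_nsmul _ _ _ hmax
      _ = (U \ T).card • d m := by rw [hc]
      _ ≤ _ := Finset.card_nsmul_le_sum _ _ _ fun j hj =>
        h m (Finset.mem_sdiff.1 hm).1 j (Finset.mem_sdiff.1 hj).2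

/-- A finite set that is totally preordered by two functions has an alternating half. -/
lemma exists_alternating {b c : I → ℝ} (K : Finset I)
    (hK : ∀ i ∈ K, ∀ j ∈ K, c j < c i → b j ≤ b i) :
    ∃ H ⊆ K, ∀ L ⊆ K, (∀ i ∈ L, ∀ j ∈ K, b j ≤ b i → c j ≤ c i → j ∈ L) →
      (L ∩ H).card = (L \ H).card ∨ (L ∩ H).card = (L \ H).card + 1 := by
  induction K using Finset.strongInduction with
  | H K ih =>
    rcases K.eq_empty_or_nonempty with rfl | hne
    · exact ⟨∅, le_rfl, fun L hL _ => by simp [Finset.subset_empty.1 hL]⟩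
    -- By `hK`, an element that maximizes `b + c` maximizes both functions.
    obtain ⟨m, hm, hmax⟩ := Finset.exists_max_image K (fun i => b i + c i) hne
    have htop : ∀ j ∈ K, b j ≤ b m ∧ c j ≤ c m := by
      intro j hj
      have h1 := hmax j hj
      have h2 := hK j hj m hm
      have h3 := hK m hm j hj
      rcases lt_trichotomy (c m) (c j) with h | h | h
      · have := h2 h; constructor <;> linarith
      · constructor <;> linarith
      · exact ⟨h3 h, h.le⟩
    obtain ⟨H, hHK, hH⟩ := ih (K.erase m) (Finset.erase_ssubset hm)
      fun i hi j hj => hK i (Finset.mem_of_mem_erase hi) j (Finset.mem_of_mem_erase hj)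
    have hmH : m ∉ H := fun h => Finset.notMem_erase m K (hHK h)
    have hlow : ∀ L ⊆ K, (∀ i ∈ L, ∀ j ∈ K, b j ≤ b i → c j ≤ c i → j ∈ L) →
        m ∉ L → (L ∩ H).card = (L \ H).card ∨ (L ∩ H).card = (L \ H).card + 1 := by
      intro L hL hL' hmL
      refine hH L (fun i hi => Finset.mem_erase.2 ⟨fun h => hmL (h ▸ hi), hL hi⟩)
        fun i hi j hj => hL' i hi j (Finset.mem_of_mem_erase hj)
    have hfull : ∀ L ⊆ K, (∀ i ∈ L, ∀ j ∈ K, b j ≤ b i → c j ≤ c i → j ∈ L) →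
        m ∈ L → L = insert m (K.erase m) := by
      intro L hL hL' hmL
      rw [Finset.insert_erase hm]
      exact Finset.Subset.antisymm hL fun j hj => hL' m hmL j hj (htop j hj).1 (htop j hj).2
    have hrest := hH (K.erase m) le_rfl fun i _ j hj _ _ => hj
    have hme : m ∉ K.erase m := Finset.notMem_erase m K
    -- The top element `m` joins `H` exactly if the remaining elements are balanced. A lower set
    -- that contains `m` is all of `K`, and the other lower sets are covered by induction.
    by_cases hb : ((K.erase m) ∩ H).card = ((K.erase m) \ H).card
    · refine ⟨insert m H, Finset.insert_subset hm (hHK.trans (Finset.erase_subset _ _)),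
        fun L hL hL' => ?_⟩
      by_cases hmL : m ∈ L
      · right
        rw [hfull L hL hL' hmL, ← Finset.insert_inter_distrib, Finset.insert_sdiff_insert,
          Finset.sdiff_insert_of_notMem hme, Finset.card_insert_of_notMem (by simp [hmH]), hb]
      · rw [Finset.inter_insert_of_notMem hmL, Finset.sdiff_insert_of_notMem hmL]
        exact hlow L hL hL' hmL
    · refine ⟨H, hHK.trans (Finset.erase_subset _ _), fun L hL hL' => ?_⟩
      by_cases hmL : m ∈ L
      · left
        rw [hfull L hL hL' hmL, Finset.insert_inter_of_notMem hmH, Finset.insert_sdiff_of_notMem _ hmH,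
          Finset.card_insert_of_notMem (by simp [hmH])]
        omega
      · exact hlow L hL hL' hmL

/-! ### Exchange -/

/-- The cost of a supplier if the suppliers in `S` are upgraded. -/
def Problem.unitCost (Q : Problem ℝ I J) (S : Finset I) (i : I) : ℝ :=
  if i ∈ S then Q.b i else Q.c i

lemma Problem.unitCost_nonneg (Q : Problem ℝ I J) (S : Finset I) (i : I) : 0 ≤ Q.unitCost S i := by
  unfold Problem.unitCost
  split_ifs
  · exact Q.b_nonneg i
  · exact (Q.b_nonneg i).trans (Q.b_le_c i)

/-- The number of suppliers of cost at least `τ`. -/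
noncomputable def Problem.level (Q : Problem ℝ I J) (S : Finset I) (τ : ℝ) : ℕ :=
  (Finset.univ.filter fun i => τ ≤ Q.unitCost S i).card

lemma Problem.minSum_level_le (Q : Problem ℝ I J) (M : (I ≃ J) × Finset I) (τ : ℝ) :
    minSum Q.d (Q.level M.2 τ) ≤ ∑ i with τ ≤ Q.unitCost M.2 i, Q.d (M.1 i) := by
  have := minSum_le Q.d ((Finset.univ.filter fun i => τ ≤ Q.unitCost M.2 i).map M.1.toEmbedding)
  simpa [Problem.level] using this

/-- In a cheapest matching for given upgrades, the most expensive suppliers get the smallest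
demands. -/
lemma Problem.sum_eq_minSum_level (Q : Problem ℝ I J) {M : (I ≃ J) × Finset I}
    (hM : ∀ σ, Q.matchingCost M ≤ Q.matchingCost (σ, M.2)) (τ : ℝ) :
    ∑ i with τ ≤ Q.unitCost M.2 i, Q.d (M.1 i) = minSum Q.d (Q.level M.2 τ) := by
  have := sum_eq_minSum Q.d
    (T := (Finset.univ.filter fun i => τ ≤ Q.unitCost M.2 i).map M.1.toEmbedding) (by
      intro j hj j' hj'
      obtain ⟨i, rfl⟩ := M.1.surjective j
      obtain ⟨i', rfl⟩ := M.1.surjective j'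
      simp only [Finset.mem_map_equiv, Equiv.symm_apply_apply, Finset.mem_filter,
        Finset.mem_univ, true_and, not_le] at hj hj'
      have hne : i ≠ i' := by rintro rfl; exact absurd hj (not_le.2 hj')
      -- Swapping the customers of a more expensive and a cheaper supplier does not help, so the
      -- difference of costs and the difference of demands have a product of known sign.
      have h := hM ((Equiv.swap i i').trans M.1)
      rw [← sub_nonneg] at h
      unfold Problem.matchingCost at h
      rw [← Finset.sum_sub_distrib, Fintype.sum_eq_add i i' hne] at h
      · simp only [Equiv.trans_apply, Equiv.swap_apply_left, Equiv.swap_apply_right] at h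
        change 0 ≤ Q.unitCost M.2 i * _ - Q.unitCost M.2 i * _ +
          (Q.unitCost M.2 i' * _ - Q.unitCost M.2 i' * _) at h
        have h' : 0 ≤ (Q.unitCost M.2 i - Q.unitCost M.2 i') * (Q.d (M.1 i') - Q.d (M.1 i)) := by
          linarith
        exact sub_nonneg.1 (nonneg_of_mul_nonneg_right h' (by linarith))
      · rintro x ⟨hx, hx'⟩
        simp [Equiv.swap_apply_of_ne_of_ne hx hx'])
  simpa [Problem.level] using this

lemma Problem.level_le (Q : Problem ℝ I J) (S : Finset I) (τ : ℝ) :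
    Q.level S τ ≤ Fintype.card J := by
  rw [← Q.card_eq]
  exact Finset.card_le_univ _

/-- Both pairs of matchings are viewed as weighted sums over `I ⊕ I` and compared on superlevel
sets. There `T`, `T'` attain the smallest possible demand sums, of balanced sizes. -/
lemma Problem.cost_add_cost_le (Q : Problem ℝ I J) {M M' T T' : (I ≃ J) × Finset I}
    (hT : ∀ σ, Q.matchingCost T ≤ Q.matchingCost (σ, T.2))
    (hT' : ∀ σ, Q.matchingCost T' ≤ Q.matchingCost (σ, T'.2))
    (hsum : ∀ τ, Q.level T.2 τ + Q.level T'.2 τ = Q.level M.2 τ + Q.level M'.2 τ)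
    (h1 : ∀ τ, Q.level T.2 τ ≤ Q.level T'.2 τ + 1)
    (h2 : ∀ τ, Q.level T'.2 τ ≤ Q.level T.2 τ + 1) :
    Q.matchingCost T + Q.matchingCost T' ≤ Q.matchingCost M + Q.matchingCost M' := by
  have := sum_mul_le_sum_mul_of_superlevel
    (a := Sum.elim (Q.unitCost T.2) (Q.unitCost T'.2))
    (y := Sum.elim (fun i => Q.d (T.1 i)) (fun i => Q.d (T'.1 i)))
    (a' := Sum.elim (Q.unitCost M.2) (Q.unitCost M'.2))
    (y' := Sum.elim (fun i => Q.d (M.1 i)) (fun i => Q.d (M'.1 i)))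
    (by rintro (x | x) <;> exact Q.unitCost_nonneg _ _)
    (by rintro (x | x) <;> exact Q.unitCost_nonneg _ _) (by
      intro τ
      have e : ∀ f g u v : I → ℝ, (∑ x with τ ≤ Sum.elim f g x, Sum.elim u v x) =
          (∑ x with τ ≤ f x, u x) + ∑ x with τ ≤ g x, v x := fun f g u v => by
        rw [Finset.sum_filter, Fintype.sum_sum_type, Finset.sum_filter, Finset.sum_filter]
        rfl
      rw [e, e, Q.sum_eq_minSum_level hT, Q.sum_eq_minSum_level hT']
      refine (minSum_balanced Q.d (hsum τ) (h1 τ) (h2 τ) (Q.level_le _ _) (Q.level_le _ _)).trans ?_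
      exact add_le_add (Q.minSum_level_le M τ) (Q.minSum_level_le M' τ))
  simpa [Fintype.sum_sum_type, Problem.matchingCost, Problem.unitCost] using this

lemma Problem.exists_cheapest (Q : Problem ℝ I J) (S : Finset I) :
    ∃ σ : I ≃ J, ∀ σ', Q.matchingCost (σ, S) ≤ Q.matchingCost (σ', S) := by
  have : Nonempty (I ≃ J) := ⟨Fintype.equivOfCardEq Q.card_eq⟩
  exact Finite.exists_min fun σ : I ≃ J => Q.matchingCost (σ, S)

/-- Two optimal solutions of the Lagrangian relaxation for a positive price can be exchanged for
two optimal solutions whose numbers of upgrades are balanced. -/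
theorem Problem.IsPenalizedMin.exchange {Q : Problem ℝ I J} {r : ℝ} {M M' : (I ≃ J) × Finset I}
    (hM : Q.IsPenalizedMin r M) (hM' : Q.IsPenalizedMin r M') (hr : 0 < r) :
    ∃ T T' : (I ≃ J) × Finset I, Q.IsPenalizedMin r T ∧ Q.IsPenalizedMin r T' ∧
      T.2.card + T'.2.card = M.2.card + M'.2.card ∧ T.2.card ≤ T'.2.card + 1 ∧
      T'.2.card ≤ T.2.card + 1 ∧ (T.2 = T'.2 → M.2 = M'.2) := by
  set K := symmDiff M.2 M'.2 with hK
  have hKm : ∀ i, i ∈ K ↔ (i ∈ M.2 ∧ i ∉ M'.2) ∨ (i ∈ M'.2 ∧ i ∉ M.2) := fun i => by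
    rw [hK, Finset.mem_symmDiff]
  obtain ⟨H, hHK, hH⟩ := exists_alternating (b := Q.b) (c := Q.c) K (fun i hi j hj hc => by
    rw [hKm] at hi hj
    exact hM.chain hM' hr (by tauto) (by tauto) hc)
  obtain ⟨σ, hσ⟩ := Q.exists_cheapest ((M.2 ∩ M'.2) ∪ H)
  obtain ⟨σ', hσ'⟩ := Q.exists_cheapest ((M.2 ∩ M'.2) ∪ (K \ H))
  have hHm : ∀ i, i ∈ H → (i ∈ M.2 ∧ i ∉ M'.2) ∨ (i ∈ M'.2 ∧ i ∉ M.2) :=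
    fun i hi => (hKm i).1 (hHK hi)
  -- All counting identities below are checked supplier by supplier, and only these six membership
  -- patterns occur.
  have hcases : ∀ i, (i ∈ M.2 ∧ i ∈ M'.2 ∧ i ∉ H) ∨ (i ∉ M.2 ∧ i ∉ M'.2 ∧ i ∉ H) ∨
      (i ∈ M.2 ∧ i ∉ M'.2 ∧ i ∈ H) ∨ (i ∈ M.2 ∧ i ∉ M'.2 ∧ i ∉ H) ∨
      (i ∉ M.2 ∧ i ∈ M'.2 ∧ i ∈ H) ∨ (i ∉ M.2 ∧ i ∈ M'.2 ∧ i ∉ H) := fun i => by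
    have := hHm i
    tauto
  have hcard : ((M.2 ∩ M'.2) ∪ H).card + ((M.2 ∩ M'.2) ∪ (K \ H)).card
      = M.2.card + M'.2.card := by
    have e : ∀ S : Finset I, S.card = ∑ i, if i ∈ S then 1 else 0 := fun S => by simp
    rw [e, e, e M.2, e M'.2, ← Finset.sum_add_distrib, ← Finset.sum_add_distrib]
    refine Finset.sum_congr rfl fun i _ => ?_
    rcases hcases i with h | h | h | h | h | h <;> simp [h, hKm, add_comm]
  have hdiff : ((M.2 ∩ M'.2) ∪ H).card + (K \ H).card
      = ((M.2 ∩ M'.2) ∪ (K \ H)).card + (K ∩ H).card := by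
    have e : ∀ S : Finset I, S.card = ∑ i, if i ∈ S then 1 else 0 := fun S => by simp
    rw [e, e (K \ H), e (_ ∪ (K \ H)), e (K ∩ H), ← Finset.sum_add_distrib,
      ← Finset.sum_add_distrib]
    refine Finset.sum_congr rfl fun i _ => ?_
    rcases hcases i with h | h | h | h | h | h <;> simp [h, hKm, add_comm]
  have hlev : ∀ τ, Q.level ((M.2 ∩ M'.2) ∪ H) τ + Q.level ((M.2 ∩ M'.2) ∪ (K \ H)) τ
      = Q.level M.2 τ + Q.level M'.2 τ := by
    intro τ
    unfold Problem.level Problem.unitCost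
    simp_rw [Finset.card_filter]
    rw [← Finset.sum_add_distrib, ← Finset.sum_add_distrib]
    refine Finset.sum_congr rfl fun i _ => ?_
    rcases hcases i with h | h | h | h | h | h <;> simp [h, hKm, add_comm]
  -- A supplier in `H` costs `b` for the first new set and `c` for the second, one in `K \ H` the
  -- reverse. So the two levels differ by the surplus of `H` over `K \ H` on `c < τ`, minus that on
  -- `b < τ`. Both are lower sets, so both surpluses are 0 or 1.
  have hld : ∀ τ, Q.level ((M.2 ∩ M'.2) ∪ H) τ + (((K.filter fun i => Q.b i < τ) ∩ H).card
      + ((K.filter fun i => Q.c i < τ) \ H).card)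
      = Q.level ((M.2 ∩ M'.2) ∪ (K \ H)) τ + (((K.filter fun i => Q.b i < τ) \ H).card
      + ((K.filter fun i => Q.c i < τ) ∩ H).card) := by
    intro τ
    have e : ∀ S : Finset I, S.card = ∑ i, if i ∈ S then 1 else 0 := fun S => by simp
    unfold Problem.level Problem.unitCost
    rw [e (_ ∩ H), e (_ \ H), e (_ \ H), e (_ ∩ H)]
    simp_rw [Finset.card_filter]
    rw [← Finset.sum_add_distrib, ← Finset.sum_add_distrib, ← Finset.sum_add_distrib,
      ← Finset.sum_add_distrib]
    refine Finset.sum_congr rfl fun i _ => ?_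
    have h5 := Q.b_le_c i
    by_cases hb : Q.b i < τ <;> by_cases hc : Q.c i < τ
    · rcases hcases i with h | h | h | h | h | h <;> simp [h, hKm, hb, hc, not_le.2 hb, not_le.2 hc, add_comm]
    · rcases hcases i with h | h | h | h | h | h <;> simp [h, hKm, hb, hc, not_le.2 hb, not_lt.1 hc, add_comm]
    · exact absurd (h5.trans_lt hc) hb
    · rcases hcases i with h | h | h | h | h | h <;> simp [h, hKm, hb, hc, not_lt.1 hb, not_lt.1 hc, add_comm]
  have hlow : ∀ τ, _ ∧ _ := fun τ =>
    ⟨hH (K.filter fun i => Q.b i < τ) (Finset.filter_subset _ _) (fun i hi j hj hb _ =>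
      Finset.mem_filter.2 ⟨hj, hb.trans_lt (Finset.mem_filter.1 hi).2⟩),
    hH (K.filter fun i => Q.c i < τ) (Finset.filter_subset _ _) (fun i hi j hj _ hc =>
      Finset.mem_filter.2 ⟨hj, hc.trans_lt (Finset.mem_filter.1 hi).2⟩)⟩
  have hKK := hH K le_rfl fun i _ j hj _ _ => hj
  have hle := Q.cost_add_cost_le (M := M) (M' := M') (T := (σ, (M.2 ∩ M'.2) ∪ H))
    (T' := (σ', (M.2 ∩ M'.2) ∪ (K \ H))) hσ hσ' hlev
    (fun τ => by have := hld τ; have := hlow τ; dsimp only; omega)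
    (fun τ => by have := hld τ; have := hlow τ; dsimp only; omega)
  have hE : Q.penalized r M' = Q.penalized r M := le_antisymm (hM' _) (hM _)
  have hT := hM (σ, (M.2 ∩ M'.2) ∪ H)
  have hT' := hM (σ', (M.2 ∩ M'.2) ∪ (K \ H))
  -- The new costs add up to at most the old ones and the new counts to the same, so neither new
  -- solution can lie above the optimum.
  have hcr : r * (((M.2 ∩ M'.2) ∪ H).card : ℝ) + r * (((M.2 ∩ M'.2) ∪ (K \ H)).card : ℝ)
      = r * (M.2.card : ℝ) + r * (M'.2.card : ℝ) := by
    rw [← mul_add, ← mul_add]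
    congr 1
    exact_mod_cast hcard
  refine ⟨(σ, (M.2 ∩ M'.2) ∪ H), (σ', (M.2 ∩ M'.2) ∪ (K \ H)), fun X => ?_, fun X => ?_, hcard,
    by dsimp only; omega, by dsimp only; omega, fun h => ?_⟩
  · have := hM X
    unfold Problem.penalized at *
    dsimp only at *
    linarith
  · have := hM X
    unfold Problem.penalized at *
    dsimp only at *
    linarith
  -- Equal new sets mean `H = K \ H`, which forces `K` to be empty.
  · ext i
    have h' := Finset.ext_iff.1 h i
    have := hHm i
    simp only [Finset.mem_union, Finset.mem_inter, Finset.mem_sdiff, hKm] at h'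
    tauto

end Matchings

end Upgrade

/-! ### Convexity in the number of upgrades, and integral optimal vertices -/

namespace Upgrade

set_option linter.unusedSectionVars false

/-- If a function lies above one of its chords, some chord supports the other values from below. -/
lemma exists_supporting_chord {f : ℕ → ℝ} {n k j₀ l₀ : ℕ} (hj₀ : j₀ < k) (hl₀ : k < l₀)
    (hn : l₀ ≤ n) (h : ((l₀ : ℝ) - k) * f j₀ + (k - j₀) * f l₀ < (l₀ - j₀) * f k) :
    ∃ (r : ℝ) (j l : ℕ), j < k ∧ k < l ∧ l ≤ n ∧ (∀ x ≤ n, f j + r * j ≤ f x + r * x) ∧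
      f l + r * l = f j + r * j ∧ f j + r * j < f k + r * k := by
  -- `v (x, y)` is the height above `k` of the chord from `x` to `y`. The lowest such chord supports
  -- `f`, and `r` is minus its slope.
  set v : ℕ × ℕ → ℝ := fun p =>
    (((p.2 : ℝ) - k) * f p.1 + (k - p.1) * f p.2) / (p.2 - p.1) with hv
  obtain ⟨⟨j, l⟩, hjl, hmin⟩ := Finset.exists_min_image
    (Finset.range k ×ˢ Finset.Ioc k n) v ⟨(j₀, l₀), by simp; omega⟩
  simp only [Finset.mem_product, Finset.mem_range, Finset.mem_Ioc] at hjl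
  obtain ⟨hj, hl, hln⟩ := hjl
  have hmin' : ∀ x y, x < k → k < y → y ≤ n → v (j, l) ≤ v (x, y) := fun x y hx hy hyn =>
    hmin (x, y) (by simp; omega)
  have c1 : (j : ℝ) < k := by exact_mod_cast hj
  have c2 : (k : ℝ) < l := by exact_mod_cast hl
  set r : ℝ := (f j - f l) / (l - j) with hr
  have hrl : f l = f j - r * (l - j) := by
    rw [hr]; field_simp [show (l : ℝ) - j ≠ 0 by linarith]; ring
  have hvjl : v (j, l) = f j - r * (k - j) := by
    simp only [hv]
    rw [div_eq_iff (by linarith), hrl]; ring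
  have hk : f j + r * j < f k + r * k := by
    have h1 := hmin' j₀ l₀ hj₀ hl₀ hn
    have d1 : (j₀ : ℝ) < k := by exact_mod_cast hj₀
    have d2 : (k : ℝ) < l₀ := by exact_mod_cast hl₀
    have h2 : v (j₀, l₀) < f k := by
      simp only [hv]
      rw [div_lt_iff₀ (by linarith)]
      linarith
    linarith
  refine ⟨r, j, l, hj, hl, hln, fun x hx => ?_, by rw [hrl]; ring, hk⟩
  rcases lt_trichotomy x k with hxk | rfl | hxk
  · have d1 : (x : ℝ) < k := by exact_mod_cast hxk
    have h1 := hmin' x l hxk hl hln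
    rw [hvjl] at h1
    simp only [hv] at h1
    rw [le_div_iff₀ (by linarith), hrl] at h1
    have : 0 ≤ ((l : ℝ) - k) * (f x + r * x - (f j + r * j)) := by linarith
    linarith [nonneg_of_mul_nonneg_right this (by linarith)]
  · exact hk.le
  · have d1 : (k : ℝ) < x := by exact_mod_cast hxk
    have h1 := hmin' j x hj hxk hx
    rw [hvjl] at h1
    simp only [hv] at h1
    rw [le_div_iff₀ (by linarith)] at h1
    have : 0 ≤ ((k : ℝ) - j) * (f x + r * x - (f j + r * j)) := by linarith
    linarith [nonneg_of_mul_nonneg_right this (by linarith)]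

section MinCost

variable {I J : Type*} [Fintype I] [Fintype J] [DecidableEq I] [DecidableEq J]

/-- The smallest cost of a matching with exactly `k` upgrades. -/
noncomputable def Problem.minCost (Q : Problem ℝ I J) (k : ℕ) : ℝ :=
  ⨅ M : {M : (I ≃ J) × Finset I // M.2.card = k}, Q.matchingCost M.1

lemma Problem.minCost_le (Q : Problem ℝ I J) (M : (I ≃ J) × Finset I) :
    Q.minCost M.2.card ≤ Q.matchingCost M :=
  ciInf_le (Set.finite_range _).bddBelow
    (⟨M, rfl⟩ : {M' : (I ≃ J) × Finset I // M'.2.card = M.2.card})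

lemma Problem.exists_minCost (Q : Problem ℝ I J) {k : ℕ} (hk : k ≤ Fintype.card I) :
    ∃ M : (I ≃ J) × Finset I, M.2.card = k ∧ Q.matchingCost M = Q.minCost k := by
  obtain ⟨S, -, hS⟩ := Finset.exists_subset_card_eq (s := (Finset.univ : Finset I)) hk
  have : Nonempty {M : (I ≃ J) × Finset I // M.2.card = k} :=
    ⟨⟨(Fintype.equivOfCardEq Q.card_eq, S), hS⟩⟩
  obtain ⟨M, hM⟩ := exists_eq_ciInf_of_finite
    (f := fun M : {M : (I ≃ J) × Finset I // M.2.card = k} => Q.matchingCost M.1)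
  exact ⟨M.1, M.2, hM⟩

lemma Problem.minCost_succ_le (Q : Problem ℝ I J) {k : ℕ} (hk : k < Fintype.card I) :
    Q.minCost (k + 1) ≤ Q.minCost k := by
  obtain ⟨M, hMk, hM⟩ := Q.exists_minCost hk.le
  obtain ⟨i, hi⟩ : ∃ i, i ∉ M.2 := by
    by_contra! h
    rw [Finset.eq_univ_of_forall h, Finset.card_univ] at hMk
    omega
  have h1 := Q.minCost_le (M.1, insert i M.2)
  rw [Finset.card_insert_of_notMem hi, hMk] at h1
  refine h1.trans (le_trans ?_ hM.le)
  refine Finset.sum_le_sum fun x _ => mul_le_mul_of_nonneg_right ?_ (Q.d_nonneg _)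
  have := Q.b_le_c x
  by_cases hx : x ∈ M.2
  · simp [hx]
  · simp only [Finset.mem_insert, hx, or_false, if_false]
    split_ifs <;> linarith

lemma Problem.minCost_antitone (Q : Problem ℝ I J) {j k : ℕ} (hjk : j ≤ k)
    (hk : k ≤ Fintype.card I) : Q.minCost k ≤ Q.minCost j := by
  induction k, hjk using Nat.le_induction with
  | base => exact le_rfl
  | succ k _ ih => exact (Q.minCost_succ_le (by omega)).trans (ih (by omega))

/-- Sorting the matchings by their number of upgrades reduces the relaxation to a question about the
single function `minCost`. -/
lemma Problem.isPenalizedMin_iff (Q : Problem ℝ I J) (r : ℝ) (M : (I ≃ J) × Finset I) :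
    Q.IsPenalizedMin r M ↔ Q.matchingCost M = Q.minCost M.2.card ∧
      ∀ j ≤ Fintype.card I, Q.minCost M.2.card + r * M.2.card ≤ Q.minCost j + r * j := by
  constructor
  · intro h
    have h1 : Q.matchingCost M = Q.minCost M.2.card := by
      obtain ⟨M', hc, hM'⟩ := Q.exists_minCost (Finset.card_le_univ M.2)
      have := h M'
      unfold Problem.penalized at this
      rw [hc, hM'] at this
      exact le_antisymm (by linarith) (Q.minCost_le M)
    refine ⟨h1, fun j hj => ?_⟩
    obtain ⟨M', hc, hM'⟩ := Q.exists_minCost hj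
    have := h M'
    unfold Problem.penalized at this
    rwa [hc, hM', h1] at this
  · rintro ⟨h1, h2⟩ M'
    have h3 := h2 M'.2.card (Finset.card_le_univ _)
    have h4 := Q.minCost_le M'
    unfold Problem.penalized
    linarith

/-- The numbers of upgrades of the optimal solutions of the Lagrangian relaxation for a positive
price have no gaps. -/
lemma Problem.IsPenalizedMin.exists_between {Q : Problem ℝ I J} {r : ℝ} (hr : 0 < r)
    {M M' : (I ≃ J) × Finset I} (hM : Q.IsPenalizedMin r M) (hM' : Q.IsPenalizedMin r M') {k : ℕ}
    (h1 : M.2.card ≤ k) (h2 : k ≤ M'.2.card) :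
    ∃ T : (I ≃ J) × Finset I, Q.IsPenalizedMin r T ∧ T.2.card = k := by
  induction hN : M'.2.card - M.2.card using Nat.strong_induction_on generalizing M M' with
  | _ N ih =>
    by_cases e1 : M.2.card = k
    · exact ⟨M, hM, e1⟩
    by_cases e2 : M'.2.card = k
    · exact ⟨M', hM', e2⟩
    -- Here `k` lies strictly between the two counts, so these differ by at least two and the
    -- balanced counts fall strictly between them.
    obtain ⟨T, T', hT, hT', hs, b1, b2, -⟩ := hM.exchange hM' hr
    rcases le_total T.2.card k with h | h
    · exact ih (M'.2.card - T.2.card) (by omega) hT hM' h h2 rfl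
    · exact ih (T.2.card - M.2.card) (by omega) hM hT h1 h rfl

/-- A violated chord inequality would yield a price at which two counts around `k` are optimal and
`k` is not. The price is positive since `minCost` is antitone, so `exists_between` contradicts this.
-/
lemma Problem.minCost_chord (Q : Problem ℝ I J) {j k l : ℕ} (hj : j < k) (hl : k < l)
    (hn : l ≤ Fintype.card I) :
    ((l : ℝ) - j) * Q.minCost k ≤ (l - k) * Q.minCost j + (k - j) * Q.minCost l := by
  by_contra! h
  obtain ⟨r, j, l, hj, hl, hn, hmin, heq, hlt⟩ := exists_supporting_chord hj hl hn h
  have hr : 0 < r := by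
    have h1 := Q.minCost_antitone hj.le (hl.le.trans hn)
    have h2 : (j : ℝ) < k := by exact_mod_cast hj
    have h3 : 0 < r * (k - j) := by linarith
    exact pos_of_mul_pos_left h3 (by linarith)
  obtain ⟨M, hMc, hM⟩ := Q.exists_minCost (show j ≤ Fintype.card I by omega)
  obtain ⟨M', hMc', hM'⟩ := Q.exists_minCost hn
  have o : Q.IsPenalizedMin r M := (Q.isPenalizedMin_iff r M).2 (by rw [hMc]; exact ⟨hM, hmin⟩)
  have o' : Q.IsPenalizedMin r M' :=
    (Q.isPenalizedMin_iff r M').2 (by rw [hMc', heq]; exact ⟨hM', hmin⟩)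
  obtain ⟨T, hT, hTk⟩ := o.exists_between (k := k) hr o' (by rw [hMc]; exact hj.le) (by rw [hMc']; exact hl.le)
  have h1 := ((Q.isPenalizedMin_iff r T).1 hT).2 j (by omega)
  rw [hTk] at h1
  linarith

/-- The smallest cost is a convex function of the number of upgrades. -/
lemma Problem.exists_price (Q : Problem ℝ I J) {k : ℕ} (hk : k ≤ Fintype.card I) :
    ∃ r : ℝ, 0 ≤ r ∧ ∀ j ≤ Fintype.card I, Q.minCost k + r * k ≤ Q.minCost j + r * j := by
  rcases hk.eq_or_lt with rfl | hlt
  · exact ⟨0, le_rfl, fun j hj => by simpa using Q.minCost_antitone hj le_rfl⟩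
  -- The slope to the right of `k` is a supporting one. For `k = |I|` there is none, and the price 0
  -- served instead.
  refine ⟨Q.minCost k - Q.minCost (k + 1), sub_nonneg.2 (Q.minCost_succ_le hlt), fun j hj => ?_⟩
  rcases lt_trichotomy j k with h | rfl | h
  · have := Q.minCost_chord h (Nat.lt_succ_self k) hlt
    push_cast at this
    linarith
  · exact le_rfl
  · rcases (Nat.succ_le_of_lt h).eq_or_lt with rfl | h
    · push_cast; linarith
    · have := Q.minCost_chord (Nat.lt_succ_self k) h hj
      push_cast at this
      linarith

/-- A cheapest matching with exactly `k` upgrades is an optimal vertex of `P(k)`. -/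
theorem Problem.isOptimalVertex_matchingPoint (Q : Problem ℝ I J) {M : (I ≃ J) × Finset I}
    (hk : M.2.card = Q.k) (hM : ∀ M' : (I ≃ J) × Finset I, M'.2.card = Q.k →
      Q.matchingCost M ≤ Q.matchingCost M') :
    Q.IsOptimalVertex (matchingPoint M) := by
  have hmin : Q.matchingCost M = Q.minCost Q.k := by
    obtain ⟨M', h1, h2⟩ := Q.exists_minCost Q.k_le
    exact le_antisymm ((hM M' h1).trans h2.le) (hk ▸ Q.minCost_le M)
  obtain ⟨r, hr, hrk⟩ := Q.exists_price Q.k_le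
  have hP : Q.IsPenalizedMin r M := (Q.isPenalizedMin_iff r M).2 (by rw [hk]; exact ⟨hmin, hrk⟩)
  have hmem : matchingPoint M ∈ polytope I J Q.k :=
    ⟨matchingPoint_mem M, by rw [sum_matchingPoint_fst, hk]⟩
  refine ⟨⟨hmem, ?_⟩, fun z hz => ?_⟩
  -- The row sums keep the polytope inside the unit cube, of which a point with 0/1 coordinates is a
  -- vertex.
  · rintro p ⟨⟨-, hp, hp1, hp2⟩, -⟩ q ⟨⟨-, hq, hq1, hq2⟩, -⟩ ⟨s, t, hs, ht, hst, hpq⟩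
    have ub : ∀ z : Point I J, (∀ i, ∑ j, (z.1 (i, j) + z.2 (i, j)) = 1) → (∀ e, 0 ≤ z.1 e) →
        (∀ e, 0 ≤ z.2 e) → ∀ e, z.1 e ≤ 1 ∧ z.2 e ≤ 1 := by
      rintro z h h1 h2 ⟨i, j⟩
      have := Finset.single_le_sum (f := fun j => z.1 (i, j) + z.2 (i, j))
        (fun j _ => add_nonneg (h1 _) (h2 _)) (Finset.mem_univ j)
      rw [h i] at this
      have := h1 (i, j)
      have := h2 (i, j)
      constructor <;> linarith
    have key : ∀ x a b : ℝ, (x = 0 ∨ x = 1) → 0 ≤ a → a ≤ 1 → 0 ≤ b → b ≤ 1 →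
        s * a + t * b = x → a = x := by
      rintro x a b (rfl | rfl) a0 a1 b0 b1 h
      · have := mul_nonneg ht.le b0
        have h' : s * a = 0 := le_antisymm (by linarith) (mul_nonneg hs.le a0)
        exact (mul_eq_zero.1 h').resolve_left hs.ne'
      · have : 0 ≤ t * (1 - b) := mul_nonneg ht.le (by linarith)
        have h' : s * (1 - a) ≤ 0 := by linarith
        exact le_antisymm a1 (by nlinarith)
    have hp' := ub p hp hp1 hp2
    have hq' := ub q hq hq1 hq2
    refine Prod.ext (funext fun e => ?_) (funext fun e => ?_)
    · refine key _ _ (q.1 e) ?_ (hp1 e) (hp' e).1 (hq1 e) (hq' e).1 ?_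
      · simp only [matchingPoint]; split_ifs <;> simp
      · exact congrFun (congrArg Prod.fst hpq) e
    · refine key _ _ (q.2 e) ?_ (hp2 e) (hp' e).2 (hq2 e) (hq' e).2 ?_
      · simp only [matchingPoint]; split_ifs <;> simp
      · exact congrFun (congrArg Prod.snd hpq) e
  -- Weak duality: on `P(k)` the price term is at most `r * k`, which is what `M` pays.
  · have h1 := hP.le hz.1
    have h2 := mul_le_mul_of_nonneg_left hz.2 hr
    change Q.objective (matchingPoint M) ≤ Q.objective z
    rw [objective_matchingPoint]
    unfold Problem.penalized at h1
    rw [hk] at h1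
    linarith

lemma isIntegral_matchingPoint (M : (I ≃ J) × Finset I) : IsIntegral (matchingPoint M) := by
  constructor <;> intro e <;> simp only [matchingPoint] <;> split_ifs
  exacts [⟨1, by simp⟩, ⟨0, by simp⟩, ⟨1, by simp⟩, ⟨0, by simp⟩]

theorem Problem.exists_integral_optimalVertex (Q : Problem ℝ I J) :
    ∃ z, Q.IsOptimalVertex z ∧ IsIntegral z := by
  obtain ⟨M, h1, h2⟩ := Q.exists_minCost Q.k_le
  exact ⟨_, Q.isOptimalVertex_matchingPoint h1 fun M' h => by
    rw [h2, ← h]; exact Q.minCost_le M', isIntegral_matchingPoint M⟩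

end MinCost

/-! ### A fractional optimal vertex -/

/-- Two suppliers and two customers, of whom one supplier may be upgraded: every upgrade saves
one unit of cost. -/
def halfProblem : Problem ℝ (Fin 2) (Fin 2) where
  b _ := 0
  c _ := 1
  d _ := 1
  k := 1
  b_nonneg _ := le_rfl
  b_le_c _ := zero_le_one
  d_nonneg _ := zero_le_one
  card_eq := rfl
  k_le := by simp

/-- The midpoint of the red matching off the diagonal and the blue matching on the diagonal. -/
noncomputable def halfPoint : Point (Fin 2) (Fin 2) :=
  (fun e => if e.1 = e.2 then 0 else 1 / 2, fun e => if e.1 = e.2 then 1 / 2 else 0)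

/-- The ends of a segment through the point share its zeros. The row and column equations then leave
one free parameter, the common value of the two red edges, and the budget bounds it by 1/2 at both
ends. The objective is 2 minus the red mass, so it is at least 1 on `P(1)`. -/
lemma halfPoint_isOptimalVertex : halfProblem.IsOptimalVertex halfPoint := by
  refine ⟨⟨⟨⟨fun j => ?_, fun i => ?_, fun e => ?_, fun e => ?_⟩, ?_⟩, ?_⟩, ?_⟩
  · fin_cases j <;> simp [halfPoint] <;> norm_num
  · fin_cases i <;> simp [halfPoint] <;> norm_num
  · simp only [halfPoint]; split_ifs <;> norm_num
  · simp only [halfPoint]; split_ifs <;> norm_num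
  · simp [halfPoint, halfProblem, Fintype.sum_prod_type]; norm_num
  · rintro p ⟨⟨hpc, hpr, hp1, hp2⟩, hpk⟩ q ⟨⟨hqc, hqr, hq1, hq2⟩, hqk⟩ ⟨s, t, hs, ht, hst, hpq⟩
    have e1 : ∀ e, s * p.1 e + t * q.1 e = if e.1 = e.2 then 0 else 1 / 2 := fun e =>
      congrFun (congrArg Prod.fst hpq) e
    have e2 : ∀ e, s * p.2 e + t * q.2 e = if e.1 = e.2 then 1 / 2 else 0 := fun e =>
      congrFun (congrArg Prod.snd hpq) e
    have key : ∀ a b : ℝ, 0 ≤ a → 0 ≤ b → s * a + t * b = 0 → a = 0 ∧ b = 0 := by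
      intro a b a0 b0 h
      have h1 := mul_nonneg hs.le a0
      have h2 := mul_nonneg ht.le b0
      exact ⟨(mul_eq_zero.1 (show s * a = 0 by linarith)).resolve_left hs.ne',
        (mul_eq_zero.1 (show t * b = 0 by linarith)).resolve_left ht.ne'⟩
    have z1 := key _ _ (hp1 (0, 0)) (hq1 (0, 0)) (by simpa using e1 (0, 0))
    have z2 := key _ _ (hp1 (1, 1)) (hq1 (1, 1)) (by simpa using e1 (1, 1))
    have z3 := key _ _ (hp2 (0, 1)) (hq2 (0, 1)) (by simpa using e2 (0, 1))
    have z4 := key _ _ (hp2 (1, 0)) (hq2 (1, 0)) (by simpa using e2 (1, 0))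
    have pr0 := hpr 0
    have pr1 := hpr 1
    have pc0 := hpc 0
    have qr0 := hqr 0
    have qr1 := hqr 1
    have qc0 := hqc 0
    simp only [Fin.sum_univ_two] at pr0 pr1 pc0 qr0 qr1 qc0
    simp only [Fintype.sum_prod_type, Fin.sum_univ_two, halfProblem, Nat.cast_one] at hpk hqk
    have m := e1 (0, 1)
    simp only [Fin.isValue, zero_ne_one, if_false] at m
    have a1 : p.1 (0, 1) ≤ 1 / 2 := by linarith
    have a2 : q.1 (0, 1) ≤ 1 / 2 := by linarith
    have a3 : p.1 (0, 1) = 1 / 2 := by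
      have : t * q.1 (0, 1) ≤ t * (1 / 2) := mul_le_mul_of_nonneg_left a2 ht.le
      have : s * (1 / 2 - p.1 (0, 1)) ≤ 0 := by linarith
      exact le_antisymm a1 (by nlinarith)
    refine Prod.ext (funext fun e => ?_) (funext fun e => ?_) <;> obtain ⟨i, j⟩ := e <;>
      fin_cases i <;> fin_cases j <;> simp [halfPoint] <;> linarith
  · rintro z ⟨⟨hc, hr, h1, h2⟩, hk⟩
    have r0 := hr 0
    have r1 := hr 1
    simp only [Fin.sum_univ_two] at r0 r1
    simp only [Fintype.sum_prod_type, Fin.sum_univ_two, halfProblem, Nat.cast_one] at hk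
    change halfProblem.objective halfPoint ≤ halfProblem.objective z
    simp [Problem.objective, halfProblem, halfPoint, Fintype.sum_prod_type]
    linarith

lemma not_isIntegral_halfPoint : ¬ IsIntegral halfPoint := by
  rintro ⟨h, -⟩
  obtain ⟨m, hm⟩ := h (0, 1)
  simp only [halfPoint, Fin.isValue, zero_ne_one, if_false] at hm
  have h2 : ((2 * m : ℤ) : ℝ) = ((1 : ℤ) : ℝ) := by push_cast; linarith
  have := Int.cast_injective h2
  omega

end Upgrade

namespace Upgrade

set_option linter.unusedSectionVars false

/-! ### Strict convexity and half-integral prices -/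

section Generic

variable {I J : Type*} [Fintype I] [Fintype J] [DecidableEq I] [DecidableEq J]

/-- If the costs determine the upgrades, the smallest cost is strictly decreasing. -/
lemma Problem.minCost_succ_lt {Q : Problem ℝ I J}
    (hgen : ∀ M M', Q.matchingCost M = Q.matchingCost M' → M.2 = M'.2) {k : ℕ}
    (hk : k < Fintype.card I) : Q.minCost (k + 1) < Q.minCost k := by
  refine lt_of_le_of_ne (Q.minCost_succ_le hk) fun h => ?_
  obtain ⟨M, hM, hM'⟩ := Q.exists_minCost hk.le
  obtain ⟨T, hT, hT'⟩ := Q.exists_minCost (show k + 1 ≤ Fintype.card I from hk)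
  have := hgen M T (by rw [hM', hT', h])
  rw [this] at hM
  omega

/-- If the costs determine the upgrades, the smallest cost is strictly convex. -/
lemma Problem.minCost_strictConvex {Q : Problem ℝ I J}
    (hgen : ∀ M M', Q.matchingCost M = Q.matchingCost M' → M.2 = M'.2) {k : ℕ}
    (hk : k + 2 ≤ Fintype.card I) :
    Q.minCost (k + 1) - Q.minCost (k + 2) < Q.minCost k - Q.minCost (k + 1) := by
  have hd := Q.minCost_succ_lt hgen (show k < Fintype.card I by omega)
  obtain ⟨r, hr, hmin⟩ := Q.exists_price (show k + 1 ≤ Fintype.card I by omega)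
  have h1 := hmin k (by omega)
  have h2 := hmin (k + 2) hk
  push_cast at h1 h2
  -- Otherwise both slopes equal `r`, and `k` and `k + 2` are optimal for this price. Exchange gives
  -- two optimal solutions with `k + 1` upgrades, hence of equal cost, hence with equal upgrades; so
  -- the original ones had equal upgrades, which their counts exclude.
  by_contra! hle
  obtain rfl : r = Q.minCost k - Q.minCost (k + 1) := by linarith
  have hmin' : ∀ j ≤ Fintype.card I, Q.minCost (k + 1) + (Q.minCost k - Q.minCost (k + 1)) *
      ((k : ℝ) + 1) ≤ Q.minCost j + (Q.minCost k - Q.minCost (k + 1)) * j := fun j hj => by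
    simpa using hmin j hj
  obtain ⟨M, hMc, hM⟩ := Q.exists_minCost (show k ≤ Fintype.card I by omega)
  obtain ⟨M', hMc', hM'⟩ := Q.exists_minCost hk
  have o := (Q.isPenalizedMin_iff (Q.minCost k - Q.minCost (k + 1)) M).2
    ⟨by rw [hMc, hM], fun j hj => by rw [hMc]; have := hmin' j hj; linarith⟩
  have o' := (Q.isPenalizedMin_iff (Q.minCost k - Q.minCost (k + 1)) M').2
    ⟨by rw [hMc', hM'], fun j hj => by rw [hMc']; have := hmin' j hj; push_cast; linarith⟩
  obtain ⟨T, T', hT, hT', hs, b1, b2, himp⟩ := o.exchange o' (by linarith)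
  have c1 : T.2.card = k + 1 := by omega
  have c2 : T'.2.card = k + 1 := by omega
  have := himp (hgen T T' (by
    rw [((Q.isPenalizedMin_iff _ T).1 hT).1, ((Q.isPenalizedMin_iff _ T').1 hT').1, c1, c2]))
  rw [this] at hMc
  omega

/-- Correctness of the search for the price: at the smallest half-integral price for which at most
`k` suppliers are upgraded, exactly `k` suppliers are upgraded. -/
theorem Problem.card_eq_of_search {Q : Problem ℝ I J}
    (hgen : ∀ M M', Q.matchingCost M = Q.matchingCost M' → M.2 = M'.2)
    (hint : ∀ M, ∃ z : ℤ, Q.matchingCost M = z) {k : ℕ} (hk : k ≤ Fintype.card I) {m : ℤ}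
    {M₀ M : (I ≃ J) × Finset I} (h₀ : Q.IsPenalizedMin (m + 1 / 2) M₀) (hc₀ : M₀.2.card ≤ k)
    (h₁ : m = 0 ∨ ∃ M₁ : (I ≃ J) × Finset I, Q.IsPenalizedMin ((m - 1 : ℤ) + 1 / 2) M₁ ∧
      k < M₁.2.card)
    (hM : Q.IsPenalizedMin (m + 1 / 2) M) : M.2.card = k := by
  have : ∀ j, ∃ z : ℤ, j ≤ Fintype.card I → Q.minCost j = z := by
    intro j
    by_cases hj : j ≤ Fintype.card I
    · obtain ⟨X, -, hX⟩ := Q.exists_minCost hj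
      obtain ⟨z, hz⟩ := hint X
      exact ⟨z, fun _ => by rw [← hX, hz]⟩
    · exact ⟨0, fun h => absurd h hj⟩
  choose F hF using this
  -- The slopes are integers and the price is not, so optimality at the price m + 1/2 means a slope
  -- of at most m to the right and, by `down`, at least m + 1 to the left.
  have up : ∀ (m : ℤ) (X : (I ≃ J) × Finset I), Q.IsPenalizedMin (m + 1 / 2) X →
      X.2.card < Fintype.card I → F X.2.card - F (X.2.card + 1) ≤ m := by
    intro m X hX hlt
    have h := ((Q.isPenalizedMin_iff _ X).1 hX).2 (X.2.card + 1) hlt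
    rw [hF _ hlt.le, hF _ hlt] at h
    push_cast at h
    have h' : ((2 * (F X.2.card - F (X.2.card + 1)) : ℤ) : ℝ) ≤ ((2 * m + 1 : ℤ) : ℝ) := by
      push_cast; linarith
    have := Int.cast_le.1 h'
    omega
  have down : ∀ (m : ℤ) (X : (I ≃ J) × Finset I), Q.IsPenalizedMin (m + 1 / 2) X →
      ∀ r, X.2.card = r + 1 → m + 1 ≤ F r - F (r + 1) := by
    intro m X hX r hr
    have hle := Finset.card_le_univ X.2
    have h := ((Q.isPenalizedMin_iff _ X).1 hX).2 r (by omega)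
    rw [hr, hF (r + 1) (by omega), hF r (by omega)] at h
    push_cast at h
    have h' : ((2 * m + 1 : ℤ) : ℝ) ≤ ((2 * (F r - F (r + 1)) : ℤ) : ℝ) := by
      push_cast; linarith
    have := Int.cast_le.1 h'
    omega
  have pos : ∀ r < Fintype.card I, F (r + 1) < F r := by
    intro r hr
    have := Q.minCost_succ_lt hgen hr
    rw [hF _ hr.le, hF _ hr] at this
    exact_mod_cast this
  have conv : ∀ r s, r < s → s < Fintype.card I → F s - F (s + 1) < F r - F (r + 1) := by
    intro r s hrs
    induction s, hrs using Nat.le_induction with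
    | base =>
      intro hs
      have := Q.minCost_strictConvex hgen (show r + 2 ≤ Fintype.card I by omega)
      rw [hF r (by omega), hF _ hs.le, hF (r + 2) (by omega)] at this
      exact_mod_cast this
    | succ s hs ih =>
      intro h
      have h1 := ih (by omega)
      have := Q.minCost_strictConvex hgen (show s + 2 ≤ Fintype.card I by omega)
      rw [hF s (by omega), hF (s + 1) (by omega), hF (s + 2) (by omega)] at this
      have : F (s + 1) - F (s + 2) < F s - F (s + 1) := by exact_mod_cast this
      exact this.trans h1
  have conv' : ∀ r s, r ≤ s → s < Fintype.card I → F s - F (s + 1) ≤ F r - F (r + 1) := by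
    intro r s hrs hs
    rcases hrs.eq_or_lt with rfl | h
    · exact le_rfl
    · exact (conv r s h hs).le
  have uniq : ∀ X Y : (I ≃ J) × Finset I, Q.IsPenalizedMin (m + 1 / 2) X →
      Q.IsPenalizedMin (m + 1 / 2) Y → X.2.card ≤ Y.2.card := by
    intro X Y hX hY
    by_contra! hlt
    have hle := Finset.card_le_univ X.2
    have h1 := up m Y hY (by omega)
    have h2 := down m X hX (X.2.card - 1) (by omega)
    have h3 := conv' Y.2.card (X.2.card - 1) (by omega) (by omega)
    omega
  have e : M.2.card = M₀.2.card := le_antisymm (uniq _ _ hM h₀) (uniq _ _ h₀ hM)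
  rw [e]
  refine le_antisymm hc₀ ?_
  -- For `m = 0` all slopes are at least 1, so every supplier is upgraded. Otherwise a count below
  -- `k` here and above `k` at the previous price would put two distinct integer slopes between m -
  -- 1/2 and m + 1/2.
  rcases h₁ with rfl | ⟨M₁, h₁, hk₁⟩
  · by_contra! hlt
    have h1 := up 0 M₀ h₀ (by omega)
    have h2 := pos M₀.2.card (by omega)
    omega
  · by_contra! hlt
    have hle := Finset.card_le_univ M₁.2
    have h1 := up m M₀ h₀ (by omega)
    have h2 := down (m - 1) M₁ h₁ (M₁.2.card - 1) (by omega)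
    have h3 := conv M₀.2.card (M₁.2.card - 1) (by omega) (by omega)
    omega

end Generic

/-! ### Integer instances and their perturbation -/

section Integer

variable {n : ℕ}

/-- The cost of a matching in an integer instance. -/
def Problem.intCost (P : Problem ℤ (Fin n) (Fin n)) (M : (Fin n ≃ Fin n) × Finset (Fin n)) : ℤ :=
  ∑ i, (if i ∈ M.2 then P.b i else P.c i) * P.d (M.1 i)

/-- An integer instance, viewed as a real one. -/
def Problem.ofInt (P : Problem ℤ (Fin n) (Fin n)) : Problem ℝ (Fin n) (Fin n) where
  b i := P.b i
  c i := P.c i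
  d j := P.d j
  k := P.k
  b_nonneg i := by exact_mod_cast P.b_nonneg i
  b_le_c i := by exact_mod_cast P.b_le_c i
  d_nonneg j := by exact_mod_cast P.d_nonneg j
  card_eq := P.card_eq
  k_le := P.k_le

lemma Problem.matchingCost_ofInt (P : Problem ℤ (Fin n) (Fin n))
    (M : (Fin n ≃ Fin n) × Finset (Fin n)) : P.ofInt.matchingCost M = (P.intCost M : ℤ) := by
  unfold Problem.matchingCost Problem.intCost Problem.ofInt
  push_cast
  rfl

/-- The perturbation that makes the costs determine the upgrades. -/
def Problem.perturb (P : Problem ℤ (Fin n) (Fin n)) (N : ℕ) : Problem ℤ (Fin n) (Fin n) where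
  b i := N * P.b i + 2 ^ (i : ℕ)
  c i := N * P.c i + 2 ^ n
  d j := N * P.d j + 1
  k := P.k
  b_nonneg i := by have := P.b_nonneg i; positivity
  b_le_c i := by
    have := P.b_le_c i
    have : (2 : ℤ) ^ (i : ℕ) ≤ 2 ^ n := pow_le_pow_right₀ (by norm_num) i.2.le
    gcongr
  d_nonneg j := by have := P.d_nonneg j; positivity
  card_eq := P.card_eq
  k_le := P.k_le

/-- Modulo 2 ^ n, demands become 1, regular costs 0 and upgraded costs 2 ^ i. The cost thus becomes
a number below 2 ^ n whose binary digits are the set of upgrades. -/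
lemma Problem.perturb_generic (P : Problem ℤ (Fin n) (Fin n)) {N : ℕ} (hN : 2 ^ n ∣ N)
    {M M' : (Fin n ≃ Fin n) × Finset (Fin n)}
    (h : (P.perturb N).intCost M = (P.perturb N).intCost M') : M.2 = M'.2 := by
  have hN' : (2 ^ n : ℤ) ∣ N := by exact_mod_cast hN
  have key : ∀ X : (Fin n ≃ Fin n) × Finset (Fin n),
      (P.perturb N).intCost X ≡ ∑ i ∈ X.2, 2 ^ (i : ℕ) [ZMOD 2 ^ n] := by
    intro X
    have : ∑ i ∈ X.2, (2 : ℤ) ^ (i : ℕ) = ∑ i, if i ∈ X.2 then 2 ^ (i : ℕ) else 0 := by simp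
    rw [this]
    refine Int.ModEq.sum fun i _ => ?_
    have h0 : (N : ℤ) ≡ 0 [ZMOD 2 ^ n] := (Int.modEq_zero_iff_dvd).2 hN'
    have h1 : (2 ^ n : ℤ) ≡ 0 [ZMOD 2 ^ n] := (Int.modEq_zero_iff_dvd).2 dvd_rfl
    have hd : (N : ℤ) * P.d (X.1 i) + 1 ≡ 1 [ZMOD 2 ^ n] := by
      simpa using (h0.mul_right (P.d (X.1 i))).add_right 1
    by_cases hi : i ∈ X.2
    · have hb : (N : ℤ) * P.b i + 2 ^ (i : ℕ) ≡ 2 ^ (i : ℕ) [ZMOD 2 ^ n] := by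
        simpa using (h0.mul_right (P.b i)).add_right (2 ^ (i : ℕ))
      simpa [hi, Problem.perturb] using hb.mul hd
    · have hb : (N : ℤ) * P.c i + 2 ^ n ≡ 0 [ZMOD 2 ^ n] := by
        simpa using (h0.mul_right (P.c i)).add h1
      simpa [hi, Problem.perturb] using hb.mul hd
  have h2 : (∑ i ∈ M.2, 2 ^ (i : ℕ) : ℤ) ≡ ∑ i ∈ M'.2, 2 ^ (i : ℕ) [ZMOD 2 ^ n] :=
    ((key M).symm.trans (h ▸ Int.ModEq.refl _)).trans (key M')
  have e : ∀ S : Finset (Fin n), (∑ i ∈ S, 2 ^ (i : ℕ) : ℤ)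
      = ((∑ i ∈ S.map Fin.valEmbedding, 2 ^ i : ℕ) : ℤ) := fun S => by simp
  have lt : ∀ S : Finset (Fin n), ∑ i ∈ S.map Fin.valEmbedding, 2 ^ i < 2 ^ n := fun S =>
    Nat.geomSum_lt le_rfl (by simp)
  rw [e, e] at h2
  have h3 : ∑ i ∈ M.2.map Fin.valEmbedding, 2 ^ i = ∑ i ∈ M'.2.map Fin.valEmbedding, 2 ^ i := by
    have h4 := (Int.natCast_modEq_iff (n := 2 ^ n)).1 (by exact_mod_cast h2)
    exact Nat.ModEq.eq_of_lt_of_lt h4 (lt _) (lt _)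
  exact Finset.map_injective _ (Finset.geomSum_injective le_rfl h3)

/-- The leading term is N ^ 2 times the old cost. The bound on `N` keeps the lower-order terms below
N ^ 2, so strict differences of integer costs survive. -/
lemma Problem.perturb_intCost (P : Problem ℤ (Fin n) (Fin n)) {N : ℕ}
    (hN : 2 ^ n * (∑ i, P.c i + ∑ j, P.d j + n + 1) ≤ N)
    (M : (Fin n ≃ Fin n) × Finset (Fin n)) :
    (N : ℤ) ^ 2 * P.intCost M ≤ (P.perturb N).intCost M ∧
      (P.perturb N).intCost M < (N : ℤ) ^ 2 * (P.intCost M + 1) := by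
  set a : Fin n → ℤ := fun i => if i ∈ M.2 then P.b i else P.c i with ha
  set e : Fin n → ℤ := fun i => if i ∈ M.2 then 2 ^ (i : ℕ) else 2 ^ n with he
  have ha0 : ∀ i, 0 ≤ a i := fun i => by
    simp only [ha]; split_ifs
    exacts [P.b_nonneg i, (P.b_nonneg i).trans (P.b_le_c i)]
  have hac : ∀ i, a i ≤ P.c i := fun i => by
    simp only [ha]; split_ifs
    exacts [P.b_le_c i, le_rfl]
  have he0 : ∀ i, 0 ≤ e i := fun i => by simp only [he]; split_ifs <;> positivity
  have hen : ∀ i, e i ≤ 2 ^ n := fun i => by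
    simp only [he]; split_ifs
    exacts [pow_le_pow_right₀ (by norm_num) i.2.le, le_rfl]
  have hexp : (P.perturb N).intCost M = (N : ℤ) ^ 2 * P.intCost M +
      (N * (∑ i, a i + ∑ i, e i * P.d (M.1 i)) + ∑ i, e i) := by
    unfold Problem.intCost
    rw [← Finset.sum_add_distrib, Finset.mul_sum, Finset.mul_sum, ← Finset.sum_add_distrib,
      ← Finset.sum_add_distrib]
    refine Finset.sum_congr rfl fun i _ => ?_
    by_cases hi : i ∈ M.2 <;> simp [hi, Problem.perturb, ha, he] <;> ring
  have s1 : ∑ i, a i ≤ ∑ i, P.c i := Finset.sum_le_sum fun i _ => hac i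
  have s2 : ∑ i, e i * P.d (M.1 i) ≤ 2 ^ n * ∑ j, P.d j := by
    rw [← Equiv.sum_comp M.1 P.d, Finset.mul_sum]
    exact Finset.sum_le_sum fun i _ => mul_le_mul_of_nonneg_right (hen i) (P.d_nonneg _)
  have s3 : ∑ i, e i ≤ n * 2 ^ n := by
    simpa using Finset.sum_le_card_nsmul Finset.univ e (2 ^ n) fun i _ => hen i
  have t1 : 0 ≤ ∑ i, a i := Finset.sum_nonneg fun i _ => ha0 i
  have t2 : 0 ≤ ∑ i, e i * P.d (M.1 i) :=
    Finset.sum_nonneg fun i _ => mul_nonneg (he0 i) (P.d_nonneg _)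
  have t3 : 0 ≤ ∑ i, e i := Finset.sum_nonneg fun i _ => he0 i
  have t4 : 0 ≤ ∑ j, P.d j := Finset.sum_nonneg fun i _ => P.d_nonneg i
  have t5 : (1 : ℤ) ≤ 2 ^ n := one_le_pow₀ (by norm_num)
  have u1 : ∑ i, a i + ∑ i, e i * P.d (M.1 i) + 1 ≤ N := by nlinarith
  have u2 : ∑ i, e i < N := by nlinarith
  have hN0 : (0 : ℤ) ≤ N := by positivity
  rw [hexp]
  constructor
  · have := mul_nonneg hN0 (add_nonneg t1 t2)
    linarith
  · nlinarith [mul_le_mul_of_nonneg_left u1 hN0]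

/-- A matching that is cheapest for the perturbed costs is cheapest. -/
lemma Problem.intCost_le_of_perturb (P : Problem ℤ (Fin n) (Fin n)) {N : ℕ}
    (hN : 2 ^ n * (∑ i, P.c i + ∑ j, P.d j + n + 1) ≤ N)
    {M M' : (Fin n ≃ Fin n) × Finset (Fin n)}
    (h : (P.perturb N).intCost M ≤ (P.perturb N).intCost M') : P.intCost M ≤ P.intCost M' := by
  have h1 := (P.perturb_intCost hN M).1
  have h2 := (P.perturb_intCost hN M').2
  have h3 : (N : ℤ) ^ 2 * P.intCost M < (N : ℤ) ^ 2 * (P.intCost M' + 1) := by linarith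
  exact Int.lt_add_one_iff.1 (lt_of_mul_lt_mul_left h3 (by positivity))

/-- Above the largest cost of an edge, no supplier is upgraded. -/
lemma Problem.exists_isPenalizedMin_empty (P : Problem ℤ (Fin n) (Fin n)) {m : ℤ}
    (hm : ∀ i j, P.c i * P.d j ≤ m) :
    ∃ M : (Fin n ≃ Fin n) × Finset (Fin n),
      P.ofInt.IsPenalizedMin (m + 1 / 2) M ∧ M.2.card = 0 := by
  obtain ⟨σ, hσ⟩ := P.ofInt.exists_cheapest ∅
  refine ⟨(σ, ∅), fun M' => ?_, by simp⟩
  refine le_trans ?_ (?_ : P.ofInt.matchingCost (M'.1, ∅) ≤ _)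
  · simpa [Problem.penalized] using hσ M'.1
  · unfold Problem.penalized Problem.matchingCost
    have : (M'.2.card : ℝ) = ∑ i, if i ∈ M'.2 then (1 : ℝ) else 0 := by simp
    rw [this, Finset.mul_sum, ← Finset.sum_add_distrib]
    refine Finset.sum_le_sum fun i _ => ?_
    by_cases hi : i ∈ M'.2
    · simp only [Finset.notMem_empty, if_false, hi, if_true]
      have h1 : ((P.c i * P.d (M'.1 i) : ℤ) : ℝ) ≤ m := by exact_mod_cast hm i (M'.1 i)
      have h2 := mul_nonneg (P.ofInt.b_nonneg i) (P.ofInt.d_nonneg (M'.1 i))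
      push_cast at h1
      change (P.c i : ℝ) * (P.d (M'.1 i) : ℝ) ≤ _
      linarith
    · simp [hi]

end Integer

end Upgrade

namespace Upgrade

/-! ### The auction algorithm for the assignment problem -/

section Auction

variable {n : ℕ}

/-- Complementary slackness up to `ε` of an assignment and prices. -/
def IsNear (W : Fin n → Fin n → ℤ) (p : Fin n → ℤ) (ε : ℤ) (σ : Fin n ≃ Fin n) : Prop :=
  ∀ i j, W i (σ i) + p (σ i) ≤ W i j + p j + ε

/-- The invariant of the bidding loop with initial prices `p₀` and current prices `p`. The owner of
`j` is encoded by `O j`, which is one plus the number of the row, or `0` if `j` is free. The first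
`i` rows have been introduced; `cur`, if positive, encodes the one that looks for a column. -/
structure Bidding (W : Fin n → Fin n → ℤ) (p₀ p O : Fin n → ℤ) (i cur : ℤ) : Prop where
  price_ge : ∀ j, p₀ j ≤ p j
  free : ∀ j, O j = 0 → p j = p₀ j
  owner_nonneg : ∀ j, 0 ≤ O j
  owner_le : ∀ j, O j ≤ i
  near : ∀ j (r : Fin n), O j = r + 1 → ∀ l, W r j + p j ≤ W r l + p l + 1
  inj : ∀ j l, O j = O l → O j ≠ 0 → j = l
  cover : ∀ r : Fin n, (r : ℤ) < i → cur = r + 1 ∨ ∃ j, O j = r + 1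
  cur_nonneg : 0 ≤ cur
  cur_le : cur ≤ i
  le : i ≤ n
  not_owner : cur ≠ 0 → ∀ j, O j ≠ cur

lemma Bidding.exists_owner {W : Fin n → Fin n → ℤ} {p₀ p O : Fin n → ℤ} {i cur : ℤ}
    (h : Bidding W p₀ p O i cur) {j : Fin n} (hj : O j ≠ 0) : ∃ r : Fin n, O j = r + 1 := by
  have h1 := h.owner_nonneg j
  have h2 := h.owner_le j
  have h3 := h.le
  refine ⟨⟨(O j - 1).toNat, by omega⟩, ?_⟩
  simp only
  omega

lemma Bidding.init (W : Fin n → Fin n → ℤ) (p : Fin n → ℤ) : Bidding W p p (fun _ => 0) 0 0 where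
  price_ge _ := le_rfl
  free _ _ := rfl
  owner_nonneg _ := le_rfl
  owner_le _ := le_rfl
  near _ r h := by have := r.2; omega
  inj _ _ _ h := absurd rfl h
  cover r h := by omega
  cur_nonneg := le_rfl
  cur_le := le_rfl
  le := by positivity
  not_owner h := absurd rfl h

lemma Bidding.next {W : Fin n → Fin n → ℤ} {p₀ p O : Fin n → ℤ} {i : ℤ}
    (h : Bidding W p₀ p O i 0) (hi : i < n) : Bidding W p₀ p O (i + 1) (i + 1) where
  price_ge := h.price_ge
  free := h.free
  owner_nonneg := h.owner_nonneg
  owner_le j := by have := h.owner_le j; omega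
  near := h.near
  inj := h.inj
  cover r hr := by
    rcases (Int.lt_add_one_iff.1 hr).eq_or_lt with h' | h'
    · left; omega
    · right
      rcases h.cover r h' with h1 | h1
      · omega
      · exact h1
  cur_nonneg := by have := h.cur_le; omega
  cur_le := le_rfl
  le := hi
  not_owner _ j := by have := h.owner_le j; omega

/-- The bidder takes a cheapest column and raises its price by one, so it is tight up to 1; for the
other owners the alternatives only get dearer. The displaced owner `O j` bids next, and `O j = 0`
means that nobody was displaced. -/
lemma Bidding.bid {W : Fin n → Fin n → ℤ} {p₀ p O : Fin n → ℤ} {i : ℤ} {r j : Fin n}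
    (h : Bidding W p₀ p O i (r + 1)) (hj : ∀ l, W r j + p j ≤ W r l + p l) :
    Bidding W p₀ (Function.update p j (p j + 1)) (Function.update O j (r + 1)) i (O j) := by
  have hp : ∀ l, p l ≤ Function.update p j (p j + 1) l := fun l => by
    by_cases e : l = j
    · subst e; simp
    · simp [e]
  have hr : ((r : ℤ) + 1) ≠ 0 := by omega
  refine ⟨fun l => (h.price_ge l).trans (hp l), fun l hl => ?_, fun l => ?_, fun l => ?_,
    fun l s hs m => ?_, fun l m hlm hl => ?_, fun s hs => ?_, h.owner_nonneg j, h.owner_le j,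
    h.le, fun h0 l => ?_⟩
  · by_cases e : l = j
    · subst e; simp only [Function.update_self] at hl; omega
    · simp only [Function.update_of_ne e] at hl ⊢; exact h.free l hl
  · by_cases e : l = j
    · subst e; simp only [Function.update_self]; omega
    · simp only [Function.update_of_ne e]; exact h.owner_nonneg l
  · by_cases e : l = j
    · subst e; simp only [Function.update_self]; exact h.cur_le
    · simp only [Function.update_of_ne e]; exact h.owner_le l
  · have hpm := hp m
    by_cases e : l = j
    · subst e
      simp only [Function.update_self] at hs ⊢
      obtain rfl : r = s := by ext; omega
      have := hj m
      linarith
    · simp only [Function.update_of_ne e] at hs ⊢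
      have := h.near l s hs m
      linarith
  · by_cases e : l = j <;> by_cases e' : m = j
    · rw [e, e']
    · subst e
      simp only [Function.update_self, Function.update_of_ne e'] at hlm
      exact absurd hlm.symm (h.not_owner hr m)
    · subst e'
      simp only [Function.update_self, Function.update_of_ne e] at hlm
      exact absurd hlm (h.not_owner hr l)
    · simp only [Function.update_of_ne e, Function.update_of_ne e'] at hlm hl
      exact h.inj l m hlm hl
  · by_cases e : s = r
    · subst e; exact Or.inr ⟨j, by simp⟩
    · rcases h.cover s hs with h1 | ⟨l, hl⟩
      · exact absurd (Fin.ext (by omega)) e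
      · by_cases e' : l = j
        · subst e'; exact Or.inl hl
        · exact Or.inr ⟨l, by simp [e', hl]⟩
  · by_cases e : l = j
    · subst e
      simp only [Function.update_self]
      exact fun h' => h.not_owner hr l h'.symm
    · simp only [Function.update_of_ne e]
      exact fun h' => e (h.inj l j h' (h' ▸ h0))

lemma Bidding.finish {W : Fin n → Fin n → ℤ} {p₀ p O : Fin n → ℤ} (h : Bidding W p₀ p O n 0) :
    ∃ σ : Fin n ≃ Fin n, (∀ j, O j = (σ.symm j : ℕ) + 1) ∧ IsNear W p 1 σ := by
  have hc : ∀ r : Fin n, ∃ j, O j = r + 1 := fun r => by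
    rcases h.cover r (by exact_mod_cast r.2) with h1 | h1
    · omega
    · exact h1
  choose f hf using hc
  have hinj : Function.Injective f := fun a b hab => by
    have h1 := hf a
    rw [hab, hf b] at h1
    ext; omega
  set σ := Equiv.ofBijective f (Finite.injective_iff_bijective.1 hinj) with hσ
  refine ⟨σ, fun j => ?_, fun r l => h.near (f r) r (hf r) l⟩
  obtain ⟨r, rfl⟩ := σ.surjective j
  rw [σ.symm_apply_apply]
  exact hf r

/-- If a perfect assignment is nearly tight for the initial prices, bids are never high. -/
lemma Bidding.price_le {W : Fin n → Fin n → ℤ} {p₀ p O : Fin n → ℤ} {i : ℤ} {r j : Fin n}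
    (h : Bidding W p₀ p O i (r + 1)) (hj : ∀ l, W r j + p j ≤ W r l + p l) {σ : Fin n ≃ Fin n}
    (hσ : IsNear W p₀ 3 σ) : p j ≤ p₀ j + 4 * n + 3 := by
  -- The chosen column is no worse for the bidder than `σ r`, so it suffices to bound the rise of
  -- the price of `σ r`.
  suffices hs : p (σ r) - p₀ (σ r) ≤ 4 * n by
    have h1 := hj (σ r)
    have h2 := hσ r j
    linarith
  by_contra! hlt
  choose! own hown using fun j hj => h.exists_owner (j := j) hj
  -- Alternating path: from a column to its present owner, and on to the column that `σ` assigns to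
  -- that owner.
  set x : ℕ → Fin n := fun t => (fun j => σ (own j))^[t] (σ r) with hx
  have hxs : ∀ t, x (t + 1) = σ (own (x t)) := fun t => by
    simp only [hx, Function.iterate_succ_apply']
  -- One step of the path loses at most 1 + 3 = 4 of the rise: 1 from the current prices and 3 from
  -- `σ`. Thus n + 1 columns have a positive rise, and such columns are owned.
  have hbig : ∀ t ≤ n, 4 * ((n : ℤ) - t) < p (x t) - p₀ (x t) := by
    intro t
    induction t with
    | zero => intro _; simpa [hx] using hlt
    | succ t ih =>
      intro ht
      have h1 := ih (by omega)
      have h0 : O (x t) ≠ 0 := fun h0 => by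
        rw [h.free _ h0] at h1; omega
      have h2 := h.near _ _ (hown _ h0) (x (t + 1))
      have h3 := hσ (own (x t)) (x t)
      rw [hxs] at h2 ⊢
      push_cast
      linarith
  have hO : ∀ t ≤ n, O (x t) ≠ 0 := fun t ht h0 => by
    have h1 := hbig t ht
    rw [h.free _ h0] at h1
    omega
  -- The path never returns: a return to `σ r` would make the bidder an owner, and later returns are
  -- traced back by injectivity.
  have hne : ∀ a b, a < b → b ≤ n → x a ≠ x b := by
    intro a
    induction a with
    | zero =>
      intro b hb hbn hab
      obtain ⟨b, rfl⟩ := Nat.exists_eq_add_of_lt hb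
      rw [zero_add, hxs] at hab
      have e : r = own (x b) := σ.injective hab
      have := hown (x b) (hO b (by omega))
      rw [← e] at this
      exact h.not_owner (by omega) _ this
    | succ a ih =>
      intro b hb hbn hab
      obtain ⟨b, rfl⟩ : ∃ b', b = b' + 1 := ⟨b - 1, by omega⟩
      rw [hxs, hxs] at hab
      have e := σ.injective hab
      refine ih b (by omega) (by omega) (h.inj _ _ ?_ (hO a (by omega)))
      rw [hown _ (hO a (by omega)), hown _ (hO b (by omega)), e]
  have hinj : Function.Injective fun t : Fin (n + 1) => x t := by
    intro a b hab
    by_contra hne'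
    rcases lt_or_gt_of_ne hne' with h' | h'
    · exact hne a b h' (by omega) hab
    · exact hne b a h' (by omega) hab.symm
  have := Fintype.card_le_of_injective _ hinj
  simp at this

/-- Doubling the precision. -/
lemma IsNear.double {W : Fin n → Fin n → ℤ} {p : Fin n → ℤ} {q : ℤ} {σ : Fin n ≃ Fin n}
    (hq : 0 < q) (h : IsNear (fun i j => W i j / (2 * q)) p 1 σ) :
    IsNear (fun i j => W i j / q) (fun j => 2 * p j) 3 σ := by
  -- Halving the divisor doubles the quotient up to a binary digit, so the slack 1 becomes 2 · 1 + 1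
  -- = 3.
  have key : ∀ a : ℤ, 2 * (a / (2 * q)) ≤ a / q ∧ a / q ≤ 2 * (a / (2 * q)) + 1 := fun a => by
    rw [mul_comm 2 q, ← Int.ediv_ediv_of_nonneg hq.le]
    omega
  intro i j
  have h1 := h i j
  have h2 := key (W i (σ i))
  have h3 := key (W i j)
  simp only at h1 ⊢
  linarith

/-- If all costs are multiples of `n + 1`, then a nearly tight assignment is optimal. -/
lemma IsNear.sum_le {w : Fin n → Fin n → ℤ} {p : Fin n → ℤ} {σ : Fin n ≃ Fin n}
    (h : IsNear (fun i j => (n + 1) * w i j) p 1 σ) (τ : Fin n ≃ Fin n) :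
    ∑ i, w i (σ i) ≤ ∑ i, w i (τ i) := by
  have h1 := Finset.sum_le_sum fun i (_ : i ∈ Finset.univ) => h i (τ i)
  simp only [Finset.sum_add_distrib, ← Finset.mul_sum, Equiv.sum_comp σ p, Equiv.sum_comp τ p,
    Finset.sum_const, Finset.card_univ, Fintype.card_fin, nsmul_eq_mul, mul_one] at h1
  -- The slacks add up to at most `n`, less than the common factor `n + 1`.
  have h2 : ((n : ℤ) + 1) * ∑ i, w i (σ i) < (n + 1) * (∑ i, w i (τ i) + 1) := by linarith
  exact Int.lt_add_one_iff.1 (lt_of_mul_lt_mul_left h2 (by positivity))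

end Auction

end Upgrade

namespace Upgrade

/-! ### Reasoning about programs -/

lemma bitLength_le_iff {z : ℤ} {m : ℕ} : bitLength z ≤ m ↔ z.natAbs < 2 ^ m := Nat.size_le

lemma bitLength_mono {y z : ℤ} (h : y.natAbs ≤ z.natAbs) : bitLength y ≤ bitLength z :=
  Nat.size_le_size h

lemma natAbs_lt_two_pow_bitLength (z : ℤ) : z.natAbs < 2 ^ bitLength z := Nat.lt_size_self _

lemma bitLength_le_natAbs (z : ℤ) : bitLength z ≤ z.natAbs :=
  bitLength_le_iff.2 Nat.lt_two_pow_self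

/-- The carry needs no extra digit because `a * m` and `b * m` are both at least 1. -/
lemma bitLength_add_le {y z : ℤ} {a b m : ℕ} (hy : bitLength y ≤ a * m) (hz : bitLength z ≤ b * m)
    (ha : 1 ≤ a) (hb : 1 ≤ b) (hm : 1 ≤ m) : bitLength (y + z) ≤ (a + b) * m := by
  rw [bitLength_le_iff] at *
  have h1 := Int.natAbs_add_le y z
  have h2 : a * m + 1 ≤ (a + b) * m := by nlinarith
  have h3 : b * m + 1 ≤ (a + b) * m := by nlinarith
  have h4 := Nat.pow_le_pow_right (n := 2) (by norm_num) h2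
  have h5 := Nat.pow_le_pow_right (n := 2) (by norm_num) h3
  rw [pow_succ] at h4 h5
  omega

lemma bitLength_mul_le {y z : ℤ} {a b m : ℕ} (hy : bitLength y ≤ a * m)
    (hz : bitLength z ≤ b * m) : bitLength (y * z) ≤ (a + b) * m := by
  rw [bitLength_le_iff] at *
  rw [Int.natAbs_mul, add_mul, pow_add]
  exact Nat.mul_lt_mul'' hy hz

/-- All stored numbers have absolute value at most `Z`. -/
def Memory.Bounded (Z : ℕ) (s : Memory) : Prop :=
  (∀ v, (s.var v).natAbs ≤ Z) ∧ ∀ a z, (s.arr a z).natAbs ≤ Z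

lemma Memory.Bounded.setVar {Z : ℕ} {s : Memory} (h : s.Bounded Z) {v : ℕ} {z : ℤ}
    (hz : z.natAbs ≤ Z) : (s.setVar v z).Bounded Z := by
  refine ⟨fun w => ?_, h.2⟩
  simp only [Memory.setVar, Function.update_apply]
  split_ifs
  exacts [hz, h.1 w]

lemma Memory.Bounded.setArr {Z : ℕ} {s : Memory} (h : s.Bounded Z) {a : ℕ} {i z : ℤ}
    (hz : z.natAbs ≤ Z) : (s.setArr a i z).Bounded Z := by
  refine ⟨h.1, fun b w => ?_⟩
  simp only [Memory.setArr, Function.update_apply]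
  split_ifs with h1
  · subst h1
    simp only [Function.update_apply]
    split_ifs
    exacts [hz, h.2 _ _]
  · exact h.2 _ _

/-- The bit length of the value of an expression, relative to that of the stored numbers. -/
def Expr.width : Expr → ℕ
  | .const z => z.natAbs + 1
  | .var _ => 1
  | .get _ _ => 1
  | .add e f => e.width + f.width
  | .sub e f => e.width + f.width
  | .mul e f => e.width + f.width
  | .div e f => e.width + f.width

/-- The cost of an expression, relative to the bit length of the stored numbers. -/
def Expr.weight : Expr → ℕ
  | .const z => z.natAbs + 1
  | .var _ => 2
  | .get _ e => e.weight + 2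
  | .add e f => e.weight + f.weight + 1 + (e.width + f.width)
  | .sub e f => e.weight + f.weight + 1 + (e.width + f.width)
  | .mul e f => e.weight + f.weight + 1 + (e.width + f.width)
  | .div e f => e.weight + f.weight + 1 + (e.width + f.width)

lemma Expr.one_le_width (e : Expr) : 1 ≤ e.width := by
  induction e <;> simp only [Expr.width] <;> omega

lemma Expr.width_le_weight (e : Expr) : e.width ≤ e.weight := by
  induction e <;> simp only [Expr.width, Expr.weight] <;> omega

lemma Expr.bitLength_eval_le {Z : ℕ} {s : Memory} (hs : s.Bounded Z) (e : Expr) :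
    bitLength (e.eval s) ≤ e.width * (Nat.size Z + 1) := by
  have hZ : ∀ z : ℤ, z.natAbs ≤ Z → bitLength z ≤ 1 * (Nat.size Z + 1) := fun z hz => by
    have : bitLength z ≤ Nat.size Z := Nat.size_le_size hz
    omega
  induction e with
  | const z =>
    have := bitLength_le_natAbs z
    simp only [Expr.eval, Expr.width]
    nlinarith
  | var v => exact hZ _ (hs.1 v)
  | get a e _ => exact hZ _ (hs.2 a _)
  | add e f he hf => exact bitLength_add_le he hf e.one_le_width f.one_le_width (by omega)
  | sub e f he hf =>
    simp only [Expr.eval, Expr.width, sub_eq_add_neg]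
    refine bitLength_add_le he ?_ e.one_le_width f.one_le_width (by omega)
    simpa [bitLength] using hf
  | mul e f he hf => exact bitLength_mul_le he hf
  | div e f he hf =>
    have h1 : bitLength (e.eval s / f.eval s) ≤ bitLength (e.eval s) :=
      bitLength_mono (Int.natAbs_ediv_le_natAbs _ _)
    simp only [Expr.eval, Expr.width, add_mul]
    omega

lemma Expr.cost_le {Z : ℕ} {s : Memory} (hs : s.Bounded Z) (e : Expr) :
    e.cost s ≤ e.weight * (Nat.size Z + 1) := by
  have hZ : ∀ z : ℤ, z.natAbs ≤ Z → bitLength z ≤ Nat.size Z := fun z hz => Nat.size_le_size hz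
  induction e with
  | const z =>
    have := bitLength_le_natAbs z
    simp only [Expr.cost, Expr.weight]
    nlinarith
  | var v =>
    have := hZ _ (hs.1 v)
    simp only [Expr.cost, Expr.weight]
    omega
  | get a e he =>
    have := hZ _ (hs.2 a (e.eval s))
    simp only [Expr.cost, Expr.weight, add_mul]
    omega
  | add e f he hf =>
    have := (Expr.add e f).bitLength_eval_le hs
    simp only [Expr.cost, Expr.weight, Expr.eval, Expr.width, add_mul] at this ⊢
    omega
  | sub e f he hf =>
    have := (Expr.sub e f).bitLength_eval_le hs
    simp only [Expr.cost, Expr.weight, Expr.eval, Expr.width, add_mul] at this ⊢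
    omega
  | mul e f he hf =>
    have := (Expr.mul e f).bitLength_eval_le hs
    simp only [Expr.cost, Expr.weight, Expr.eval, Expr.width, add_mul] at this ⊢
    omega
  | div e f he hf =>
    have := (Expr.div e f).bitLength_eval_le hs
    simp only [Expr.cost, Expr.weight, Expr.eval, Expr.width, add_mul] at this ⊢
    omega

/-- The variables that a program may write. -/
def Program.vars : Program → List ℕ
  | .skip => []
  | .assign v _ => [v]
  | .store _ _ _ => []
  | .seq p q => p.vars ++ q.vars
  | .ifPos _ p q => p.vars ++ q.vars
  | .whilePos _ p => p.vars

/-- The arrays that a program may write. -/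
def Program.arrs : Program → List ℕ
  | .skip => []
  | .assign _ _ => []
  | .store a _ _ => [a]
  | .seq p q => p.arrs ++ q.arrs
  | .ifPos _ p q => p.arrs ++ q.arrs
  | .whilePos _ p => p.arrs

/-- Two memories agree except where `p` may write. -/
def Frame (p : Program) (s s' : Memory) : Prop :=
  (∀ v ∉ p.vars, s'.var v = s.var v) ∧ ∀ a ∉ p.arrs, s'.arr a = s.arr a

lemma Frame.refl (p : Program) (s : Memory) : Frame p s s := ⟨fun _ _ => rfl, fun _ _ => rfl⟩

lemma Frame.trans {p : Program} {s s' s'' : Memory} (h : Frame p s s') (h' : Frame p s' s'') :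
    Frame p s s'' :=
  ⟨fun v hv => (h'.1 v hv).trans (h.1 v hv), fun a ha => (h'.2 a ha).trans (h.2 a ha)⟩

lemma Frame.mono {p q : Program} {s s' : Memory} (h : Frame p s s') (hv : p.vars ⊆ q.vars)
    (ha : p.arrs ⊆ q.arrs) : Frame q s s' :=
  ⟨fun v hv' => h.1 v fun h' => hv' (hv h'), fun a ha' => h.2 a fun h' => ha' (ha h')⟩

/-- This turns the syntactic lists of written variables and arrays into invariance of everything
else, so that side conditions can be settled by `decide`. -/
lemma Runs.frame {p : Program} {s s' : Memory} {t : ℕ} (h : Runs p s t s') : Frame p s s' := by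
  induction h with
  | skip s => exact Frame.refl _ _
  | assign s v e =>
    refine ⟨fun w hw => ?_, fun _ _ => rfl⟩
    simp only [Program.vars, List.mem_singleton] at hw
    simp [Memory.setVar, hw]
  | store s a i e =>
    refine ⟨fun _ _ => rfl, fun b hb => ?_⟩
    simp only [Program.arrs, List.mem_singleton] at hb
    simp [Memory.setArr, hb]
  | seq _ _ h1 h2 =>
    exact (h1.mono (by simp [Program.vars]) (by simp [Program.arrs])).trans
      (h2.mono (by simp [Program.vars]) (by simp [Program.arrs]))
  | ifTrue _ _ h1 => exact h1.mono (by simp [Program.vars]) (by simp [Program.arrs])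
  | ifFalse _ _ h1 => exact h1.mono (by simp [Program.vars]) (by simp [Program.arrs])
  | whileTrue _ _ _ h1 h2 =>
    exact (h1.mono (by simp [Program.vars]) (by simp [Program.arrs])).trans h2
  | whileFalse _ => exact Frame.refl _ _

/-- The time charged for one step of a program when the stored numbers are bounded by `Z`. -/
def stepTime (Z : ℕ) : ℕ := 1000 * (Nat.size Z + 1)

lemma Expr.one_add_cost_le {Z : ℕ} {s : Memory} (hs : s.Bounded Z) {e : Expr}
    (he : e.weight ≤ 999) : 1 + e.cost s ≤ stepTime Z := by
  have := e.cost_le hs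
  unfold stepTime
  nlinarith

/-- The program halts after at most `m` steps in a memory that satisfies `R` and stores only numbers
bounded by `Z`. -/
def Ends (Z : ℕ) (p : Program) (s : Memory) (m : ℕ) (R : Memory → Prop) : Prop :=
  ∃ t s', Runs p s t s' ∧ t ≤ m * stepTime Z ∧ s'.Bounded Z ∧ R s'

namespace Ends

variable {Z m m' : ℕ} {p q : Program} {s : Memory} {R R' : Memory → Prop} {e i : Expr} {a v : ℕ}

lemma mono (h : Ends Z p s m R) (hm : m ≤ m') (hR : ∀ s', s'.Bounded Z → Frame p s s' → R s' → R' s') :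
    Ends Z p s m' R' := by
  obtain ⟨t, s', h1, h2, h3, h4⟩ := h
  exact ⟨t, s', h1, h2.trans (Nat.mul_le_mul_right _ hm), h3, hR s' h3 h1.frame h4⟩

lemma skip (hs : s.Bounded Z) (hR : R s) : Ends Z .skip s 1 R :=
  ⟨1, s, .skip s, by unfold stepTime; omega, hs, hR⟩

lemma assign (hs : s.Bounded Z) (he : e.weight ≤ 999) (hv : (e.eval s).natAbs ≤ Z)
    (hR : R (s.setVar v (e.eval s))) : Ends Z (.assign v e) s 1 R :=
  ⟨_, _, .assign s v e, by rw [one_mul]; exact e.one_add_cost_le hs he, hs.setVar hv, hR⟩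

lemma store (hs : s.Bounded Z) (he : i.weight + e.weight ≤ 999) (hv : (e.eval s).natAbs ≤ Z)
    (hR : R (s.setArr a (i.eval s) (e.eval s))) : Ends Z (.store a i e) s 1 R := by
  refine ⟨_, _, .store s a i e, ?_, hs.setArr hv, hR⟩
  have h1 := i.cost_le hs
  have h2 := e.cost_le hs
  unfold stepTime
  nlinarith

lemma seq {R₁ : Memory → Prop} (h : Ends Z p s m R₁)
    (h' : ∀ s', s'.Bounded Z → Frame p s s' → R₁ s' → Ends Z q s' m' R) :
    Ends Z (.seq p q) s (m + m') R := by
  obtain ⟨t, s', h1, h2, h3, h4⟩ := h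
  obtain ⟨u, s'', k1, k2, k3, k4⟩ := h' s' h3 h1.frame h4
  exact ⟨t + u, s'', .seq h1 k1, by rw [add_mul]; omega, k3, k4⟩

lemma assign_seq (hs : s.Bounded Z) (he : e.weight ≤ 999) (hv : (e.eval s).natAbs ≤ Z)
    (h : (s.setVar v (e.eval s)).Bounded Z → Ends Z q (s.setVar v (e.eval s)) m R) :
    Ends Z (.seq (.assign v e) q) s (1 + m) R :=
  (assign (R := fun s' => s' = s.setVar v (e.eval s)) hs he hv rfl).seq
    fun _ hs' _ h' => by subst h'; exact h hs'

lemma store_seq (hs : s.Bounded Z) (he : i.weight + e.weight ≤ 999) (hv : (e.eval s).natAbs ≤ Z)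
    (h : (s.setArr a (i.eval s) (e.eval s)).Bounded Z →
      Ends Z q (s.setArr a (i.eval s) (e.eval s)) m R) :
    Ends Z (.seq (.store a i e) q) s (1 + m) R :=
  (store (R := fun s' => s' = s.setArr a (i.eval s) (e.eval s)) hs he hv rfl).seq
    fun _ hs' _ h' => by subst h'; exact h hs'

lemma ifPos (hs : s.Bounded Z) (he : e.weight ≤ 999) (h : 0 < e.eval s → Ends Z p s m R)
    (h' : ¬ 0 < e.eval s → Ends Z q s m R) : Ends Z (.ifPos e p q) s (1 + m) R := by
  have hc := e.one_add_cost_le hs he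
  by_cases h0 : 0 < e.eval s
  · obtain ⟨t, s', h1, h2, h3, h4⟩ := h h0
    exact ⟨_, s', .ifTrue h0 h1, by rw [add_mul, one_mul]; omega, h3, h4⟩
  · obtain ⟨t, s', h1, h2, h3, h4⟩ := h' h0
    exact ⟨_, s', .ifFalse h0 h1, by rw [add_mul, one_mul]; omega, h3, h4⟩

/-- The rule for loops. The number `r` bounds the remaining iterations. -/
lemma whilePos (Inv : ℕ → Memory → Prop) (he : e.weight ≤ 999) {r : ℕ} (hs : s.Bounded Z)
    (h0 : Inv r s)
    (step : ∀ r s', s'.Bounded Z → Frame (.whilePos e p) s s' → Inv r s' → 0 < e.eval s' →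
      Ends Z p s' m fun s'' => ∃ r' < r, Inv r' s'') :
    Ends Z (.whilePos e p) s (r * (m + 1) + 1) fun s' => (∃ r', Inv r' s') ∧ ¬ 0 < e.eval s' := by
  suffices key : ∀ r s', s'.Bounded Z → Frame (.whilePos e p) s s' → Inv r s' →
      Ends Z (.whilePos e p) s' (r * (m + 1) + 1)
        fun s' => (∃ r', Inv r' s') ∧ ¬ 0 < e.eval s' from key r s hs (Frame.refl _ _) h0
  intro r
  induction r using Nat.strong_induction_on with
  | _ r ih =>
    intro s₁ hs₁ hf hI
    have hc := e.one_add_cost_le hs₁ he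
    by_cases hpos : 0 < e.eval s₁
    · obtain ⟨t, s₂, h1, h2, h3, r', hr', h4⟩ := step r s₁ hs₁ hf hI hpos
      obtain ⟨u, s₃, k1, k2, k3, k4⟩ := ih r' hr' s₂ h3
        (hf.trans (h1.frame.mono (by simp [Program.vars]) (by simp [Program.arrs]))) h4
      refine ⟨_, s₃, .whileTrue hpos h1 k1, ?_, k3, k4⟩
      obtain ⟨r, rfl⟩ : ∃ r₀, r = r₀ + 1 := ⟨r - 1, by omega⟩
      have hle : r' * (m + 1) ≤ r * (m + 1) := Nat.mul_le_mul_right _ (by omega)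
      have hle' : (r' * (m + 1) + 1) * stepTime Z ≤ (r * (m + 1) + 1) * stepTime Z :=
        Nat.mul_le_mul_right _ (by omega)
      calc 1 + e.cost s₁ + t + u
          ≤ stepTime Z + m * stepTime Z + (r * (m + 1) + 1) * stepTime Z := by omega
        _ = _ := by ring
    · refine ⟨_, s₁, .whileFalse hpos, ?_, hs₁, ⟨r, hI⟩, hpos⟩
      calc 1 + e.cost s₁ ≤ 1 * stepTime Z := by omega
        _ ≤ _ := Nat.mul_le_mul_right _ (by omega)

end Ends

/-- The loop in which the variable `v` runs from zero to the value of `e`, exclusive. -/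
def forLoop (v : ℕ) (e : Expr) (p : Program) : Program :=
  .seq (.assign v (.const 0))
    (.whilePos (.sub e (.var v)) (.seq p (.assign v (.add (.var v) (.const 1)))))

/-- `Inv j` refers to the memory in which the counter already has the value `j`, hence the `setVar`
in `h0` and `step`. The frame argument ensures that the bound `e` keeps its value throughout. -/
lemma Ends.forLoop {Z m N : ℕ} {p : Program} {s : Memory} {e : Expr} {v : ℕ}
    (Inv : ℕ → Memory → Prop) (he : e.weight ≤ 400) (hs : s.Bounded Z) (hN : N ≤ Z)
    (hv : v ∉ p.vars) (heval : ∀ s', Frame (forLoop v e p) s s' → e.eval s' = N)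
    (h0 : Inv 0 (s.setVar v 0))
    (step : ∀ j < N, ∀ s', s'.Bounded Z → Frame (forLoop v e p) s s' → s'.var v = j → Inv j s' →
      Ends Z p s' m fun s'' => Inv (j + 1) (s''.setVar v ((j + 1 : ℕ) : ℤ))) :
    Ends Z (forLoop v e p) s (N * (m + 2) + 2) (Inv N) := by
  have hfa : Frame (Upgrade.forLoop v e p) s (s.setVar v 0) :=
    ⟨fun w hw => by
      have : w ≠ v := fun h => hw (by simp [Upgrade.forLoop, Program.vars, h])
      simp [Memory.setVar, this], fun _ _ => rfl⟩
  have main := Ends.whilePos (Z := Z) (m := m + 1) (s := s.setVar v 0)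
    (e := .sub e (.var v)) (p := .seq p (.assign v (.add (.var v) (.const 1))))
    (fun r s' => ∃ j : ℕ, j + r = N ∧ s'.var v = j ∧ Inv j s') (r := N)
    (by have := e.width_le_weight; simp only [Expr.weight, Expr.width]; omega) (hs.setVar (by simp))
    ⟨0, by simp, by simp [Memory.setVar], h0⟩ (by
      rintro r s' hs' hf ⟨j, hj, hjv, hI⟩ hpos
      have hf' : Frame (Upgrade.forLoop v e p) s s' :=
        hfa.trans (hf.mono (by simp [Upgrade.forLoop, Program.vars])
          (by simp [Upgrade.forLoop, Program.arrs]))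
      have hjN : j < N := by
        simp only [Expr.eval, heval s' hf', hjv] at hpos
        omega
      refine Ends.seq (step j hjN s' hs' hf' hjv hI) fun s'' hs'' hf'' hI' => ?_
      have hval : (Expr.add (.var v) (.const 1)).eval s'' = ((j + 1 : ℕ) : ℤ) := by
        simp [Expr.eval, hf''.1 v hv, hjv]
      refine Ends.assign hs'' (by simp [Expr.weight, Expr.width]) (by rw [hval]; omega)
        ⟨r - 1, by omega, j + 1, by omega, ?_, ?_⟩
      · rw [hval]; simp [Memory.setVar]
      · rw [hval]; exact hI')
  have hall := Ends.assign_seq (Z := Z) (s := s) (v := v) (e := .const 0) hs (by decide)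
    (by simp [Expr.eval]) fun _ => main
  refine hall.mono (le_of_eq (by ring)) ?_
  rintro s' hs' hf ⟨⟨r, j, hj, hjv, hI⟩, hneg⟩
  have := heval s' hf
  simp only [Expr.eval, this, hjv] at hneg
  obtain rfl : j = N := by omega
  exact hI

end Upgrade

namespace Upgrade

/-! ### The program for the assignment problem -/

instance : Add Expr := ⟨Expr.add⟩
instance : Sub Expr := ⟨Expr.sub⟩
instance : Mul Expr := ⟨Expr.mul⟩
instance : Div Expr := ⟨Expr.div⟩

section EvalLemmas

variable (s : Memory) (e f : Expr) (v w a b : ℕ) (i j z : ℤ)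

@[simp] lemma Expr.eval_const : (Expr.const z).eval s = z := rfl
@[simp] lemma Expr.eval_var : (Expr.var v).eval s = s.var v := rfl
@[simp] lemma Expr.eval_get : (Expr.get a e).eval s = s.arr a (e.eval s) := rfl
@[simp] lemma Expr.eval_add : (e + f).eval s = e.eval s + f.eval s := rfl
@[simp] lemma Expr.eval_sub : (e - f).eval s = e.eval s - f.eval s := rfl
@[simp] lemma Expr.eval_mul : (e * f).eval s = e.eval s * f.eval s := rfl
@[simp] lemma Expr.eval_div : (e / f).eval s = e.eval s / f.eval s := rfl

@[simp] lemma Memory.setVar_var : (s.setVar v z).var w = if w = v then z else s.var w := by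
  simp [Memory.setVar, Function.update_apply]

@[simp] lemma Memory.setVar_arr : (s.setVar v z).arr = s.arr := rfl

@[simp] lemma Memory.setArr_var : (s.setArr a i z).var = s.var := rfl

@[simp] lemma Memory.setArr_arr :
    (s.setArr a i z).arr b j = if b = a ∧ j = i then z else s.arr b j := by
  by_cases h : b = a
  · subst h; simp [Memory.setArr, Function.update_apply]
  · simp [Memory.setArr, h]

end EvalLemmas

/-- The cost of column `j` for the bidder, at the current precision. -/
def bidKey (j : Expr) : Expr :=
  .get 11 ((.var 13 - .const 1) * .var 0 + j) / .var 11 + .get 12 j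

/-- Find the best column for the bidder. -/
def bestLoop : Program :=
  forLoop 2 (.var 0) (.ifPos (bidKey (.var 14) - bidKey (.var 2)) (.assign 14 (.var 2)) .skip)

/-- One bid, or the introduction of the next bidder. -/
def bidBody : Program :=
  .ifPos (.var 13)
    (.seq (.assign 14 (.const 0)) (.seq bestLoop (.seq (.assign 15 (.get 13 (.var 14)))
      (.seq (.store 13 (.var 14) (.var 13)) (.seq
        (.store 12 (.var 14) (.get 12 (.var 14) + .const 1)) (.assign 13 (.var 15)))))))
    (.seq (.assign 12 (.var 12 + .const 1)) (.assign 13 (.var 12)))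

/-- Variable 12 counts the rows introduced and variable 13 is one plus the bidding row, or 0. The
test is positive as long as some row bids or waits. Arrays 11, 12 and 13 hold costs, prices and
owners. -/
def bidLoop : Program := .whilePos (.var 13 + (.var 0 - .var 12)) bidBody

/-- Double the prices and remove the assignment. -/
def doubleLoop : Program :=
  forLoop 2 (.var 0) (.seq (.store 12 (.var 2) (.const 2 * .get 12 (.var 2)))
    (.store 13 (.var 2) (.const 0)))

/-- Variable 11 is the divisor of the costs. Halving it refines the costs by one binary digit, and
the prices are doubled to match. -/
def phaseBody : Program :=
  .seq (.assign 11 (.var 11 / .const 2)) (.seq doubleLoop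
    (.seq (.assign 12 (.const 0)) (.seq (.assign 13 (.const 0)) bidLoop)))

def phaseLoop : Program := .whilePos (.var 11 - .const 1) phaseBody

section Verification

variable {n Z : ℕ} {s : Memory} {W : Fin n → Fin n → ℤ} {q : ℤ}

lemma bestLoop_ends (hs : s.Bounded Z) (hn : s.var 0 = n) (hW : ∀ i j : Fin n,
    s.arr 11 ((i : ℕ) * n + (j : ℕ)) = W i j) (hq : s.var 11 = q) {r : Fin n}
    (hr : s.var 13 = (r : ℕ) + 1) (h14 : s.var 14 = 0) :
    Ends Z bestLoop s (n * 4 + 2) fun s' => ∃ j : Fin n, s'.var 14 = (j : ℕ) ∧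
      ∀ l : Fin n, W r j / q + s.arr 12 (j : ℕ) ≤ W r l / q + s.arr 12 (l : ℕ) := by
  have hnZ : n ≤ Z := by have := hs.1 0; omega
  have hkey : ∀ s', Frame bestLoop s s' → ∀ (e : Expr) (l : Fin n), e.eval s' = (l : ℕ) →
      (bidKey e).eval s' = W r l / q + s.arr 12 (l : ℕ) := by
    intro s' hf e l he
    simp only [bidKey, Expr.eval_add, Expr.eval_div, Expr.eval_get, Expr.eval_mul, Expr.eval_sub,
      Expr.eval_var, Expr.eval_const, he]
    rw [hf.1 13 (by decide), hf.1 0 (by decide), hf.1 11 (by decide), hf.2 11 (by decide),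
      hf.2 12 (by decide), hr, hn, hq, add_sub_cancel_right, hW]
  have main := Ends.forLoop (Z := Z) (m := 2) (N := n) (s := s) (v := 2) (e := .var 0)
    (p := .ifPos (bidKey (.var 14) - bidKey (.var 2)) (.assign 14 (.var 2)) .skip)
    (fun t s' => ∃ j : Fin n, s'.var 14 = (j : ℕ) ∧ ∀ l : Fin n, (l : ℕ) < t →
      W r j / q + s.arr 12 (j : ℕ) ≤ W r l / q + s.arr 12 (l : ℕ))
    (by decide) hs hnZ (by decide) (fun s' hf => by
      rw [Expr.eval_var, hf.1 0 (by decide), hn]) ⟨⟨0, r.pos⟩, by simp [h14], by simp⟩ (by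
    rintro t ht s' hs' hf h2 ⟨j, hj, hmin⟩
    have k1 := hkey s' hf (.var 14) j (by simp [hj])
    have k2 := hkey s' hf (.var 2) ⟨t, ht⟩ (by simp [h2])
    refine Ends.ifPos (m := 1) hs' (by decide) (fun hpos => ?_) fun hneg => ?_
    · rw [Expr.eval_sub, k1, k2] at hpos
      refine Ends.assign hs' (by decide) (hs'.1 2) ⟨⟨t, ht⟩, by simp [h2], fun l hl => ?_⟩
      rcases (Nat.lt_succ_iff.1 hl).eq_or_lt with h | h
      · obtain rfl : l = ⟨t, ht⟩ := Fin.ext h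
        exact le_rfl
      · have := hmin l h
        linarith
    · rw [Expr.eval_sub, k1, k2] at hneg
      refine Ends.skip hs' ⟨j, by simp [hj], fun l hl => ?_⟩
      rcases (Nat.lt_succ_iff.1 hl).eq_or_lt with h | h
      · obtain rfl : l = ⟨t, ht⟩ := Fin.ext h
        linarith
      · exact hmin l h)
  exact main.mono le_rfl fun s' _ _ ⟨j, hj, h⟩ => ⟨j, hj, fun l => h l l.2⟩

/-- The potential is the sum of the prices plus the number of introduced rows. Each iteration raises
it by one, and `price_le` bounds each price rise by 4 n + 4, so at most n (4 n + 4) + n iterations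
occur. -/
lemma bidLoop_ends (hs : s.Bounded Z) (hn : s.var 0 = n) (hW : ∀ i j : Fin n,
    s.arr 11 ((i : ℕ) * n + (j : ℕ)) = W i j) (hq : s.var 11 = q)
    (h13 : ∀ j : Fin n, s.arr 13 (j : ℕ) = 0) (hi : s.var 12 = 0) (hcur : s.var 13 = 0)
    {σ : Fin n ≃ Fin n}
    (hσ : IsNear (fun i j => W i j / q) (fun j => s.arr 12 (j : ℕ)) 3 σ)
    (hp0 : ∀ j : Fin n, 0 ≤ s.arr 12 (j : ℕ))
    (hZ : ∀ j : Fin n, s.arr 12 (j : ℕ) + (4 * n + 4) ≤ Z) :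
    Ends Z bidLoop s ((n * (4 * n + 4) + n) * (4 * n + 9) + 1) fun s' => ∃ σ : Fin n ≃ Fin n,
      (∀ j : Fin n, s'.arr 13 (j : ℕ) = (σ.symm j : ℕ) + 1) ∧
      IsNear (fun i j => W i j / q) (fun j => s'.arr 12 (j : ℕ)) 1 σ ∧
      ∀ j : Fin n, 0 ≤ s'.arr 12 (j : ℕ) ∧
        s'.arr 12 (j : ℕ) ≤ s.arr 12 (j : ℕ) + (4 * n + 4) := by
  have hnZ : n ≤ Z := by have := hs.1 0; omega
  have main := Ends.whilePos (Z := Z) (m := 4 * n + 8) (s := s)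
    (e := .var 13 + (.var 0 - .var 12)) (p := bidBody) (r := n * (4 * n + 4) + n)
    (fun r s' => Bidding (fun i j => W i j / q) (fun j => s.arr 12 (j : ℕ))
        (fun j => s'.arr 12 (j : ℕ)) (fun j => s'.arr 13 (j : ℕ)) (s'.var 12) (s'.var 13) ∧
      (∀ j : Fin n, s'.arr 12 (j : ℕ) ≤ s.arr 12 (j : ℕ) + (4 * n + 4)) ∧
      ∑ j : Fin n, s'.arr 12 (j : ℕ) + s'.var 12 + r
        = ∑ j : Fin n, s.arr 12 (j : ℕ) + n * (4 * n + 4) + n)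
    (by decide) hs (by
      refine ⟨?_, fun j => by linarith, by rw [hi]; push_cast; ring⟩
      simp only [h13, hi, hcur]
      exact Bidding.init _ _) (by
    rintro r s' hs' hf ⟨hB, hub, hr⟩ hpos
    have e0 : s'.var 0 = n := (hf.1 0 (by decide)).trans hn
    have htot : ∀ p : Fin n → ℤ, (∀ j, p j ≤ s.arr 12 (j : ℕ) + (4 * n + 4)) →
        ∑ j, p j ≤ ∑ j : Fin n, s.arr 12 (j : ℕ) + n * (4 * n + 4) := fun p hp => by
      refine (Finset.sum_le_sum fun j _ => hp j).trans (le_of_eq ?_)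
      simp [Finset.sum_add_distrib]
    have hle := hB.le
    refine (Ends.ifPos (m := 4 * n + 7) hs' (by decide) (fun hc => ?_) fun hc => ?_).mono
      (by omega) fun _ _ _ h => h
    · rw [Expr.eval_var] at hc
      have hcn := hB.cur_le
      obtain ⟨b, hb⟩ : ∃ b : Fin n, s'.var 13 = (b : ℕ) + 1 :=
        ⟨⟨(s'.var 13 - 1).toNat, by omega⟩, by simp only; omega⟩
      refine Ends.mono (m := 1 + ((n * 4 + 2) + (1 + (1 + (1 + 1))))) ?_ (by omega)
        fun _ _ _ h => h
      refine Ends.assign_seq hs' (by decide) (by simp) fun hs₁ => ?_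
      refine Ends.seq (bestLoop_ends (W := W) (q := q) (r := b) hs₁ (by simp [e0])
        (fun i j => ?_) ?_ (by simp [hb]) (by simp)) ?_
      · simp only [Memory.setVar_arr]
        rw [hf.2 11 (by decide), hW]
      · simp only [Memory.setVar_var]
        norm_num
        rw [hf.1 11 (by decide), hq]
      rintro s₂ hs₂ hf₂ ⟨j, hj, hmin⟩
      simp only [Memory.setVar_arr] at hmin
      have a12 : s₂.arr 12 = s'.arr 12 := by rw [hf₂.2 12 (by decide)]; rfl
      have a13 : s₂.arr 13 = s'.arr 13 := by rw [hf₂.2 13 (by decide)]; rfl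
      have v12 : s₂.var 12 = s'.var 12 := by rw [hf₂.1 12 (by decide)]; simp
      have v13 : s₂.var 13 = s'.var 13 := by rw [hf₂.1 13 (by decide)]; simp
      rw [hb] at hB
      have hpj := hB.price_le hmin hσ
      have hpj0 := (hp0 j).trans (hB.price_ge j)
      have hbid := hB.bid hmin
      have hZj := hZ j
      refine Ends.assign_seq hs₂ (by decide) (hs₂.2 _ _) fun hs₃ => ?_
      refine Ends.store_seq hs₃ (by decide) (hs₃.1 _) fun hs₄ => ?_
      refine Ends.store_seq hs₄ (by decide) ?_ fun hs₅ => ?_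
      · simp only [Expr.eval_add, Expr.eval_get, Expr.eval_var, Expr.eval_const,
          Memory.setArr_arr, Memory.setArr_var, Memory.setVar_var, Memory.setVar_arr]
        norm_num
        rw [hj, a12]
        omega
      refine Ends.assign hs₅ (by decide) (hs₅.1 _) ?_
      have n12 : ∀ l : Fin n, (if (l : ℕ) = (j : ℕ) then s'.arr 12 (j : ℕ) + 1
          else s'.arr 12 (l : ℕ)) = Function.update (fun j : Fin n => s'.arr 12 (j : ℕ)) j
            (s'.arr 12 (j : ℕ) + 1) l := fun l => by
        simp [Function.update_apply, Fin.ext_iff]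
      have n13 : ∀ l : Fin n, (if (l : ℕ) = (j : ℕ) then ((b : ℕ) : ℤ) + 1
          else s'.arr 13 (l : ℕ)) = Function.update (fun j : Fin n => s'.arr 13 (j : ℕ)) j
            (((b : ℕ) : ℤ) + 1) l := fun l => by
        simp [Function.update_apply, Fin.ext_iff]
      have ubn : ∀ l : Fin n, Function.update (fun j : Fin n => s'.arr 12 (j : ℕ)) j
          (s'.arr 12 (j : ℕ) + 1) l ≤ s.arr 12 (l : ℕ) + (4 * n + 4) := fun l => by
        by_cases h : l = j
        · subst h; simp only [Function.update_self]; linarith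
        · simp only [Function.update_of_ne h]; exact hub l
      have hsum : ∑ l : Fin n, Function.update (fun j : Fin n => s'.arr 12 (j : ℕ)) j
          (s'.arr 12 (j : ℕ) + 1) l = ∑ l : Fin n, s'.arr 12 (l : ℕ) + 1 := by
        rw [Finset.sum_update_of_mem (Finset.mem_univ j),
          ← Finset.add_sum_erase _ _ (Finset.mem_univ j), Finset.sdiff_singleton_eq_erase]
        ring
      have hr1 := htot _ ubn
      rw [hsum] at hr1
      have hrpos : 0 < r := by omega
      refine ⟨r - 1, by omega, ?_, ?_, ?_⟩
      · simpa [hj, a12, a13, v12, v13, hb, n12, n13] using hbid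
      · simpa [hj, a12, n12] using ubn
      · simp [hj, a12, n12, v12, hsum]
        omega
    · rw [Expr.eval_var] at hc
      have hc0 := hB.cur_nonneg
      have hc' : s'.var 13 = 0 := by omega
      simp only [Expr.eval_add, Expr.eval_sub, Expr.eval_var, e0, hc'] at hpos
      rw [hc'] at hB
      have hcl := hB.cur_le
      have hnext := hB.next (by omega)
      refine Ends.mono (m := 1 + 1) ?_ (by omega) fun _ _ _ h => h
      refine Ends.assign_seq hs' (by decide) ?_ fun hs₁ => Ends.assign hs₁ (by decide) (hs₁.1 _) ?_
      · simp only [Expr.eval_add, Expr.eval_var, Expr.eval_const]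
        omega
      · have := htot _ hub
        refine ⟨r - 1, by omega, ?_, ?_, ?_⟩
        · simpa using hnext
        · simpa using hub
        · simp
          omega)
  refine main.mono (by ring_nf; omega) ?_
  rintro s' hs' hf ⟨⟨r, hB, hub, hr⟩, hneg⟩
  have e0 : s'.var 0 = n := (hf.1 0 (by decide)).trans hn
  have h1 := hB.le
  have h2 := hB.cur_nonneg
  simp only [Expr.eval_add, Expr.eval_sub, Expr.eval_var, e0] at hneg
  have e12 : s'.var 12 = n := by omega
  have e13 : s'.var 13 = 0 := by omega
  rw [e12, e13] at hB
  obtain ⟨σ, hσ1, hσ2⟩ := hB.finish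
  exact ⟨σ, hσ1, hσ2, fun j => ⟨(hp0 j).trans (hB.price_ge j), hub j⟩⟩

lemma doubleLoop_ends (hs : s.Bounded Z) (hn : s.var 0 = n)
    (hZ : ∀ j : Fin n, (2 * s.arr 12 (j : ℕ)).natAbs ≤ Z) :
    Ends Z doubleLoop s (n * 4 + 2) fun s' => ∀ j : Fin n,
      s'.arr 12 (j : ℕ) = 2 * s.arr 12 (j : ℕ) ∧ s'.arr 13 (j : ℕ) = 0 := by
  have hnZ : n ≤ Z := by have := hs.1 0; omega
  have main := Ends.forLoop (Z := Z) (m := 2) (N := n) (s := s) (v := 2) (e := .var 0)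
    (p := .seq (.store 12 (.var 2) (.const 2 * .get 12 (.var 2))) (.store 13 (.var 2) (.const 0)))
    (fun t s' => ∀ j : Fin n, ((j : ℕ) < t →
      s'.arr 12 (j : ℕ) = 2 * s.arr 12 (j : ℕ) ∧ s'.arr 13 (j : ℕ) = 0) ∧
      (t ≤ j → s'.arr 12 (j : ℕ) = s.arr 12 (j : ℕ)))
    (by decide) hs hnZ (by decide) (fun s' hf => by
      rw [Expr.eval_var, hf.1 0 (by decide), hn]) (fun j => by simp) (by
    intro t ht s' hs' hf h2 hI
    have ht' := (hI ⟨t, ht⟩).2 le_rfl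
    have hZt := hZ ⟨t, ht⟩
    simp only at ht' hZt
    refine Ends.store_seq (m := 1) hs' (by decide) ?_ fun hs₁ =>
      Ends.store hs₁ (by decide) (by simp) fun j => ⟨fun hj => ?_, fun hj => ?_⟩
    · simpa [h2, ht'] using hZt
    · rcases (Nat.lt_succ_iff.1 hj).eq_or_lt with h | h
      · simp [h2, h, ht']
      · have hne : ¬ ((j : ℕ) = t) := h.ne
        simp [h2, hne, (hI j).1 h]
    · have hne : ¬ ((j : ℕ) = t) := by omega
      simp [h2, hne, (hI j).2 (by omega)])
  exact main.mono le_rfl fun s' _ _ h j => (h j).1 j.2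

end Verification

end Upgrade

namespace Upgrade

/-! ### Cost scaling -/

section Phases

variable {n Z : ℕ} {s : Memory} {W : Fin n → Fin n → ℤ}

/-- The number of steps of the bidding loop. -/
def bidSteps (n : ℕ) : ℕ := (n * (4 * n + 4) + n) * (4 * n + 9) + 1

/-- The number of steps of one phase. -/
def phaseSteps (n : ℕ) : ℕ := 1 + ((n * 4 + 2) + (1 + (1 + bidSteps n)))

/-- At first the divisor 2 ^ T exceeds all costs, so every quotient is 0 and any assignment is near
for zero prices. A phase sends a price p to at most 2 p + 4 n + 4, which solves to the invariant
bound. Owners are recorded only by a phase, hence the need for `1 ≤ T`. -/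
lemma phaseLoop_ends (hs : s.Bounded Z) (hn : s.var 0 = n) (hW : ∀ i j : Fin n,
    s.arr 11 ((i : ℕ) * n + (j : ℕ)) = W i j) {T : ℕ} (hq : s.var 11 = 2 ^ T) (hT : 1 ≤ T)
    (hWT : ∀ i j, 0 ≤ W i j ∧ W i j < 2 ^ T) (hp : ∀ j : Fin n, s.arr 12 (j : ℕ) = 0)
    (hZ : (4 * n + 4) * 2 ^ T ≤ Z) :
    Ends Z phaseLoop s (T * (phaseSteps n + 1) + 1) fun s' => ∃ σ : Fin n ≃ Fin n,
      (∀ j : Fin n, s'.arr 13 (j : ℕ) = (σ.symm j : ℕ) + 1) ∧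
      IsNear W (fun j => s'.arr 12 (j : ℕ)) 1 σ := by
  have main := Ends.whilePos (Z := Z) (m := phaseSteps n) (s := s)
    (e := .var 11 - .const 1) (p := phaseBody) (r := T)
    (fun r s' => s'.var 11 = 2 ^ r ∧ r ≤ T ∧
      (∀ j : Fin n, 0 ≤ s'.arr 12 (j : ℕ) ∧
        s'.arr 12 (j : ℕ) * 2 ^ r ≤ (4 * n + 4) * (2 ^ T - 2 ^ r)) ∧
      ∃ σ : Fin n ≃ Fin n, IsNear (fun i j => W i j / 2 ^ r) (fun j => s'.arr 12 (j : ℕ)) 1 σ ∧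
        (r < T → ∀ j : Fin n, s'.arr 13 (j : ℕ) = (σ.symm j : ℕ) + 1))
    (by decide) hs ⟨hq, le_rfl, fun j => by simp [hp], Equiv.refl _, fun i j => by
      simp [hp, Int.ediv_eq_zero_of_lt (hWT _ _).1 (hWT _ _).2], fun h => absurd h (lt_irrefl _)⟩ (by
    rintro r s' hs' hf ⟨h11, hrT, hpb, σ, hσ, -⟩ hpos
    obtain ⟨r, rfl⟩ : ∃ r', r = r' + 1 := by
      rcases r with _ | r
      · simp [h11] at hpos
      · exact ⟨r, rfl⟩
    have e0 : s'.var 0 = n := (hf.1 0 (by decide)).trans hn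
    have e11 : s'.arr 11 = s.arr 11 := hf.2 11 (by decide)
    have hhalf : (Expr.var 11 / Expr.const 2).eval s' = 2 ^ r := by
      simp only [Expr.eval_div, Expr.eval_var, Expr.eval_const, h11, pow_succ]
      omega
    have hr1 : (1 : ℤ) ≤ 2 ^ r := one_le_pow₀ (by norm_num)
    have hrT' : (2 : ℤ) ^ (r + 1) ≤ 2 ^ T := pow_le_pow_right₀ (by norm_num) hrT
    have hZ' : (4 * (n : ℤ) + 4) * 2 ^ T ≤ Z := by exact_mod_cast hZ
    rw [pow_succ] at hrT'
    have hnew : ∀ j : Fin n, (2 * s'.arr 12 (j : ℕ) + (4 * n + 4)) * 2 ^ r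
        ≤ (4 * n + 4) * (2 ^ T - 2 ^ r) := fun j => by
      have := (hpb j).2
      rw [pow_succ] at this
      linarith
    have hbound : ∀ j : Fin n, 2 * s'.arr 12 (j : ℕ) + (4 * n + 4) ≤ Z := fun j => by
      have h1 := hnew j
      have h2 := (hpb j).1
      have h3 : 2 * s'.arr 12 (j : ℕ) + (4 * n + 4)
          ≤ (2 * s'.arr 12 (j : ℕ) + (4 * n + 4)) * 2 ^ r :=
        le_mul_of_one_le_right (by positivity) hr1
      have h4 : (0 : ℤ) ≤ (4 * n + 4) * 2 ^ r := by positivity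
      linarith
    refine Ends.assign_seq hs' (by decide) ?_ fun hs₁ => ?_
    · rw [hhalf]
      have h2 : (0 : ℤ) ≤ (4 * n + 3) * 2 ^ T := by positivity
      zify
      rw [abs_of_nonneg (by positivity)]
      linarith
    refine Ends.seq (doubleLoop_ends hs₁ (by simp [e0]) fun j => ?_) fun s₂ hs₂ hf₂ hd => ?_
    · have h1 := hbound j
      have h2 := (hpb j).1
      simp only [Memory.setVar_arr]
      omega
    simp only [Memory.setVar_arr] at hd
    refine Ends.assign_seq hs₂ (by decide) (by simp) fun hs₃ => ?_
    refine Ends.assign_seq hs₃ (by decide) (by simp) fun hs₄ => ?_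
    have harr : ∀ j : Fin n, s₂.arr 12 (j : ℕ) = 2 * s'.arr 12 (j : ℕ) := fun j => (hd j).1
    refine (bidLoop_ends (W := W) (q := 2 ^ r) (σ := σ) hs₄ ?_ ?_ ?_ ?_ ?_ ?_ ?_ ?_ ?_).mono le_rfl
      fun s₅ hs₅ hf₅ h => ?_
    · simp only [Memory.setVar_var]
      norm_num
      rw [hf₂.1 0 (by decide)]
      simp [e0]
    · intro i j
      simp only [Memory.setVar_arr]
      rw [hf₂.2 11 (by decide), Memory.setVar_arr, e11, hW]
    · simp only [Memory.setVar_var]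
      norm_num
      rw [hf₂.1 11 (by decide)]
      simpa using hhalf
    · intro j
      simpa using (hd j).2
    · simp
    · simp
    · simp only [Memory.setVar_arr, harr]
      exact IsNear.double (q := 2 ^ r) (by positivity) (by simpa [pow_succ, mul_comm] using hσ)
    · intro j
      have := (hpb j).1
      simp only [Memory.setVar_arr, harr]
      positivity
    · intro j
      simp only [Memory.setVar_arr, harr]
      exact hbound j
    · obtain ⟨σ', ho, hnear, hpr⟩ := h
      simp only [Memory.setVar_arr, harr] at hpr
      refine ⟨r, by omega, ?_, by omega, fun j => ⟨(hpr j).1, ?_⟩, σ', hnear, fun _ => ho⟩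
      · rw [hf₅.1 11 (by decide)]
        simp only [Memory.setVar_var]
        norm_num
        rw [hf₂.1 11 (by decide)]
        simpa using hhalf
      · exact (mul_le_mul_of_nonneg_right (hpr j).2 (by positivity)).trans (hnew j))
  refine main.mono le_rfl ?_
  rintro s' hs' hf ⟨⟨r, h11, hrT, hpb, σ, hσ, ho⟩, hneg⟩
  obtain rfl : r = 0 := by
    by_contra h
    have : (2 : ℤ) ^ 1 ≤ 2 ^ r := pow_le_pow_right₀ (by norm_num) (by omega)
    simp only [Expr.eval_sub, Expr.eval_var, Expr.eval_const, h11] at hneg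
    omega
  exact ⟨σ, ho (by omega), by simpa using hσ⟩

end Phases

/-! ### The Lagrangian relaxation -/

/-- How much cheaper than a regular edge an upgraded edge is, after paying for the upgrade. -/
def gap (i j : Expr) : Expr :=
  .const 2 * (.get 9 i * .get 10 j) - .const 2 * (.get 8 i * .get 10 j) -
    (.const 2 * .var 10 + .const 1)

/-- Fill the cost matrix and clear the prices. -/
def fillLoop : Program :=
  forLoop 2 (.var 0 * .var 0) (.seq
    (.ifPos (gap (.var 2 / .var 0) (.var 2 - .var 2 / .var 0 * .var 0))
      (.store 11 (.var 2) ((.var 0 + .const 1) * (.const 2 * (.get 8 (.var 2 / .var 0) *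
        .get 10 (.var 2 - .var 2 / .var 0 * .var 0)) + (.const 2 * .var 10 + .const 1))))
      (.store 11 (.var 2) ((.var 0 + .const 1) * (.const 2 * (.get 9 (.var 2 / .var 0) *
        .get 10 (.var 2 - .var 2 / .var 0 * .var 0))))))
    (.store 12 (.var 2 / .var 0) (.const 0)))

/-- Solve the Lagrangian relaxation for the price given by the variable `10`. -/
def solve : Program := .seq fillLoop (.seq (.assign 11 (.var 7)) phaseLoop)

/-- Count the upgraded suppliers. -/
def countLoop : Program :=
  .seq (.assign 16 (.const 0)) (forLoop 2 (.var 0)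
    (.ifPos (gap (.get 13 (.var 2) - .const 1) (.var 2)) (.assign 16 (.var 16 + .const 1)) .skip))

/-- Write the solution. -/
def outputLoop : Program :=
  forLoop 2 (.var 0) (.ifPos (gap (.get 13 (.var 2) - .const 1) (.var 2))
    (.store 6 ((.get 13 (.var 2) - .const 1) * .var 0 + .var 2) (.const 1))
    (.store 7 ((.get 13 (.var 2) - .const 1) * .var 0 + .var 2) (.const 1)))

/-- Twice the cost of the cheaper edge between `i` and `j`, if an upgrade costs `m + 1 / 2`. -/
def Problem.edgeCost {n : ℕ} (P : Problem ℤ (Fin n) (Fin n)) (m : ℤ) (i j : Fin n) : ℤ :=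
  min (2 * (P.b i * P.d j) + (2 * m + 1)) (2 * (P.c i * P.d j))

/-- The suppliers that are upgraded in the assignment `σ`, if an upgrade costs `m + 1 / 2`. -/
def Problem.redSet {n : ℕ} (P : Problem ℤ (Fin n) (Fin n)) (m : ℤ) (σ : Fin n ≃ Fin n) :
    Finset (Fin n) :=
  Finset.univ.filter fun i =>
    0 < 2 * (P.c i * P.d (σ i)) - 2 * (P.b i * P.d (σ i)) - (2 * m + 1)

/-- The memory holds the integer instance `P` and the number `2 ^ T`. -/
structure Ready {n : ℕ} (P : Problem ℤ (Fin n) (Fin n)) (T : ℕ) (s : Memory) : Prop where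
  size : s.var 0 = n
  b : ∀ i : Fin n, s.arr 8 (i : ℕ) = P.b i
  c : ∀ i : Fin n, s.arr 9 (i : ℕ) = P.c i
  d : ∀ i : Fin n, s.arr 10 (i : ℕ) = P.d i
  scale : s.var 7 = 2 ^ T

section Relaxation

variable {n Z T : ℕ} {s : Memory} {P : Problem ℤ (Fin n) (Fin n)} {m : ℤ}

lemma Ready.frame (h : Ready P T s) {p : Program} {s' : Memory} (hf : Frame p s s')
    (h0 : 0 ∉ p.vars) (h7 : 7 ∉ p.vars) (h8 : 8 ∉ p.arrs) (h9 : 9 ∉ p.arrs) (h10 : 10 ∉ p.arrs) :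
    Ready P T s' :=
  ⟨(hf.1 0 h0).trans h.size, fun i => by rw [hf.2 8 h8, h.b], fun i => by rw [hf.2 9 h9, h.c],
    fun i => by rw [hf.2 10 h10, h.d], (hf.1 7 h7).trans h.scale⟩

lemma Ready.gap_eval (h : Ready P T s) (hm : s.var 10 = m) {e f : Expr} {i j : Fin n}
    (he : e.eval s = (i : ℕ)) (hf : f.eval s = (j : ℕ)) :
    (gap e f).eval s = 2 * (P.c i * P.d j) - 2 * (P.b i * P.d j) - (2 * m + 1) := by
  simp [gap, he, hf, h.b, h.c, h.d, hm]

/-- One counter t = i n + j runs through the matrix, and i and j are recovered by division. The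
factor `n + 1` is the one that `IsNear.sum_le` requires. Each price is cleared n times, which saves
a second loop. -/
lemma fillLoop_ends (hs : s.Bounded Z) (h : Ready P T s) (hm : s.var 10 = m) (hm0 : 0 ≤ m)
    (hZ : ∀ i j, ((n : ℤ) + 1) * (2 * (P.c i * P.d j)) ≤ Z) (hnn : n * n ≤ Z) :
    Ends Z fillLoop s (n * n * 5 + 2) fun s' =>
      (∀ i j : Fin n, s'.arr 11 ((i : ℕ) * n + (j : ℕ)) = (n + 1) * P.edgeCost m i j) ∧
      ∀ j : Fin n, s'.arr 12 (j : ℕ) = 0 := by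
  have main := Ends.forLoop (Z := Z) (m := 3) (N := n * n) (s := s) (v := 2)
    (e := .var 0 * .var 0) (p := .seq
    (.ifPos (gap (.var 2 / .var 0) (.var 2 - .var 2 / .var 0 * .var 0))
      (.store 11 (.var 2) ((.var 0 + .const 1) * (.const 2 * (.get 8 (.var 2 / .var 0) *
        .get 10 (.var 2 - .var 2 / .var 0 * .var 0)) + (.const 2 * .var 10 + .const 1))))
      (.store 11 (.var 2) ((.var 0 + .const 1) * (.const 2 * (.get 9 (.var 2 / .var 0) *
        .get 10 (.var 2 - .var 2 / .var 0 * .var 0))))))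
    (.store 12 (.var 2 / .var 0) (.const 0)))
    (fun t s' => (∀ i j : Fin n, (i : ℕ) * n + (j : ℕ) < t →
      s'.arr 11 ((i : ℕ) * n + (j : ℕ)) = (n + 1) * P.edgeCost m i j) ∧
      ∀ i : Fin n, (i : ℕ) * n < t → s'.arr 12 (i : ℕ) = 0)
    (by decide) hs hnn (by decide) (fun s' hf => by
      simp [hf.1 0 (by decide), h.size]) (by simp) (by
    rintro t ht s' hs' hf h2 ⟨hI1, hI2⟩
    have hR : Ready P T s' := h.frame hf (by decide) (by decide) (by decide) (by decide) (by decide)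
    have hm' : s'.var 10 = m := (hf.1 10 (by decide)).trans hm
    have hn0 : 0 < n := Nat.pos_of_mul_pos_left (by omega : 0 < n * n)
    obtain ⟨i, hi⟩ : ∃ i : Fin n, (i : ℕ) = t / n :=
      ⟨⟨t / n, Nat.div_lt_of_lt_mul ht⟩, rfl⟩
    obtain ⟨j, hj⟩ : ∃ j : Fin n, (j : ℕ) = t % n := ⟨⟨t % n, Nat.mod_lt _ hn0⟩, rfl⟩
    have htij : t = i * n + j := by
      rw [hi, hj, mul_comm]; exact (Nat.div_add_mod t n).symm
    have ei : (Expr.var 2 / Expr.var 0).eval s' = (i : ℕ) := by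
      rw [Expr.eval_div, Expr.eval_var, Expr.eval_var, h2, hR.size, hi]
      exact_mod_cast rfl
    have ej : (Expr.var 2 - Expr.var 2 / Expr.var 0 * Expr.var 0).eval s' = (j : ℕ) := by
      rw [Expr.eval_sub, Expr.eval_mul, ei, Expr.eval_var, Expr.eval_var, h2, hR.size, htij]
      push_cast; ring
    have hg := hR.gap_eval hm' ei ej
    have hpc := mul_nonneg (P.b_nonneg i) (P.d_nonneg j)
    refine Ends.seq (m := 2) (m' := 1) (R₁ := fun s'' => s'' =
      s'.setArr 11 ((i : ℕ) * n + (j : ℕ)) ((n + 1) * P.edgeCost m i j)) ?_ ?_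
    · refine Ends.ifPos (m := 1) hs' (by decide) (fun hpos => ?_) fun hneg => ?_
      · rw [hg] at hpos
        have hval : ((.var 0 + .const 1) * (.const 2 * (.get 8 (.var 2 / .var 0) *
            .get 10 (.var 2 - .var 2 / .var 0 * .var 0)) + (.const 2 * .var 10 + .const 1)) :
            Expr).eval s' = (n + 1) * P.edgeCost m i j := by
          rw [Problem.edgeCost, min_eq_left (by linarith)]
          simp only [Expr.eval_mul, Expr.eval_add, Expr.eval_get, ei, ej, Expr.eval_var,
            Expr.eval_const, hR.size, hR.b, hR.d, hm']
        refine Ends.store hs' (by decide) ?_ ?_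
        · rw [hval, Problem.edgeCost, min_eq_left (by linarith)]
          have h1 : ((n : ℤ) + 1) * (2 * (P.b i * P.d j) + (2 * m + 1))
              ≤ (n + 1) * (2 * (P.c i * P.d j)) :=
            mul_le_mul_of_nonneg_left (by linarith) (by positivity)
          have h2 := hZ i j
          zify
          rw [abs_of_nonneg (by positivity)]
          linarith
        · rw [hval, Expr.eval_var, h2, htij]
          push_cast; rfl
      · rw [hg] at hneg
        have hval : ((.var 0 + .const 1) * (.const 2 * (.get 9 (.var 2 / .var 0) *
            .get 10 (.var 2 - .var 2 / .var 0 * .var 0))) :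
            Expr).eval s' = (n + 1) * P.edgeCost m i j := by
          rw [Problem.edgeCost, min_eq_right (by linarith)]
          simp only [Expr.eval_mul, Expr.eval_add, Expr.eval_get, ei, ej, Expr.eval_var,
            Expr.eval_const, hR.size, hR.c, hR.d]
        refine Ends.store hs' (by decide) ?_ ?_
        · rw [hval, Problem.edgeCost, min_eq_right (by linarith)]
          have h2 := hZ i j
          have h3 := mul_nonneg ((P.b_nonneg i).trans (P.b_le_c i)) (P.d_nonneg j)
          zify
          rw [abs_of_nonneg (by positivity)]
          exact h2
        · rw [hval, Expr.eval_var, h2, htij]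
          push_cast; rfl
    · rintro s₁ hs₁ hf₁ rfl
      have ei' : (Expr.var 2 / Expr.var 0).eval
          (s'.setArr 11 ((i : ℕ) * n + (j : ℕ)) ((n + 1) * P.edgeCost m i j)) = (i : ℕ) := ei
      refine Ends.store hs₁ (by decide) (by simp) ⟨fun i' j' h' => ?_, fun i' h' => ?_⟩
      · simp only [Memory.setVar_arr, Memory.setArr_arr]
        norm_num
        by_cases he : ((i' : ℕ) : ℤ) * n + (j' : ℕ) = (i : ℕ) * n + (j : ℕ)
        · have he' : (i' : ℕ) * n + (j' : ℕ) = i * n + j := by exact_mod_cast he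
          have hd : ∀ a b : Fin n, ((a : ℕ) * n + b) / n = a := fun a b => by
            rw [mul_comm, Nat.mul_add_div hn0, Nat.div_eq_of_lt b.2, add_zero]
          have hii : i' = i := Fin.ext (by rw [← hd i' j', he', hd])
          subst hii
          have hjj : j' = j := Fin.ext (by omega)
          subst hjj
          simp
        · rw [if_neg he]
          refine hI1 i' j' ?_
          have : (i' : ℕ) * n + (j' : ℕ) ≠ i * n + j := fun h => he (by exact_mod_cast h)
          omega
      · simp only [Memory.setVar_arr, Memory.setArr_arr, ei', Expr.eval_const]
        norm_num
        intro hne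
        refine hI2 i' ?_
        have hii : (i' : ℕ) * n ≤ i * n + j := by omega
        by_contra hlt
        have hj2 := j.2
        have : (i' : ℕ) < i ∨ (i' : ℕ) > i := by omega
        rcases this with h3 | h3
        · have : ((i' : ℕ) + 1) * n ≤ i * n := Nat.mul_le_mul_right _ h3
          nlinarith
        · have : ((i : ℕ) + 1) * n ≤ i' * n := Nat.mul_le_mul_right _ h3
          nlinarith)
  refine main.mono le_rfl fun s' _ _ ⟨h1, h2⟩ => ⟨fun i j => h1 i j ?_, fun j => h2 j ?_⟩
  · have : ((i : ℕ) + 1) * n ≤ n * n := Nat.mul_le_mul_right _ i.2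
    nlinarith [j.2]
  · have := j.2
    have hn0 : 0 < n := j.pos
    exact Nat.mul_lt_mul_of_pos_right this hn0

/-- The cheaper colour may be taken on each edge separately. Edge costs are doubled to make the
half-integral price an integer. -/
lemma Problem.isPenalizedMin_redSet {σ : Fin n ≃ Fin n}
    (h : ∀ τ : Fin n ≃ Fin n, ∑ i, P.edgeCost m i (σ i) ≤ ∑ i, P.edgeCost m i (τ i)) :
    P.ofInt.IsPenalizedMin (m + 1 / 2) (σ, P.redSet m σ) := by
  have hval : ∀ M : (Fin n ≃ Fin n) × Finset (Fin n), P.ofInt.penalized (m + 1 / 2) M =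
      ((∑ i, if i ∈ M.2 then 2 * (P.b i * P.d (M.1 i)) + (2 * m + 1)
        else 2 * (P.c i * P.d (M.1 i)) : ℤ) : ℝ) / 2 := by
    intro M
    unfold Problem.penalized Problem.matchingCost
    have : (M.2.card : ℝ) = ∑ i, if i ∈ M.2 then (1 : ℝ) else 0 := by simp
    rw [this, Finset.mul_sum, ← Finset.sum_add_distrib, Int.cast_sum, Finset.sum_div]
    refine Finset.sum_congr rfl fun i _ => ?_
    by_cases hi : i ∈ M.2
    · simp [hi, Problem.ofInt]; ring
    · simp [hi, Problem.ofInt]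
  intro M'
  rw [hval, hval]
  refine div_le_div_of_nonneg_right (Int.cast_le.2 ?_) (by norm_num)
  calc _ = ∑ i, P.edgeCost m i (σ i) := Finset.sum_congr rfl fun i _ => by
        simp only [Problem.redSet, Finset.mem_filter, Finset.mem_univ, true_and, Problem.edgeCost]
        split_ifs with hi
        · exact (min_eq_left (by linarith)).symm
        · exact (min_eq_right (by linarith)).symm
    _ ≤ _ := h M'.1
    _ ≤ _ := Finset.sum_le_sum fun i _ => by
        unfold Problem.edgeCost
        split_ifs
        exacts [min_le_left _ _, min_le_right _ _]

/-- The number of steps for solving the Lagrangian relaxation. -/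
def solveSteps (n T : ℕ) : ℕ := (n * n * 5 + 2) + (1 + (T * (phaseSteps n + 1) + 1))

lemma solve_ends (hs : s.Bounded Z) (h : Ready P T s) (hm : s.var 10 = m) (hm0 : 0 ≤ m)
    (hT : 1 ≤ T) (hP : ∀ i j, ((n : ℤ) + 1) * (2 * (P.c i * P.d j)) < 2 ^ T)
    (hZ : (4 * n + 4) * 2 ^ T ≤ Z) (hnn : n * n ≤ Z) :
    Ends Z solve s (solveSteps n T) fun s' => ∃ σ : Fin n ≃ Fin n,
      (∀ j : Fin n, s'.arr 13 (j : ℕ) = (σ.symm j : ℕ) + 1) ∧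
      P.ofInt.IsPenalizedMin (m + 1 / 2) (σ, P.redSet m σ) := by
  have hTZ : (2 : ℤ) ^ T ≤ Z := by
    have h1 : (2 : ℤ) ^ T ≤ (4 * n + 4) * 2 ^ T :=
      le_mul_of_one_le_left (by positivity) (by linarith [Int.natCast_nonneg n])
    exact h1.trans (by exact_mod_cast hZ)
  refine Ends.seq (fillLoop_ends hs h hm hm0 (fun i j => (hP i j).le.trans hTZ) hnn) ?_
  rintro s₁ hs₁ hf₁ ⟨hW, hp⟩
  have h7 : s₁.var 7 = 2 ^ T := (hf₁.1 7 (by decide)).trans h.scale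
  refine Ends.assign_seq hs₁ (by decide) (hs₁.1 _) fun hs₂ => ?_
  refine (phaseLoop_ends (T := T) (W := fun i j => (n + 1) * P.edgeCost m i j) hs₂ ?_ hW ?_ hT
    (fun i j => ?_) hp hZ).mono le_rfl ?_
  · simpa using (hf₁.1 0 (by decide)).trans h.size
  · simp [h7]
  · have h1 := mul_nonneg (P.b_nonneg i) (P.d_nonneg j)
    have h2 := mul_nonneg ((P.b_nonneg i).trans (P.b_le_c i)) (P.d_nonneg j)
    constructor
    · unfold Problem.edgeCost
      exact mul_nonneg (by positivity) (le_min (by positivity) (by positivity))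
    · exact (mul_le_mul_of_nonneg_left (min_le_right _ _) (by positivity)).trans_lt (hP i j)
  · rintro s' hs' hf' ⟨σ, hσ, hnear⟩
    exact ⟨σ, hσ, Problem.isPenalizedMin_redSet hnear.sum_le⟩

lemma countLoop_ends (hs : s.Bounded Z) (h : Ready P T s) (hm : s.var 10 = m)
    {σ : Fin n ≃ Fin n} (hσ : ∀ j : Fin n, s.arr 13 (j : ℕ) = (σ.symm j : ℕ) + 1) :
    Ends Z countLoop s (1 + (n * 4 + 2)) fun s' => s'.var 16 = (P.redSet m σ).card := by
  have hnZ : n ≤ Z := by have := hs.1 0; have := h.size; omega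
  refine Ends.assign_seq hs (by decide) (by simp) fun hs₁ => ?_
  -- The loop runs over customers, so the upgraded suppliers are counted in the order of their
  -- customers.
  set S : ℕ → Finset (Fin n) := fun t => (P.redSet m σ).filter fun i => (σ i : ℕ) < t with hS
  refine (Ends.forLoop (m := 2) (N := n) (fun t s' => s'.var 16 = (S t).card)
    (by decide) hs₁ hnZ (by decide) (fun s' hf => by
      rw [Expr.eval_var, hf.1 0 (by decide)]; simp [h.size]) (by simp [hS]) ?_).mono le_rfl ?_
  · intro t ht s' hs' hf h2 hI
    have hR : Ready P T s' := ⟨by rw [hf.1 0 (by decide)]; simp [h.size],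
      fun i => by rw [hf.2 8 (by decide)]; simp [h.b], fun i => by rw [hf.2 9 (by decide)]; simp [h.c],
      fun i => by rw [hf.2 10 (by decide)]; simp [h.d], by rw [hf.1 7 (by decide)]; simp [h.scale]⟩
    have hm' : s'.var 10 = m := by rw [hf.1 10 (by decide)]; simp [hm]
    have h13 : s'.arr 13 = s.arr 13 := by rw [hf.2 13 (by decide)]; rfl
    set i := σ.symm ⟨t, ht⟩ with hi
    have hit : σ i = ⟨t, ht⟩ := by rw [hi, Equiv.apply_symm_apply]
    have hg := hR.gap_eval hm' (e := .get 13 (.var 2) - .const 1) (f := .var 2) (i := i)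
      (j := ⟨t, ht⟩) (by
        have := hσ ⟨t, ht⟩
        simp only at this
        simp [h2, h13, this, hi]) (by simp [h2])
    have hmem : i ∈ P.redSet m σ ↔ 0 < 2 * (P.c i * P.d ⟨t, ht⟩) - 2 * (P.b i * P.d ⟨t, ht⟩) -
        (2 * m + 1) := by simp [Problem.redSet, hit]
    have hiS : i ∉ S t := by simp [hS, hit]
    have hcl : (S (t + 1)).card ≤ n := by
      simpa using Finset.card_le_univ (S (t + 1))
    refine Ends.ifPos (m := 1) hs' (by decide) (fun hpos => ?_) fun hneg => ?_
    · rw [hg, ← hmem] at hpos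
      have : S (t + 1) = insert i (S t) := by
        ext x
        simp only [hS, Finset.mem_filter, Finset.mem_insert]
        constructor
        · rintro ⟨hx, hlt⟩
          rcases (Nat.lt_succ_iff.1 hlt).eq_or_lt with h' | h'
          · exact Or.inl (σ.injective (by rw [hit]; exact Fin.ext h'))
          · exact Or.inr ⟨hx, h'⟩
        · rintro (rfl | ⟨hx, hlt⟩)
          · exact ⟨hpos, by rw [hit]; simp⟩
          · exact ⟨hx, by omega⟩
      have hcard : (S (t + 1)).card = (S t).card + 1 := by
        rw [this, Finset.card_insert_of_notMem hiS]
      refine Ends.assign hs' (by decide) ?_ ?_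
      · simp only [Expr.eval_add, Expr.eval_var, Expr.eval_const, hI]
        omega
      · simp [hI, hcard]
    · rw [hg, ← hmem] at hneg
      have : S (t + 1) = S t := by
        ext x
        simp only [hS, Finset.mem_filter]
        constructor
        · rintro ⟨hx, hlt⟩
          rcases (Nat.lt_succ_iff.1 hlt).eq_or_lt with h' | h'
          · have : x = i := σ.injective (by rw [hit]; exact Fin.ext h')
            exact absurd (this ▸ hx) hneg
          · exact ⟨hx, h'⟩
        · exact fun ⟨hx, hlt⟩ => ⟨hx, by omega⟩
      refine Ends.skip hs' ?_
      simp [hI, this]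
  · intro s' _ _ hI
    rw [hI]
    congr 2
    exact Finset.filter_true_of_mem fun i _ => (σ i).2

/-- Only the entries 1 are written, so arrays 6 and 7 have to be zero beforehand. -/
lemma outputLoop_ends (hs : s.Bounded Z) (h : Ready P T s) (hm : s.var 10 = m)
    (hZ : 1 ≤ Z) {σ : Fin n ≃ Fin n} (hσ : ∀ j : Fin n, s.arr 13 (j : ℕ) = (σ.symm j : ℕ) + 1)
    (h6 : ∀ z, s.arr 6 z = 0) (h7 : ∀ z, s.arr 7 z = 0) :
    Ends Z outputLoop s (n * 4 + 2) fun s' =>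
      outputPoint n s' = matchingPoint (σ, P.redSet m σ) := by
  have hnZ : n ≤ Z := by have := hs.1 0; have := h.size; omega
  refine (Ends.forLoop (m := 2) (N := n) (fun t s' => ∀ i j : Fin n,
    s'.arr 6 ((i : ℕ) * n + (j : ℕ)) = (if (j : ℕ) < t ∧ σ i = j ∧ i ∈ P.redSet m σ then 1 else 0) ∧
    s'.arr 7 ((i : ℕ) * n + (j : ℕ)) = (if (j : ℕ) < t ∧ σ i = j ∧ i ∉ P.redSet m σ then 1 else 0))
    (by decide) hs hnZ (by decide) (fun s' hf => by
      rw [Expr.eval_var, hf.1 0 (by decide), h.size]) (by simp [h6, h7]) ?_).mono le_rfl ?_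
  · intro t ht s' hs' hf h2 hI
    have hR : Ready P T s' := h.frame hf (by decide) (by decide) (by decide) (by decide) (by decide)
    have hm' : s'.var 10 = m := (hf.1 10 (by decide)).trans hm
    have h13 : s'.arr 13 = s.arr 13 := hf.2 13 (by decide)
    set i := σ.symm ⟨t, ht⟩ with hi
    have hit : σ i = ⟨t, ht⟩ := by rw [hi, Equiv.apply_symm_apply]
    have he : (Expr.get 13 (.var 2) - .const 1).eval s' = (i : ℕ) := by
      have := hσ ⟨t, ht⟩
      simp only at this
      simp [h2, h13, this, hi]
    have hg := hR.gap_eval hm' (e := .get 13 (.var 2) - .const 1) (f := .var 2) (i := i)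
      (j := ⟨t, ht⟩) he (by simp [h2])
    have hmem : i ∈ P.redSet m σ ↔ 0 < 2 * (P.c i * P.d ⟨t, ht⟩) - 2 * (P.b i * P.d ⟨t, ht⟩) -
        (2 * m + 1) := by simp [Problem.redSet, hit]
    have haddr : ((Expr.get 13 (.var 2) - .const 1) * .var 0 + .var 2).eval s'
        = (i : ℕ) * n + (t : ℕ) := by
      rw [Expr.eval_add, Expr.eval_mul, he, Expr.eval_var, Expr.eval_var, hR.size, h2]
    have hn0 : 0 < n := by omega
    have hpair : ∀ i' j' : Fin n, ((i' : ℕ) : ℤ) * n + (j' : ℕ) = (i : ℕ) * n + (t : ℕ) ↔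
        i' = i ∧ (j' : ℕ) = t := by
      intro i' j'
      constructor
      · intro hh
        have he' : (i' : ℕ) * n + (j' : ℕ) = i * n + t := by exact_mod_cast hh
        have hd : ∀ a b : ℕ, b < n → (a * n + b) / n = a := fun a b hb => by
          rw [mul_comm, Nat.mul_add_div hn0, Nat.div_eq_of_lt hb, add_zero]
        have hii : i' = i := Fin.ext (by rw [← hd i' j' j'.2, he', hd _ _ ht])
        subst hii
        exact ⟨rfl, by omega⟩
      · rintro ⟨rfl, hj⟩
        rw [hj]
    have hstep : ∀ i' j' : Fin n, ((j' : ℕ) < t + 1 ∧ σ i' = j') ↔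
        ((i' = i ∧ (j' : ℕ) = t) ∨ ((j' : ℕ) < t ∧ σ i' = j')) := by
      intro i' j'
      constructor
      · rintro ⟨h1, h3⟩
        rcases (Nat.lt_succ_iff.1 h1).eq_or_lt with h' | h'
        · exact Or.inl ⟨σ.injective (by rw [hit, h3]; exact Fin.ext h'), h'⟩
        · exact Or.inr ⟨h', h3⟩
      · rintro (⟨rfl, h1⟩ | ⟨h1, h3⟩)
        · exact ⟨by omega, by rw [hit]; exact Fin.ext h1.symm⟩
        · exact ⟨by omega, h3⟩
    refine Ends.ifPos (m := 1) hs' (by decide) (fun hpos => ?_) fun hneg => ?_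
    · rw [hg, ← hmem] at hpos
      refine Ends.store hs' (by decide) (by simpa using hZ) fun i' j' => ?_
      simp only [Memory.setVar_arr, Memory.setArr_arr, haddr, hpair, Expr.eval_const,
        (hI i' j').1, (hI i' j').2, ← and_assoc, hstep]
      by_cases hc : i' = i ∧ (j' : ℕ) = t
      · obtain ⟨rfl, hj⟩ := hc
        simp [hj, hpos]
      · simp [hc]
    · rw [hg, ← hmem] at hneg
      refine Ends.store hs' (by decide) (by simpa using hZ) fun i' j' => ?_
      simp only [Memory.setVar_arr, Memory.setArr_arr, haddr, hpair, Expr.eval_const,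
        (hI i' j').1, (hI i' j').2, ← and_assoc, hstep]
      by_cases hc : i' = i ∧ (j' : ℕ) = t
      · obtain ⟨rfl, hj⟩ := hc
        simp [hj, hneg]
      · simp [hc]
  · intro s' _ _ hI
    refine Prod.ext (funext fun e => ?_) (funext fun e => ?_)
    · have := (hI e.1 e.2).1
      simp only [outputPoint, matchingPoint, this, e.2.2, true_and]
      push_cast; rfl
    · have := (hI e.1 e.2).2
      simp only [outputPoint, matchingPoint, this, e.2.2, true_and]
      push_cast; rfl

end Relaxation

end Upgrade

namespace Upgrade

/-! ### The search for the price -/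

/-- One step of the binary search between the variables `8` and `9`. -/
def searchBody : Program :=
  .seq (.assign 10 ((.var 8 + .var 9) / .const 2)) (.seq solve (.seq countLoop
    (.ifPos (.var 1 - .var 16 + .const 1) (.assign 9 (.var 10)) (.assign 8 (.var 10)))))

def search : Program := .whilePos (.var 9 - .var 8 - .const 1) searchBody

/-- Search for the price, solve for this price and write the solution. -/
def searchAndOutput : Program :=
  .seq search (.seq (.assign 10 (.var 9)) (.seq solve outputLoop))

/-- The numbers that occur in the solution of `P` are bounded by `Z`. -/
structure Fits {n : ℕ} (P : Problem ℤ (Fin n) (Fin n)) (T Z : ℕ) : Prop where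
  one_le : 1 ≤ T
  cost_lt : ∀ i j, ((n : ℤ) + 1) * (2 * (P.c i * P.d j)) < 2 ^ T
  price_le : (4 * n + 4) * 2 ^ T ≤ Z
  sq_le : n * n ≤ Z

/-- The number of steps of one step of the binary search. -/
def searchBodySteps (n T : ℕ) : ℕ := 1 + (solveSteps n T + ((1 + (n * 4 + 2)) + (1 + 1)))

section Search

variable {n Z T : ℕ} {s : Memory} {P : Problem ℤ (Fin n) (Fin n)}

/-- Initially `-1` stands for a lower end that was never tested. The interval has length at most 2 ^
r and is halved, so `r` bounds the iterations. No monotonicity of the counts is needed: the two ends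
finally become adjacent, with the required outcomes. -/
lemma search_ends (hs : s.Bounded Z) (h : Ready P T s) (hF : Fits P T Z) {k : ℕ}
    (hk : s.var 1 = k) {H : ℕ} (hlo : s.var 8 = -1) (hhi : s.var 9 = H) {r : ℕ} (hr : H < 2 ^ r)
    (hHM : ∃ M : (Fin n ≃ Fin n) × Finset (Fin n),
      P.ofInt.IsPenalizedMin ((H : ℤ) + 1 / 2) M ∧ M.2.card ≤ k) :
    Ends Z search s (r * (searchBodySteps n T + 1) + 1) fun s' =>
      0 ≤ s'.var 9 ∧ (∃ M : (Fin n ≃ Fin n) × Finset (Fin n),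
        P.ofInt.IsPenalizedMin (s'.var 9 + 1 / 2) M ∧ M.2.card ≤ k) ∧
      (s'.var 9 = 0 ∨ ∃ M : (Fin n ≃ Fin n) × Finset (Fin n),
        P.ofInt.IsPenalizedMin ((s'.var 9 - 1 : ℤ) + 1 / 2) M ∧ k < M.2.card) := by
  have main := Ends.whilePos (Z := Z) (m := searchBodySteps n T) (s := s)
    (e := .var 9 - .var 8 - .const 1) (p := searchBody) (r := r)
    (fun r s' => -1 ≤ s'.var 8 ∧ s'.var 8 < s'.var 9 ∧ s'.var 9 - s'.var 8 ≤ 2 ^ r ∧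
      (∃ M : (Fin n ≃ Fin n) × Finset (Fin n),
        P.ofInt.IsPenalizedMin (s'.var 9 + 1 / 2) M ∧ M.2.card ≤ k) ∧
      (s'.var 8 = -1 ∨ ∃ M : (Fin n ≃ Fin n) × Finset (Fin n),
        P.ofInt.IsPenalizedMin (s'.var 8 + 1 / 2) M ∧ k < M.2.card))
    (by decide) hs (by
      have hr' : (H : ℤ) < 2 ^ r := by exact_mod_cast hr
      refine ⟨hlo.ge, by omega, by omega, ?_, Or.inl hlo⟩
      rw [hhi]; exact hHM) (by
    rintro r s' hs' hf ⟨h1, h2, h3, hhi, hlo⟩ hpos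
    simp only [Expr.eval_sub, Expr.eval_var, Expr.eval_const] at hpos
    obtain ⟨r, rfl⟩ : ∃ r', r = r' + 1 := by
      rcases r with _ | r
      · simp only [pow_zero] at h3; omega
      · exact ⟨r, rfl⟩
    rw [pow_succ] at h3
    have hR : Ready P T s' := h.frame hf (by decide) (by decide) (by decide) (by decide) (by decide)
    have hk' : s'.var 1 = k := (hf.1 1 (by decide)).trans hk
    obtain ⟨m, hm⟩ : ∃ m, m = (s'.var 8 + s'.var 9) / 2 := ⟨_, rfl⟩
    have hmv : ((Expr.var 8 + Expr.var 9) / Expr.const 2).eval s' = m := by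
      simp only [Expr.eval_add, Expr.eval_div, Expr.eval_var, Expr.eval_const, hm]
    have b9 := hs'.1 9
    refine Ends.assign_seq hs' (by decide) (by rw [hmv]; omega) fun hs₁ => ?_
    rw [hmv] at hs₁ ⊢
    have hR₁ : Ready P T (s'.setVar 10 m) := ⟨by simp [hR.size], by simpa using hR.b,
      by simpa using hR.c, by simpa using hR.d, by simp [hR.scale]⟩
    refine Ends.seq (solve_ends (m := m) hs₁ hR₁ (by simp) (by omega) hF.one_le hF.cost_lt
      hF.price_le hF.sq_le) ?_
    rintro s₂ hs₂ hf₂ ⟨σ, hσ, hmin⟩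
    have hR₂ : Ready P T s₂ :=
      hR₁.frame hf₂ (by decide) (by decide) (by decide) (by decide) (by decide)
    have v10 : s₂.var 10 = m := by rw [hf₂.1 10 (by decide)]; simp
    refine Ends.seq (countLoop_ends hs₂ hR₂ v10 hσ) ?_
    intro s₃ hs₃ hf₃ hc
    have w10 : s₃.var 10 = m := (hf₃.1 10 (by decide)).trans v10
    have w1 : s₃.var 1 = k := by
      rw [hf₃.1 1 (by decide), hf₂.1 1 (by decide)]; simp [hk']
    have w8 : s₃.var 8 = s'.var 8 := by
      rw [hf₃.1 8 (by decide), hf₂.1 8 (by decide)]; simp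
    have w9 : s₃.var 9 = s'.var 9 := by
      rw [hf₃.1 9 (by decide), hf₂.1 9 (by decide)]; simp
    refine Ends.ifPos (m := 1) hs₃ (by decide) (fun hp => ?_) fun hp => ?_
    · simp only [Expr.eval_add, Expr.eval_sub, Expr.eval_var, Expr.eval_const, w1, hc] at hp
      refine Ends.assign hs₃ (by decide) (hs₃.1 _) ⟨r, by omega, ?_⟩
      simp only [Memory.setVar_var, Expr.eval_var, w8, w10]
      norm_num [-Prod.exists]
      exact ⟨h1, by omega, by omega, ⟨_, hmin, (by omega : (P.redSet m σ).card ≤ k)⟩, hlo⟩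
    · simp only [Expr.eval_add, Expr.eval_sub, Expr.eval_var, Expr.eval_const, w1, hc] at hp
      refine Ends.assign hs₃ (by decide) (hs₃.1 _) ⟨r, by omega, ?_⟩
      simp only [Memory.setVar_var, Expr.eval_var, w9, w10]
      norm_num [-Prod.exists]
      exact ⟨by omega, by omega, by omega, hhi, Or.inr ⟨_, hmin, (by omega : k < (P.redSet m σ).card)⟩⟩)
  refine main.mono le_rfl ?_
  rintro s' hs' hf ⟨⟨r, h1, h2, h3, hhi, hlo⟩, hneg⟩
  simp only [Expr.eval_sub, Expr.eval_var, Expr.eval_const] at hneg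
  have e : s'.var 8 = s'.var 9 - 1 := by omega
  refine ⟨by omega, hhi, ?_⟩
  rw [e] at hlo
  rcases hlo with h' | h'
  · exact Or.inl (by omega)
  · exact Or.inr h'

/-- The number of steps of the search and the output. -/
def searchAndOutputSteps (n r T : ℕ) : ℕ :=
  (r * (searchBodySteps n T + 1) + 1) + (1 + (solveSteps n T + (n * 4 + 2)))

/-- The final call of `solve` may return another optimal solution than the search has seen;
`card_eq_of_search` applies to every optimal solution at that price. -/
lemma searchAndOutput_ends (hs : s.Bounded Z) (h : Ready P T s) (hF : Fits P T Z)
    (hgen : ∀ M M', P.intCost M = P.intCost M' → M.2 = M'.2) {k : ℕ} (hkn : k ≤ n)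
    (hk : s.var 1 = k) {H : ℕ} (hlo : s.var 8 = -1) (hhi : s.var 9 = H) {r : ℕ} (hr : H < 2 ^ r)
    (hH : ∀ i j, P.c i * P.d j ≤ H) (h6 : ∀ z, s.arr 6 z = 0) (h7 : ∀ z, s.arr 7 z = 0) :
    Ends Z searchAndOutput s (searchAndOutputSteps n r T) fun s' =>
      ∃ M : (Fin n ≃ Fin n) × Finset (Fin n), outputPoint n s' = matchingPoint M ∧
        M.2.card = k ∧ ∃ x, P.ofInt.IsPenalizedMin x M := by
  obtain ⟨M₀, hM₀, hc₀⟩ := P.exists_isPenalizedMin_empty (m := H) hH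
  refine Ends.seq (search_ends hs h hF hk hlo hhi hr ⟨M₀, hM₀, by omega⟩) ?_
  rintro s₁ hs₁ hf₁ ⟨hpos, ⟨M, hM, hMk⟩, hor⟩
  have hR₁ : Ready P T s₁ := h.frame hf₁ (by decide) (by decide) (by decide) (by decide) (by decide)
  refine Ends.assign_seq hs₁ (by decide) (hs₁.1 _) fun hs₂ => ?_
  have hR₂ : Ready P T (s₁.setVar 10 (s₁.var 9)) := ⟨by simp [hR₁.size], by simpa using hR₁.b,
    by simpa using hR₁.c, by simpa using hR₁.d, by simp [hR₁.scale]⟩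
  refine Ends.seq (solve_ends (m := s₁.var 9) hs₂ hR₂ (by simp) hpos hF.one_le hF.cost_lt
    hF.price_le hF.sq_le) ?_
  rintro s₃ hs₃ hf₃ ⟨σ, hσ, hmin⟩
  have hR₃ : Ready P T s₃ :=
    hR₂.frame hf₃ (by decide) (by decide) (by decide) (by decide) (by decide)
  have hZ1 : 1 ≤ Z := le_trans (Nat.mul_pos (by omega) (by positivity)) hF.price_le
  refine (outputLoop_ends (m := s₁.var 9) hs₃ hR₃ ?_ hZ1 hσ ?_ ?_).mono le_rfl
    fun s₄ hs₄ hf₄ ho => ⟨_, ho, ?_, _, hmin⟩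
  · rw [hf₃.1 10 (by decide)]; simp
  · intro z
    rw [hf₃.2 6 (by decide)]
    simp only [Memory.setVar_arr]
    rw [hf₁.2 6 (by decide), h6]
  · intro z
    rw [hf₃.2 7 (by decide)]
    simp only [Memory.setVar_arr]
    rw [hf₁.2 7 (by decide), h7]
  · refine Problem.card_eq_of_search (Q := P.ofInt) (fun M M' he => hgen M M' ?_)
      (fun M => ⟨_, P.matchingCost_ofInt M⟩) (by simpa using hkn) hM hMk hor hmin
    rw [P.matchingCost_ofInt, P.matchingCost_ofInt] at he
    exact_mod_cast he

end Search

/-! ### Scaling of a rational instance -/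

section Scaling

variable {n : ℕ}

/-- The product of the denominators. -/
def Problem.denProd (Q : Problem ℚ (Fin n) (Fin n)) : ℕ :=
  ∏ i, ((Q.b i).den * ((Q.c i).den * (Q.d i).den))

/-- The integer multiple of `x`, for a multiple `D` of the denominator. -/
def scaleRat (D : ℕ) (x : ℚ) : ℤ := x.num * ((D : ℤ) / (x.den : ℤ))

lemma scaleRat_cast {D : ℕ} {x : ℚ} (h : x.den ∣ D) : (scaleRat D x : ℚ) = D * x := by
  have h0 : (x.den : ℚ) ≠ 0 := by exact_mod_cast x.den_ne_zero
  obtain ⟨e, rfl⟩ := h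
  unfold scaleRat
  have hd : (x.den : ℤ) ≠ 0 := by exact_mod_cast x.den_ne_zero
  rw [Nat.cast_mul, Int.mul_ediv_cancel_left _ hd]
  have := Rat.mul_den_eq_num x
  push_cast
  rw [← this]
  ring

lemma scaleRat_le {D : ℕ} {x : ℚ} (hx : 0 ≤ x) : scaleRat D x ≤ x.num * D :=
  mul_le_mul_of_nonneg_left (Int.ediv_le_self _ (by positivity)) (Rat.num_nonneg.2 hx)

lemma le_scaleRat {D : ℕ} {x : ℚ} (hx : 0 ≤ x) (h : x.den ∣ D) (hD : 0 < D) :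
    x.num ≤ scaleRat D x := by
  have h1 : 1 ≤ D / x.den := Nat.div_pos (Nat.le_of_dvd hD h) x.den_pos
  have h2 : (1 : ℤ) ≤ (D : ℤ) / (x.den : ℤ) := by exact_mod_cast h1
  exact le_mul_of_one_le_right (Rat.num_nonneg.2 hx) h2

variable (Q : Problem ℚ (Fin n) (Fin n))

lemma Problem.den_dvd (i : Fin n) : (Q.b i).den ∣ Q.denProd ∧ (Q.c i).den ∣ Q.denProd ∧
    (Q.d i).den ∣ Q.denProd := by
  have h := Finset.dvd_prod_of_mem (fun i => (Q.b i).den * ((Q.c i).den * (Q.d i).den))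
    (Finset.mem_univ i)
  exact ⟨(Dvd.intro _ rfl).trans h, ((Dvd.intro _ rfl).mul_left _).trans h,
    ((Dvd.intro_left _ rfl).mul_left _).trans h⟩

lemma Problem.denProd_pos : 0 < Q.denProd :=
  Finset.prod_pos fun i _ => Nat.mul_pos (Q.b i).den_pos (Nat.mul_pos (Q.c i).den_pos (Q.d i).den_pos)

/-- The integer instance that results from clearing the denominators. -/
def Problem.scaled : Problem ℤ (Fin n) (Fin n) where
  b i := scaleRat Q.denProd (Q.b i)
  c i := scaleRat Q.denProd (Q.c i)
  d j := scaleRat Q.denProd (Q.d j)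
  k := Q.k
  b_nonneg i := (Rat.num_nonneg.2 (Q.b_nonneg i)).trans
    (le_scaleRat (Q.b_nonneg i) (Q.den_dvd i).1 Q.denProd_pos)
  b_le_c i := by
    have : (scaleRat Q.denProd (Q.b i) : ℚ) ≤ scaleRat Q.denProd (Q.c i) := by
      rw [scaleRat_cast (Q.den_dvd i).1, scaleRat_cast (Q.den_dvd i).2.1]
      exact mul_le_mul_of_nonneg_left (Q.b_le_c i) (by positivity)
    exact_mod_cast this
  d_nonneg i := (Rat.num_nonneg.2 (Q.d_nonneg i)).trans
    (le_scaleRat (Q.d_nonneg i) (Q.den_dvd i).2.2 Q.denProd_pos)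
  card_eq := Q.card_eq
  k_le := Q.k_le

/-- The square arises because costs and demands are both scaled. -/
lemma Problem.intCost_scaled (M : (Fin n ≃ Fin n) × Finset (Fin n)) :
    (Q.scaled.intCost M : ℝ) = (Q.denProd : ℝ) ^ 2 * Q.toReal.matchingCost M := by
  have hb : ∀ i, (Q.scaled.b i : ℝ) = Q.denProd * Q.b i := fun i => by
    have := scaleRat_cast (Q.den_dvd i).1
    exact_mod_cast congrArg (fun x : ℚ => (x : ℝ)) this
  have hc : ∀ i, (Q.scaled.c i : ℝ) = Q.denProd * Q.c i := fun i => by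
    have := scaleRat_cast (Q.den_dvd i).2.1
    exact_mod_cast congrArg (fun x : ℚ => (x : ℝ)) this
  have hd : ∀ i, (Q.scaled.d i : ℝ) = Q.denProd * Q.d i := fun i => by
    have := scaleRat_cast (Q.den_dvd i).2.2
    exact_mod_cast congrArg (fun x : ℚ => (x : ℝ)) this
  unfold Problem.intCost Problem.matchingCost Problem.toReal
  rw [Finset.mul_sum]
  push_cast
  refine Finset.sum_congr rfl fun i _ => ?_
  by_cases hi : i ∈ M.2 <;> (simp only [hi, if_true, if_false, hb, hc, hd]; ring)

/-- The scaling factor of the perturbation. -/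
def Problem.factor : ℕ :=
  2 ^ n * (Q.denProd * (n + 2 + ∑ i, ((Q.c i).num.toNat + (Q.d i).num.toNat)))

/-- The perturbed integer instance. -/
def Problem.generic : Problem ℤ (Fin n) (Fin n) := Q.scaled.perturb Q.factor

lemma Problem.factor_dvd : 2 ^ n ∣ Q.factor := Dvd.intro _ rfl

/-- Clearing denominators multiplies a numerator by at most `denProd`. This is the size condition of
`intCost_le_of_perturb`, bounded without computing the scaled data. -/
lemma Problem.le_factor :
    2 ^ n * (∑ i, Q.scaled.c i + ∑ j, Q.scaled.d j + n + 1) ≤ (Q.factor : ℤ) := by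
  have e : ((∑ i, ((Q.c i).num.toNat + (Q.d i).num.toNat) : ℕ) : ℤ)
      = ∑ i, (Q.c i).num + ∑ i, (Q.d i).num := by
    push_cast
    rw [Finset.sum_add_distrib]
    congr 1 <;> refine Finset.sum_congr rfl fun i _ => Int.toNat_of_nonneg (Rat.num_nonneg.2 ?_)
    exacts [(Q.b_nonneg i).trans (Q.b_le_c i), Q.d_nonneg i]
  unfold Problem.factor
  rw [Nat.cast_mul, Nat.cast_mul, Nat.cast_add, e]
  push_cast
  refine mul_le_mul_of_nonneg_left ?_ (by positivity)
  have h1 : ∑ i, Q.scaled.c i ≤ ∑ i, (Q.c i).num * (Q.denProd : ℤ) :=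
    Finset.sum_le_sum fun i _ => scaleRat_le ((Q.b_nonneg i).trans (Q.b_le_c i))
  have h2 : ∑ i, Q.scaled.d i ≤ ∑ i, (Q.d i).num * (Q.denProd : ℤ) :=
    Finset.sum_le_sum fun i _ => scaleRat_le (Q.d_nonneg i)
  rw [← Finset.sum_mul] at h1 h2
  have h3 : (1 : ℤ) ≤ Q.denProd := by exact_mod_cast Q.denProd_pos
  have h4 : ((n : ℤ) + 2) ≤ Q.denProd * (n + 2) := le_mul_of_one_le_left (by positivity) h3
  linarith

lemma Problem.generic_injective {M M' : (Fin n ≃ Fin n) × Finset (Fin n)}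
    (h : Q.generic.intCost M = Q.generic.intCost M') : M.2 = M'.2 :=
  Q.scaled.perturb_generic Q.factor_dvd h

/-- Minimizing the perturbed costs for a fixed number of upgrades yields an optimal vertex. -/
lemma Problem.isOptimalVertex_of_generic {M : (Fin n ≃ Fin n) × Finset (Fin n)}
    (hk : M.2.card = Q.k) {x : ℝ} (hM : Q.generic.ofInt.IsPenalizedMin x M) :
    Q.toReal.IsOptimalVertex (matchingPoint M) := by
  refine Q.toReal.isOptimalVertex_matchingPoint hk fun M' hk' => ?_
  have h1 := hM M'
  unfold Problem.penalized at h1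
  have hk'' : M'.2.card = M.2.card := hk'.trans hk.symm
  rw [hk'', Problem.matchingCost_ofInt, Problem.matchingCost_ofInt] at h1
  have h2 : Q.generic.intCost M ≤ Q.generic.intCost M' := by
    have : (Q.generic.intCost M : ℝ) ≤ Q.generic.intCost M' := by linarith
    exact_mod_cast this
  have h3 : (Q.scaled.intCost M : ℝ) ≤ Q.scaled.intCost M' := by
    exact_mod_cast Q.scaled.intCost_le_of_perturb Q.le_factor h2
  rw [Q.intCost_scaled, Q.intCost_scaled] at h3
  have h4 : (0 : ℝ) < (Q.denProd : ℝ) ^ 2 := by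
    have : (0 : ℝ) < Q.denProd := by exact_mod_cast Q.denProd_pos
    positivity
  exact le_of_mul_le_mul_left h3 h4

end Scaling

end Upgrade

namespace Upgrade

/-! ### Preparation of the instance -/

/-- Compute the product of the denominators, `2 ^ n`, and the scaling factor in the variables `3`,
`4` and `5`. -/
def factorProgram : Program :=
  .seq (.assign 3 (.const 1)) (.seq (.assign 4 (.const 1)) (.seq (.assign 5 (.var 0 + .const 2))
    (.seq (forLoop 2 (.var 0) (.seq
      (.assign 3 (.var 3 * (.get 1 (.var 2) * (.get 3 (.var 2) * .get 5 (.var 2)))))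
      (.seq (.assign 4 (.const 2 * .var 4))
        (.assign 5 (.var 5 + (.get 2 (.var 2) + .get 4 (.var 2)))))))
      (.assign 5 (.var 4 * (.var 3 * .var 5))))))

/-- Write the perturbed integer instance. -/
def perturbProgram : Program :=
  .seq (.assign 6 (.const 1)) (forLoop 2 (.var 0) (.seq
    (.store 8 (.var 2)
      (.var 5 * (.get 0 (.var 2) * (.var 3 / .get 1 (.var 2))) + .var 6)) (.seq
    (.store 9 (.var 2)
      (.var 5 * (.get 2 (.var 2) * (.var 3 / .get 3 (.var 2))) + .var 4)) (.seq
    (.store 10 (.var 2)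
      (.var 5 * (.get 4 (.var 2) * (.var 3 / .get 5 (.var 2))) + .const 1))
    (.assign 6 (.const 2 * .var 6))))))

/-- Find a power of two above the sixth power of the scaling factor. -/
def powerProgram : Program :=
  .seq (.assign 7 (.const 1)) (.whilePos
    (.var 5 * .var 5 * .var 5 * .var 5 * .var 5 * .var 5 - .var 7 + .const 1)
    (.assign 7 (.const 2 * .var 7)))

/-- The program for the multiplicative assignment problem with upgrades. -/
def assignmentProgram : Program :=
  .seq factorProgram (.seq perturbProgram (.seq powerProgram (.seq (.assign 8 (.const (-1)))
    (.seq (.assign 9 (.var 5 * .var 5 * .var 5 * .var 5)) searchAndOutput))))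

section Prepare

variable {n : ℕ} (Q : Problem ℚ (Fin n) (Fin n))

lemma toArray_fin (f : Fin n → ℤ) (i : Fin n) : toArray f ((i : ℕ) : ℤ) = f i := by
  simp [toArray]

lemma toArray_natAbs_le {f : Fin n → ℤ} {Z : ℕ} (h : ∀ i, (f i).natAbs ≤ Z) (z : ℤ) :
    (toArray f z).natAbs ≤ Z := by
  unfold toArray
  split_ifs
  exacts [h _, by simp]

lemma Problem.size_le_factor : n + 2 ≤ Q.factor := by
  have h1 := Q.denProd_pos
  have h2 : 0 < 2 ^ n := by positivity
  calc n + 2 ≤ n + 2 + ∑ i, ((Q.c i).num.toNat + (Q.d i).num.toNat) := by omega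
    _ ≤ Q.denProd * _ := Nat.le_mul_of_pos_left _ h1
    _ ≤ Q.factor := Nat.le_mul_of_pos_left _ h2

lemma Problem.numSum_le_factor :
    n + 2 + ∑ i, ((Q.c i).num.toNat + (Q.d i).num.toNat) ≤ Q.factor := by
  calc _ ≤ Q.denProd * _ := Nat.le_mul_of_pos_left _ Q.denProd_pos
    _ ≤ Q.factor := Nat.le_mul_of_pos_left _ (by positivity)

lemma Problem.two_pow_le_factor : 2 ^ n ≤ Q.factor :=
  Nat.le_mul_of_pos_right _ (Nat.mul_pos Q.denProd_pos (by omega))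

lemma Problem.denProd_le_factor : Q.denProd ≤ Q.factor :=
  (Nat.le_mul_of_pos_right _ (by omega)).trans (Nat.le_mul_of_pos_left _ (by positivity))

lemma Problem.scaled_add_one_le (i : Fin n) :
    Q.scaled.c i + 1 ≤ Q.factor ∧ Q.scaled.d i + 1 ≤ Q.factor := by
  have h := Q.le_factor
  have hc := Finset.single_le_sum (f := Q.scaled.c)
    (fun i _ => (Q.scaled.b_nonneg i).trans (Q.scaled.b_le_c i)) (Finset.mem_univ i)
  have hd := Finset.single_le_sum (f := Q.scaled.d)
    (fun i _ => Q.scaled.d_nonneg i) (Finset.mem_univ i)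
  have hc0 : 0 ≤ Q.scaled.c i := (Q.scaled.b_nonneg i).trans (Q.scaled.b_le_c i)
  have hd0 := Q.scaled.d_nonneg i
  have h2 : ∑ i, Q.scaled.c i + ∑ j, Q.scaled.d j + n + 1 ≤ (Q.factor : ℤ) :=
    le_trans (le_mul_of_one_le_left (by linarith) (one_le_pow₀ (by norm_num))) h
  constructor <;> linarith

lemma Problem.generic_c_le (i : Fin n) : Q.generic.c i ≤ (Q.factor : ℤ) ^ 2 := by
  have h1 := (Q.scaled_add_one_le i).1
  have h2 : (2 : ℤ) ^ n ≤ Q.factor := by exact_mod_cast Q.two_pow_le_factor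
  change (Q.factor : ℤ) * Q.scaled.c i + 2 ^ n ≤ _
  nlinarith

lemma Problem.generic_d_le (i : Fin n) : Q.generic.d i ≤ (Q.factor : ℤ) ^ 2 := by
  have h1 := (Q.scaled_add_one_le i).2
  have h2 : ((n : ℤ) + 2) ≤ Q.factor := by exact_mod_cast Q.size_le_factor
  change (Q.factor : ℤ) * Q.scaled.d i + 1 ≤ _
  nlinarith

lemma Problem.generic_cost_le (i j : Fin n) :
    Q.generic.c i * Q.generic.d j ≤ (Q.factor ^ 4 : ℕ) := by
  have := mul_le_mul (Q.generic_c_le i) (Q.generic_d_le j) (Q.generic.d_nonneg j) (by positivity)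
  push_cast
  linarith

/-- A bound for the numbers that occur in the computation. -/
def Problem.maxNumber : ℕ := Q.factor ^ 10

lemma Problem.pow_le_maxNumber {m : ℕ} (hm : m ≤ 10) : Q.factor ^ m ≤ Q.maxNumber :=
  Nat.pow_le_pow_right (by have := Q.size_le_factor; omega) hm

lemma Problem.factor_le_maxNumber : Q.factor ≤ Q.maxNumber := by
  simpa using Q.pow_le_maxNumber (m := 1) (by norm_num)

/-- With N = `factor`, the entries of the cost matrix are at most 2 (n + 1) N ^ 4 ≤ N ^ 6 < 2 ^ T.
Prices stay below (4 n + 4) 2 ^ T ≤ 8 N ^ 7 ≤ N ^ 10. This explains the exponents 6 and 10. -/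
lemma Problem.fits {T : ℕ} (h : Q.factor ^ 6 < 2 ^ T) (h' : 2 ^ T ≤ 2 * Q.factor ^ 6) :
    Fits Q.generic T Q.maxNumber := by
  have hn := Q.size_le_factor
  obtain ⟨N, hN⟩ : ∃ N, N = Q.factor := ⟨_, rfl⟩
  rw [← hN] at h h' hn
  have hN4 : N ^ 2 ≤ N ^ 4 := Nat.pow_le_pow_right (by omega) (by norm_num)
  refine ⟨?_, fun i j => ?_, ?_, ?_⟩
  · rcases T with _ | T
    · have : 1 ≤ N ^ 6 := Nat.one_le_pow _ _ (by omega)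
      simp only [pow_zero] at h
      omega
    · omega
  · have h1 := Q.generic_cost_le i j
    rw [← hN] at h1
    have h2 : (2 * (n + 1)) * N ^ 4 ≤ N ^ 6 := by
      calc (2 * (n + 1)) * N ^ 4 ≤ (N * N) * N ^ 4 :=
            Nat.mul_le_mul_right _ (Nat.mul_le_mul (by omega) (by omega))
        _ = N ^ 6 := by ring
    calc ((n : ℤ) + 1) * (2 * (Q.generic.c i * Q.generic.d j))
        ≤ ((n : ℤ) + 1) * (2 * (N ^ 4 : ℕ)) := by gcongr
      _ = ((2 * (n + 1)) * N ^ 4 : ℕ) := by push_cast; ring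
      _ < 2 ^ T := by exact_mod_cast h2.trans_lt h
  · rw [Problem.maxNumber, ← hN]
    calc (4 * n + 4) * 2 ^ T ≤ (4 * N) * (2 * N ^ 6) := Nat.mul_le_mul (by omega) h'
      _ = 2 ^ 3 * (N * N ^ 6) := by ring
      _ ≤ N ^ 3 * (N * N ^ 6) := Nat.mul_le_mul_right _ (Nat.pow_le_pow_left (by omega) 3)
      _ = N ^ 10 := by ring
  · refine (Nat.mul_le_mul (by omega : n ≤ N) (by omega : n ≤ N)).trans ?_
    have := Q.pow_le_maxNumber (m := 2) (by norm_num)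
    rwa [← hN, sq] at this

lemma Problem.num_natAbs_le (i : Fin n) : (Q.b i).num.natAbs ≤ Q.factor ∧
    (Q.c i).num.natAbs ≤ Q.factor ∧ (Q.d i).num.natAbs ≤ Q.factor := by
  have hc0 := (Q.b_nonneg i).trans (Q.b_le_c i)
  have h1 := le_scaleRat (Q.b_nonneg i) (Q.den_dvd i).1 Q.denProd_pos
  have h2 := le_scaleRat hc0 (Q.den_dvd i).2.1 Q.denProd_pos
  have h3 := le_scaleRat (Q.d_nonneg i) (Q.den_dvd i).2.2 Q.denProd_pos
  have h4 := Q.scaled_add_one_le i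
  have h5 := Q.scaled.b_le_c i
  simp only [Problem.scaled] at h4 h5
  have p1 := Rat.num_nonneg.2 (Q.b_nonneg i)
  have p2 := Rat.num_nonneg.2 hc0
  have p3 := Rat.num_nonneg.2 (Q.d_nonneg i)
  omega

lemma Problem.den_le (i : Fin n) : (Q.b i).den ≤ Q.factor ∧ (Q.c i).den ≤ Q.factor ∧
    (Q.d i).den ≤ Q.factor := by
  have h := Q.den_dvd i
  have hp := Q.denProd_pos
  have hle := Q.denProd_le_factor
  exact ⟨(Nat.le_of_dvd hp h.1).trans hle, (Nat.le_of_dvd hp h.2.1).trans hle,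
    (Nat.le_of_dvd hp h.2.2).trans hle⟩

lemma Problem.inputMemory_bounded : Q.inputMemory.Bounded Q.maxNumber := by
  have hle := Q.factor_le_maxNumber
  have hn := Q.size_le_factor
  have hk : Q.k ≤ n := by simpa using Q.k_le
  refine ⟨fun v => ?_, fun a z => ?_⟩
  · match v with
    | 0 => simp only [Problem.inputMemory]; omega
    | 1 => simp only [Problem.inputMemory]; omega
    | v + 2 => simp [Problem.inputMemory]
  · refine le_trans ?_ hle
    match a with
    | 0 => exact toArray_natAbs_le (fun i => (Q.num_natAbs_le i).1) z
    | 1 => exact toArray_natAbs_le (f := fun i => ((Q.b i).den : ℤ)) (fun i => (Q.den_le i).1) z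
    | 2 => exact toArray_natAbs_le (fun i => (Q.num_natAbs_le i).2.1) z
    | 3 => exact toArray_natAbs_le (f := fun i => ((Q.c i).den : ℤ)) (fun i => (Q.den_le i).2.1) z
    | 4 => exact toArray_natAbs_le (fun i => (Q.num_natAbs_le i).2.2) z
    | 5 => exact toArray_natAbs_le (f := fun i => ((Q.d i).den : ℤ)) (fun i => (Q.den_le i).2.2) z
    | a + 6 => simp [Problem.inputMemory]

/-- The input arrays and the size. -/
structure HasInput (s : Memory) : Prop where
  size : s.var 0 = n
  b_num : ∀ i : Fin n, s.arr 0 (i : ℕ) = (Q.b i).num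
  b_den : ∀ i : Fin n, s.arr 1 (i : ℕ) = (Q.b i).den
  c_num : ∀ i : Fin n, s.arr 2 (i : ℕ) = (Q.c i).num
  c_den : ∀ i : Fin n, s.arr 3 (i : ℕ) = (Q.c i).den
  d_num : ∀ i : Fin n, s.arr 4 (i : ℕ) = (Q.d i).num
  d_den : ∀ i : Fin n, s.arr 5 (i : ℕ) = (Q.d i).den

lemma Problem.hasInput_inputMemory : HasInput Q Q.inputMemory :=
  ⟨rfl, fun i => toArray_fin (fun i => (Q.b i).num) i,
    fun i => toArray_fin (fun i => ((Q.b i).den : ℤ)) i,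
    fun i => toArray_fin (fun i => (Q.c i).num) i,
    fun i => toArray_fin (fun i => ((Q.c i).den : ℤ)) i,
    fun i => toArray_fin (fun i => (Q.d i).num) i,
    fun i => toArray_fin (fun i => ((Q.d i).den : ℤ)) i⟩

variable {Q} {s : Memory}

lemma HasInput.congr (h : HasInput Q s) {s' : Memory} (h0 : s'.var 0 = s.var 0)
    (ha : ∀ a < 6, s'.arr a = s.arr a) : HasInput Q s' :=
  ⟨h0.trans h.size, by simpa [ha 0] using h.b_num, by simpa [ha 1] using h.b_den,
    by simpa [ha 2] using h.c_num, by simpa [ha 3] using h.c_den, by simpa [ha 4] using h.d_num,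
    by simpa [ha 5] using h.d_den⟩

lemma HasInput.frame (h : HasInput Q s) {p : Program} {s' : Memory} (hf : Frame p s s')
    (h0 : 0 ∉ p.vars) (ha : ∀ a < 6, a ∉ p.arrs) : HasInput Q s' :=
  h.congr (hf.1 0 h0) fun a h => hf.2 a (ha a h)

lemma factorProgram_ends (hs : s.Bounded Q.maxNumber) (h : HasInput Q s) :
    Ends Q.maxNumber factorProgram s (n * 5 + 6) fun s' =>
      s'.var 3 = Q.denProd ∧ s'.var 4 = 2 ^ n ∧ s'.var 5 = Q.factor := by
  have hle := Q.factor_le_maxNumber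
  have hn := Q.size_le_factor
  have hsum := Q.numSum_le_factor
  have hpow := Q.two_pow_le_factor
  have hden := Q.denProd_le_factor
  -- Extensions to all natural numbers, so that the loop invariant can speak of partial products and
  -- sums over ranges.
  obtain ⟨g, hg⟩ : ∃ g : ℕ → ℕ, ∀ i : Fin n,
      g i = (Q.b i).den * ((Q.c i).den * (Q.d i).den) :=
    ⟨fun t => if ht : t < n then (Q.b ⟨t, ht⟩).den * ((Q.c ⟨t, ht⟩).den * (Q.d ⟨t, ht⟩).den) else 1,
      fun i => by simp⟩
  obtain ⟨f, hf⟩ : ∃ f : ℕ → ℕ, ∀ i : Fin n, f i = (Q.c i).num.toNat + (Q.d i).num.toNat :=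
    ⟨fun t => if ht : t < n then (Q.c ⟨t, ht⟩).num.toNat + (Q.d ⟨t, ht⟩).num.toNat else 0,
      fun i => by simp⟩
  have hgn : ∏ t ∈ Finset.range n, g t = Q.denProd := by
    rw [Finset.prod_range]; exact Finset.prod_congr rfl fun i _ => hg i
  have hfn : ∑ t ∈ Finset.range n, f t = ∑ i, ((Q.c i).num.toNat + (Q.d i).num.toNat) := by
    rw [Finset.sum_range]; exact Finset.sum_congr rfl fun i _ => hf i
  have hgle : ∀ t ≤ n, ∏ t ∈ Finset.range t, g t ≤ Q.denProd := fun t ht =>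
    Nat.le_of_dvd Q.denProd_pos
      (hgn ▸ Finset.prod_dvd_prod_of_subset _ _ _ (Finset.range_subset_range.2 ht))
  have hfle : ∀ t ≤ n, ∑ t ∈ Finset.range t, f t
      ≤ ∑ i, ((Q.c i).num.toNat + (Q.d i).num.toNat) := fun t ht =>
    hfn ▸ Finset.sum_le_sum_of_subset (Finset.range_subset_range.2 ht)
  have hpowle : ∀ t ≤ n, 2 ^ t ≤ 2 ^ n := fun t ht => Nat.pow_le_pow_right (by norm_num) ht
  have total : Ends Q.maxNumber factorProgram s (1 + (1 + (1 + ((n * (3 + 2) + 2) + 1)))) fun s' =>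
      s'.var 3 = Q.denProd ∧ s'.var 4 = 2 ^ n ∧ s'.var 5 = Q.factor := by
    refine Ends.assign_seq hs (by decide) (by simp; omega) fun hs₁ => ?_
    refine Ends.assign_seq hs₁ (by decide) (by simp; omega) fun hs₂ => ?_
    refine Ends.assign_seq hs₂ (by decide) (by simp [h.size]; omega) fun hs₃ => ?_
    simp only [Expr.eval_const, Expr.eval_add, Expr.eval_var] at hs₃ ⊢
    set s₃ := (((s.setVar 3 1).setVar 4 1).setVar 5
      (((s.setVar 3 1).setVar 4 1).var 0 + 2)) with hs₃e
    have hI₃ : HasInput Q s₃ := h.congr (by simp [hs₃e]) fun a _ => by simp [hs₃e]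
    refine Ends.seq (R₁ := fun s' => s'.var 3 = Q.denProd ∧ s'.var 4 = 2 ^ n ∧
      s'.var 5 = (n + 2 + ∑ i, ((Q.c i).num.toNat + (Q.d i).num.toNat) : ℕ)) ?_ ?_
    · refine (Ends.forLoop (m := 3) (N := n) (fun t s' =>
        s'.var 3 = (∏ t ∈ Finset.range t, g t : ℕ) ∧ s'.var 4 = (2 ^ t : ℕ) ∧
        s'.var 5 = (n + 2 + ∑ t ∈ Finset.range t, f t : ℕ)) (by decide) hs₃ (by omega) (by decide)
        (fun s' hf' => ?_) ?_ ?_).mono le_rfl ?_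
      · simpa using (hI₃.frame hf' (by decide) (by decide)).size
      · simp [hs₃e, h.size]
      · rintro t ht s' hs' hf' hv ⟨i3, i4, i5⟩
        have hI := hI₃.frame hf' (by decide) (by decide)
        set i : Fin n := ⟨t, ht⟩ with hi
        have hv' : s'.var 2 = ((i : ℕ) : ℤ) := hv
        have e3 : s'.var 3 * (s'.arr 1 (s'.var 2) * (s'.arr 3 (s'.var 2) * s'.arr 5 (s'.var 2)))
            = (∏ t ∈ Finset.range (t + 1), g t : ℕ) := by
          rw [hv', hI.b_den, hI.c_den, hI.d_den, i3, Finset.prod_range_succ, hg i]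
          push_cast; ring
        have e4 : 2 * s'.var 4 = (2 ^ (t + 1) : ℕ) := by rw [i4]; push_cast; ring
        have e5 : s'.var 5 + (s'.arr 2 (s'.var 2) + s'.arr 4 (s'.var 2))
            = (n + 2 + ∑ t ∈ Finset.range (t + 1), f t : ℕ) := by
          have p2 := Rat.num_nonneg.2 ((Q.b_nonneg i).trans (Q.b_le_c i))
          have p3 := Rat.num_nonneg.2 (Q.d_nonneg i)
          rw [hv', hI.c_num, hI.d_num, i5, Finset.sum_range_succ, hf i]
          push_cast
          rw [Int.toNat_of_nonneg p2, Int.toNat_of_nonneg p3]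
          ring
        have b3 := hgle (t + 1) ht
        have b4 := hpowle (t + 1) ht
        have b5 := hfle (t + 1) ht
        refine (Ends.assign_seq (m := 2) hs' (by decide) ?_ fun k₁ =>
          Ends.assign_seq (m := 1) k₁ (by decide) ?_ fun k₂ => Ends.assign k₂ (by decide) ?_ ?_)
        · simp only [Expr.eval_mul, Expr.eval_var, Expr.eval_get, e3]; omega
        · simp only [Expr.eval_mul, Expr.eval_var, Expr.eval_const, Memory.setVar_var]
          norm_num only [if_false]
          rw [e4, Int.natAbs_natCast]; omega
        · simp only [Expr.eval_mul, Expr.eval_add, Expr.eval_get, Expr.eval_var, Expr.eval_const,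
            Memory.setVar_var, Memory.setVar_arr]
          norm_num only [if_false]
          rw [e5]; omega
        · simp only [Expr.eval_mul, Expr.eval_add, Expr.eval_get, Expr.eval_var, Expr.eval_const,
            Memory.setVar_var, Memory.setVar_arr]
          norm_num only [if_false, if_true]
          exact ⟨e3, e4, e5⟩
      · rintro s' - - ⟨i3, i4, i5⟩
        exact ⟨by rw [i3, hgn], by rw [i4]; push_cast; rfl, by rw [i5, hfn]⟩
    · rintro s' hs' - ⟨i3, i4, i5⟩
      have e : s'.var 4 * (s'.var 3 * s'.var 5) = Q.factor := by
        rw [i3, i4, i5, Problem.factor]; push_cast; ring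
      refine Ends.assign hs' (by decide) ?_ ?_
      · simp only [Expr.eval_mul, Expr.eval_var, e]; omega
      · simp only [Expr.eval_mul, Expr.eval_var, e, Memory.setVar_var]
        norm_num only [if_false, if_true]
        exact ⟨i3, i4, trivial⟩
  exact total.mono (by omega) fun _ _ _ h => h

lemma perturbProgram_ends (hs : s.Bounded Q.maxNumber) (h : HasInput Q s)
    (h3 : s.var 3 = Q.denProd) (h4 : s.var 4 = 2 ^ n) (h5 : s.var 5 = Q.factor) :
    Ends Q.maxNumber perturbProgram s (n * 6 + 3) fun s' =>
      (∀ i : Fin n, s'.arr 8 (i : ℕ) = Q.generic.b i) ∧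
      (∀ i : Fin n, s'.arr 9 (i : ℕ) = Q.generic.c i) ∧
      ∀ i : Fin n, s'.arr 10 (i : ℕ) = Q.generic.d i := by
  have hle := Q.factor_le_maxNumber
  have hn := Q.size_le_factor
  have hsq : (Q.factor : ℤ) ^ 2 ≤ Q.maxNumber := by
    exact_mod_cast Q.pow_le_maxNumber (m := 2) (by norm_num)
  have hpow := Q.two_pow_le_factor
  have total : Ends Q.maxNumber perturbProgram s (1 + (n * (4 + 2) + 2)) fun s' =>
      (2 ^ n : ℕ) = s'.var 6 ∧
      ∀ i : Fin n, (i : ℕ) < n → s'.arr 8 (i : ℕ) = Q.generic.b i ∧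
      s'.arr 9 (i : ℕ) = Q.generic.c i ∧ s'.arr 10 (i : ℕ) = Q.generic.d i := by
    refine Ends.assign_seq hs (by decide) (by simp; omega) fun hs₁ => ?_
    simp only [Expr.eval_const] at hs₁ ⊢
    have hI₁ : HasInput Q (s.setVar 6 1) := h.congr (by simp) fun a _ => by simp
    refine Ends.forLoop (m := 4) (N := n) (fun t s' => (2 ^ t : ℕ) = s'.var 6 ∧
      ∀ i : Fin n, (i : ℕ) < t → s'.arr 8 (i : ℕ) = Q.generic.b i ∧
      s'.arr 9 (i : ℕ) = Q.generic.c i ∧ s'.arr 10 (i : ℕ) = Q.generic.d i)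
      (by decide) hs₁ (by omega) (by decide) (fun s' hf' => ?_) ?_ ?_
    · simpa using (hI₁.frame hf' (by decide) (by decide)).size
    · simp
    · rintro t ht s' hs' hf' hv ⟨i6, ih⟩
      have hI := hI₁.frame hf' (by decide) (by decide)
      have w3 : s'.var 3 = Q.denProd := by rw [hf'.1 3 (by decide)]; simp [h3]
      have w4 : s'.var 4 = 2 ^ n := by rw [hf'.1 4 (by decide)]; simp [h4]
      have w5 : s'.var 5 = Q.factor := by rw [hf'.1 5 (by decide)]; simp [h5]
      set i : Fin n := ⟨t, ht⟩ with hi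
      have hv' : s'.var 2 = ((i : ℕ) : ℤ) := hv
      have eb : s'.var 5 * (s'.arr 0 (s'.var 2) * (s'.var 3 / s'.arr 1 (s'.var 2))) + s'.var 6
          = Q.generic.b i := by
        rw [hv', hI.b_den, hI.b_num, w3, w5, ← i6]; push_cast; rfl
      have ec : s'.var 5 * (s'.arr 2 (s'.var 2) * (s'.var 3 / s'.arr 3 (s'.var 2))) + s'.var 4
          = Q.generic.c i := by
        rw [hv', hI.c_den, hI.c_num, w3, w5, w4]; rfl
      have ed : s'.var 5 * (s'.arr 4 (s'.var 2) * (s'.var 3 / s'.arr 5 (s'.var 2))) + 1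
          = Q.generic.d i := by
        rw [hv', hI.d_den, hI.d_num, w3, w5]; rfl
      have b0 := Q.generic.b_nonneg i
      have b1 := Q.generic.b_le_c i
      have b2 := Q.generic_c_le i
      have b3 := Q.generic.d_nonneg i
      have b4 := Q.generic_d_le i
      have b6 : 2 ^ (t + 1) ≤ 2 ^ n := Nat.pow_le_pow_right (by norm_num) ht
      have e6 : 2 * s'.var 6 = (2 ^ (t + 1) : ℕ) := by rw [← i6]; push_cast; ring
      refine (Ends.store_seq (m := 3) hs' (by decide) ?_ fun k₁ =>
        Ends.store_seq (m := 2) k₁ (by decide) ?_ fun k₂ =>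
        Ends.store_seq (m := 1) k₂ (by decide) ?_ fun k₃ => Ends.assign k₃ (by decide) ?_ ?_)
      · simp only [Expr.eval_mul, Expr.eval_add, Expr.eval_div, Expr.eval_var, Expr.eval_get, eb]
        omega
      · simp only [Expr.eval_mul, Expr.eval_add, Expr.eval_div, Expr.eval_var, Expr.eval_get,
          Memory.setArr_var, Memory.setArr_arr]
        norm_num only [if_false, false_and]
        rw [ec]; omega
      · simp only [Expr.eval_mul, Expr.eval_add, Expr.eval_div, Expr.eval_var, Expr.eval_get,
          Memory.setArr_var, Memory.setArr_arr, Expr.eval_const]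
        norm_num only [if_false, false_and]
        rw [ed]; omega
      · simp only [Expr.eval_mul, Expr.eval_var, Expr.eval_const, Memory.setArr_var, e6, Int.natAbs_natCast]
        omega
      · simp only [Expr.eval_mul, Expr.eval_add, Expr.eval_div, Expr.eval_var, Expr.eval_get,
          Memory.setArr_var, Memory.setArr_arr, Expr.eval_const, Memory.setVar_var,
          Memory.setVar_arr]
        norm_num only [if_false, if_true, false_and, true_and]
        refine ⟨e6.symm, fun i' hi' => ?_⟩
        rcases Nat.lt_succ_iff_lt_or_eq.1 hi' with hlt | heq
        · have hne : ((i' : ℕ) : ℤ) ≠ s'.var 2 := by rw [hv]; omega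
          simp only [hne, if_false]
          exact ih i' hlt
        · obtain rfl : i' = i := Fin.ext heq
          simp only [hv', if_true]
          rw [hv'] at eb ec ed
          exact ⟨eb, ec, ed⟩
  exact total.mono (by omega) fun _ _ _ h =>
    ⟨fun i => (h.2 i i.2).1, fun i => (h.2 i i.2).2.1, fun i => (h.2 i i.2).2.2⟩

/-- The last doubling starts from a power of at most `factor ^ 6`, which gives the upper bound; the
failed test gives the lower one. -/
lemma powerProgram_ends (hs : s.Bounded Q.maxNumber) (h5 : s.var 5 = Q.factor) :
    Ends Q.maxNumber powerProgram s (Nat.size Q.maxNumber * 2 + 2) fun s' =>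
      ∃ T, s'.var 7 = 2 ^ T ∧ Q.factor ^ 6 < 2 ^ T ∧ 2 ^ T ≤ 2 * Q.factor ^ 6 := by
  have hle := Q.factor_le_maxNumber
  have hn := Q.size_le_factor
  have h1 : 1 ≤ Q.factor ^ 6 := Nat.one_le_pow _ _ (by omega)
  have hZ : 2 * Q.factor ^ 6 ≤ Q.maxNumber := by
    calc 2 * Q.factor ^ 6 ≤ Q.factor * Q.factor ^ 6 := Nat.mul_le_mul_right _ (by omega)
      _ = Q.factor ^ 7 := by ring
      _ ≤ _ := Q.pow_le_maxNumber (by norm_num)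
  have total : Ends Q.maxNumber powerProgram s (1 + (Nat.size Q.maxNumber * (1 + 1) + 1)) fun s' =>
      (∃ r T : ℕ, s'.var 7 = 2 ^ T ∧ 2 ^ T ≤ 2 * Q.factor ^ 6 ∧ Q.factor ^ 6 < 2 ^ T * 2 ^ r) ∧
      ¬ 0 < (Expr.var 5 * .var 5 * .var 5 * .var 5 * .var 5 * .var 5 - .var 7 + .const 1).eval s' := by
    refine Ends.assign_seq hs (by decide) (by simp; omega) fun hs₁ => ?_
    simp only [Expr.eval_const] at hs₁ ⊢
    refine (Ends.whilePos (m := 1) (r := Nat.size Q.maxNumber) (fun r s' => ∃ T : ℕ,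
      s'.var 7 = 2 ^ T ∧ 2 ^ T ≤ 2 * Q.factor ^ 6 ∧ Q.factor ^ 6 < 2 ^ T * 2 ^ r)
      (by decide) hs₁ ⟨0, by simp, by omega, ?_⟩ ?_)
    · rw [pow_zero, one_mul]
      exact (Q.pow_le_maxNumber (by norm_num)).trans_lt (Nat.lt_size_self _)
    · rintro r s' hs' hf' ⟨T, e7, hT, hr⟩ hpos
      have w5 : s'.var 5 = Q.factor := by rw [hf'.1 5 (by decide)]; simp [h5]
      have hlt : 2 ^ T ≤ Q.factor ^ 6 := by
        simp only [Expr.eval_mul, Expr.eval_add, Expr.eval_sub, Expr.eval_var, Expr.eval_const,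
          e7, w5] at hpos
        have : (2 : ℤ) ^ T ≤ (Q.factor : ℤ) ^ 6 := by linarith
        exact_mod_cast this
      obtain ⟨r, rfl⟩ : ∃ r', r = r' + 1 := by
        rcases r with _ | r
        · simp only [pow_zero] at hr; omega
        · exact ⟨r, rfl⟩
      have e7' : 2 * s'.var 7 = (2 ^ (T + 1) : ℕ) := by rw [e7]; push_cast; ring
      have hb : 2 ^ (T + 1) ≤ 2 * Q.factor ^ 6 := by rw [pow_succ]; omega
      refine Ends.assign hs' (by decide) ?_ ⟨r, by omega, T + 1, ?_, hb, ?_⟩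
      · simp only [Expr.eval_mul, Expr.eval_var, Expr.eval_const, e7', Int.natAbs_natCast]
        omega
      · simp only [Expr.eval_mul, Expr.eval_var, Expr.eval_const, e7', Memory.setVar_var, if_true]
        push_cast; rfl
      · calc _ < _ := hr
          _ = _ := by ring
  refine total.mono (by omega) ?_
  rintro s' - hf' ⟨⟨r, T, e7, hT, -⟩, hneg⟩
  have w5 : s'.var 5 = Q.factor := by rw [hf'.1 5 (by decide), h5]
  refine ⟨T, e7, ?_, hT⟩
  simp only [Expr.eval_mul, Expr.eval_add, Expr.eval_sub, Expr.eval_var, Expr.eval_const,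
    e7, w5] at hneg
  have : (Q.factor : ℤ) ^ 6 < (2 : ℤ) ^ T := by
    have e : (Q.factor : ℤ) ^ 6 =
      Q.factor * Q.factor * Q.factor * Q.factor * Q.factor * Q.factor := by ring
    rw [e]; linarith
  exact_mod_cast this

end Prepare

end Upgrade

namespace Upgrade

/-! ### Correctness of the whole program -/

section Correctness

variable {n : ℕ} (Q : Problem ℚ (Fin n) (Fin n))

/-- A bound for the number of steps of the program. -/
def assignmentSteps (n z : ℕ) : ℕ :=
  (n * 5 + 6) + ((n * 6 + 3) + ((z * 2 + 2) + (1 + (1 + searchAndOutputSteps n z z))))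

lemma searchAndOutputSteps_mono {m n r r' T T' : ℕ} (h : m ≤ n) (h₁ : r ≤ r') (h₂ : T ≤ T') :
    searchAndOutputSteps m r T ≤ searchAndOutputSteps n r' T' := by
  unfold searchAndOutputSteps searchBodySteps solveSteps phaseSteps bidSteps
  gcongr

lemma assignmentSteps_mono {m n z z' : ℕ} (h : m ≤ n) (h' : z ≤ z') :
    assignmentSteps m z ≤ assignmentSteps n z' := by
  have := searchAndOutputSteps_mono h h' h'
  unfold assignmentSteps
  omega

/-- The program computes an integral optimal vertex. -/
theorem assignmentProgram_ends :
    Ends Q.maxNumber assignmentProgram Q.inputMemory (assignmentSteps n (Nat.size Q.maxNumber))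
      fun s => Q.toReal.IsOptimalVertex (outputPoint n s) ∧ IsIntegral (outputPoint n s) := by
  have hs := Q.inputMemory_bounded
  have h0 := Q.hasInput_inputMemory
  have hkn : Q.k ≤ n := by simpa using Q.k_le
  refine Ends.seq (factorProgram_ends hs h0) ?_
  rintro s₁ hs₁ hf₁ ⟨e3, e4, e5⟩
  have h1 := h0.frame hf₁ (by decide) (by decide)
  refine Ends.seq (perturbProgram_ends hs₁ h1 e3 e4 e5) ?_
  rintro s₂ hs₂ hf₂ ⟨ab, ac, ad⟩
  have h2 := h1.frame hf₂ (by decide) (by decide)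
  have f5 : s₂.var 5 = Q.factor := (hf₂.1 5 (by decide)).trans e5
  refine Ends.seq (powerProgram_ends hs₂ f5) ?_
  rintro s₃ hs₃ hf₃ ⟨T, e7, hT, hT'⟩
  have h3 := h2.frame hf₃ (by decide) (by decide)
  have g5 : s₃.var 5 = Q.factor := (hf₃.1 5 (by decide)).trans f5
  have hle := Q.factor_le_maxNumber
  have hn := Q.size_le_factor
  have hfit := Q.fits hT hT'
  have h4 := Q.pow_le_maxNumber (m := 4) (by norm_num)
  have hTz : T ≤ Nat.size Q.maxNumber := by
    have : 1 * 2 ^ T ≤ (4 * n + 4) * 2 ^ T := Nat.mul_le_mul_right _ (by omega)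
    exact (Nat.lt_size.2 (by linarith [hfit.price_le])).le
  refine Ends.assign_seq hs₃ (by decide) (by simp; omega) fun hs₄ => ?_
  have e9 : (Expr.var 5 * .var 5 * .var 5 * .var 5).eval
      (s₃.setVar 8 ((Expr.const (-1)).eval s₃)) = (Q.factor ^ 4 : ℕ) := by
    simp [g5]; ring
  refine Ends.assign_seq hs₄ (by decide) (by rw [e9, Int.natAbs_natCast]; exact h4) fun hs₅ => ?_
  rw [e9] at hs₅ ⊢
  -- The preparation leaves the number of upgrades and the two output arrays as they were in the
  -- input.
  have hv : ∀ v, v ∉ ([3, 4, 5, 2, 6, 7] : List ℕ) → s₃.var v = Q.inputMemory.var v := by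
    intro v hv
    simp only [List.mem_cons, List.not_mem_nil, or_false, not_or] at hv
    rw [hf₃.1 v (by simp [powerProgram, Program.vars, hv]),
      hf₂.1 v (by simp [perturbProgram, forLoop, Program.vars, hv]),
      hf₁.1 v (by simp [factorProgram, forLoop, Program.vars, hv])]
  have ha : ∀ a, a ∉ ([8, 9, 10] : List ℕ) → s₃.arr a = Q.inputMemory.arr a := by
    intro a ha
    simp only [List.mem_cons, List.not_mem_nil, or_false, not_or] at ha
    rw [hf₃.2 a (by simp [powerProgram, Program.arrs]),
      hf₂.2 a (by simp [perturbProgram, forLoop, Program.arrs, ha]),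
      hf₁.2 a (by simp [factorProgram, forLoop, Program.arrs])]
  have a8 : s₃.arr 8 = s₂.arr 8 := hf₃.2 8 (by decide)
  have a9 : s₃.arr 9 = s₂.arr 9 := hf₃.2 9 (by decide)
  have a10 : s₃.arr 10 = s₂.arr 10 := hf₃.2 10 (by decide)
  have hR : Ready Q.generic T ((s₃.setVar 8 ((Expr.const (-1)).eval s₃)).setVar 9
      ((Q.factor ^ 4 : ℕ) : ℤ)) :=
    ⟨by simp [h3.size], by simpa [a8] using ab, by simpa [a9] using ac, by simpa [a10] using ad,
      by simp [e7]⟩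
  refine (searchAndOutput_ends (r := Nat.size Q.maxNumber) hs₅ hR hfit
    (fun M M' h => Q.generic_injective h) hkn (H := Q.factor ^ 4) ?_ (by simp) (by simp)
    (h4.trans_lt (Nat.lt_size_self _)) Q.generic_cost_le ?_ ?_).mono
    (searchAndOutputSteps_mono le_rfl le_rfl hTz) ?_
  · simp [hv 1 (by decide), Problem.inputMemory]
  · intro z; simp [ha 6 (by decide), Problem.inputMemory]
  · intro z; simp [ha 7 (by decide), Problem.inputMemory]
  · rintro s₆ - - ⟨M, ho, hc, x, hM⟩
    rw [ho]
    exact ⟨Q.isOptimalVertex_of_generic hc hM, isIntegral_matchingPoint M⟩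

end Correctness

/-! ### The running time -/

section Time

variable {n : ℕ} (Q : Problem ℚ (Fin n) (Fin n))

lemma one_le_bitLength_den (q : ℚ) : 1 ≤ bitLength q.den :=
  Nat.size_pos.2 (by simpa using q.den_pos)

lemma Problem.size_le_inputLength : n ≤ Q.inputLength := by
  have : ∑ _i : Fin n, 1 ≤ ∑ i, (ratLength (Q.b i) + ratLength (Q.c i) + ratLength (Q.d i)) :=
    Finset.sum_le_sum fun i _ => by
      have := one_le_bitLength_den (Q.b i)
      unfold ratLength
      omega
  simp only [Finset.sum_const, Finset.card_univ, Fintype.card_fin, smul_eq_mul, mul_one] at this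
  unfold Problem.inputLength
  omega

lemma Problem.ratLength_le_inputLength (i : Fin n) :
    ratLength (Q.b i) + ratLength (Q.c i) + ratLength (Q.d i) ≤ Q.inputLength :=
  (Finset.single_le_sum (f := fun i => ratLength (Q.b i) + ratLength (Q.c i) + ratLength (Q.d i))
    (fun _ _ => Nat.zero_le _) (Finset.mem_univ i)).trans (Nat.le_add_left _ _)

lemma Problem.denProd_le_two_pow : Q.denProd ≤ 2 ^ Q.inputLength := by
  have hden : ∀ q : ℚ, q.den ≤ 2 ^ bitLength q.den := fun q => by
    simpa using (natAbs_lt_two_pow_bitLength (q.den : ℤ)).le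
  calc Q.denProd ≤ ∏ i, 2 ^ (ratLength (Q.b i) + ratLength (Q.c i) + ratLength (Q.d i)) := by
        refine Finset.prod_le_prod' fun i _ => ?_
        calc _ ≤ 2 ^ bitLength (Q.b i).den * (2 ^ bitLength (Q.c i).den * 2 ^ bitLength (Q.d i).den) :=
              Nat.mul_le_mul (hden _) (Nat.mul_le_mul (hden _) (hden _))
          _ = 2 ^ (bitLength (Q.b i).den + (bitLength (Q.c i).den + bitLength (Q.d i).den)) := by
              rw [pow_add, pow_add]
          _ ≤ _ := Nat.pow_le_pow_right (by norm_num) (by unfold ratLength; omega)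
    _ = 2 ^ ∑ i, (ratLength (Q.b i) + ratLength (Q.c i) + ratLength (Q.d i)) :=
        Finset.prod_pow_eq_pow_sum _ _ _
    _ ≤ _ := Nat.pow_le_pow_right (by norm_num) (Nat.le_add_left _ _)

/-- With L the input length, `2 ^ n` and `denProd` contribute at most 2 ^ L each, the latter since
bit lengths add up under products, and the sum of numerators at most 4 · 2 ^ (2 L). -/
lemma Problem.factor_le_two_pow : Q.factor ≤ 2 ^ (4 * Q.inputLength + 2) := by
  have hn := Q.size_le_inputLength
  set L := Q.inputLength with hL
  have hnum : ∀ i, (Q.c i).num.toNat + (Q.d i).num.toNat ≤ 2 * 2 ^ L := by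
    intro i
    have h := Q.ratLength_le_inputLength i
    have hle : ∀ q : ℚ, ratLength q ≤ L → q.num.toNat ≤ 2 ^ L := fun q hq => by
      have h1 := natAbs_lt_two_pow_bitLength q.num
      have h2 : 2 ^ bitLength q.num ≤ 2 ^ L :=
        Nat.pow_le_pow_right (by norm_num) (by unfold ratLength at hq; omega)
      omega
    have h1 := hle (Q.c i) (by omega)
    have h2 := hle (Q.d i) (by omega)
    omega
  have hsum : ∑ i, ((Q.c i).num.toNat + (Q.d i).num.toNat) ≤ n * (2 * 2 ^ L) := by
    simpa using Finset.sum_le_card_nsmul Finset.univ _ _ fun i _ => hnum i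
  have hnL : n + 1 ≤ 2 ^ L := (Nat.lt_two_pow_self).trans_le (Nat.pow_le_pow_right (by norm_num) hn)
  have hB : n + 2 + ∑ i, ((Q.c i).num.toNat + (Q.d i).num.toNat) ≤ 4 * (2 ^ L * 2 ^ L) := by
    nlinarith [Nat.one_le_two_pow (n := L)]
  calc Q.factor ≤ 2 ^ L * (2 ^ L * (4 * (2 ^ L * 2 ^ L))) :=
        Nat.mul_le_mul (Nat.pow_le_pow_right (by norm_num) hn)
          (Nat.mul_le_mul Q.denProd_le_two_pow hB)
    _ = 2 ^ (4 * L + 2) := by ring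

lemma Problem.size_maxNumber_le : Nat.size Q.maxNumber ≤ 40 * Q.inputLength + 21 := by
  refine Nat.size_le.2 ((Nat.pow_le_pow_left Q.factor_le_two_pow 10).trans_lt ?_)
  rw [← pow_mul]
  exact Nat.pow_lt_pow_right (by norm_num) (by omega)

/-- The function agrees with a polynomial. -/
def IsPoly (f : ℕ → ℕ) : Prop := ∃ p : Polynomial ℕ, ∀ x, p.eval x = f x

lemma IsPoly.const (a : ℕ) : IsPoly fun _ => a := ⟨.C a, by simp⟩

lemma IsPoly.id : IsPoly fun x => x := ⟨.X, by simp⟩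

lemma IsPoly.add {f g : ℕ → ℕ} (hf : IsPoly f) (hg : IsPoly g) : IsPoly fun x => f x + g x := by
  obtain ⟨p, hp⟩ := hf
  obtain ⟨q, hq⟩ := hg
  exact ⟨p + q, fun x => by rw [Polynomial.eval_add, hp, hq]⟩

lemma IsPoly.mul {f g : ℕ → ℕ} (hf : IsPoly f) (hg : IsPoly g) : IsPoly fun x => f x * g x := by
  obtain ⟨p, hp⟩ := hf
  obtain ⟨q, hq⟩ := hg
  exact ⟨p * q, fun x => by rw [Polynomial.eval_mul, hp, hq]⟩

/-- Steps times `stepTime`, with n replaced by the input length x and the bit length of `maxNumber`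
by its linear bound 40 x + 21. -/
lemma isPoly_assignmentSteps :
    IsPoly fun x => assignmentSteps x (40 * x + 21) * (1000 * (40 * x + 21 + 1)) := by
  unfold assignmentSteps searchAndOutputSteps searchBodySteps solveSteps phaseSteps bidSteps
  repeat' first
    | with_reducible exact IsPoly.const _
    | with_reducible exact IsPoly.id
    | with_reducible refine IsPoly.add ?_ ?_
    | with_reducible refine IsPoly.mul ?_ ?_

/-- An integral optimal vertex can be computed in polynomial time. -/
theorem exists_program_integral_optimalVertex :
    ∃ (prog : Program) (bound : Polynomial ℕ), ∀ (n : ℕ) (Q : Problem ℚ (Fin n) (Fin n)),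
      ∃ (t : ℕ) (s : Memory), Runs prog Q.inputMemory t s ∧ t ≤ bound.eval Q.inputLength ∧
        Q.toReal.IsOptimalVertex (outputPoint n s) ∧ IsIntegral (outputPoint n s) := by
  obtain ⟨p, hp⟩ := isPoly_assignmentSteps
  refine ⟨assignmentProgram, p, fun n Q => ?_⟩
  obtain ⟨t, s, h1, h2, -, h3⟩ := assignmentProgram_ends Q
  refine ⟨t, s, h1, h2.trans ?_, h3⟩
  rw [hp, stepTime]
  have hz := Q.size_maxNumber_le
  exact Nat.mul_le_mul (assignmentSteps_mono Q.size_le_inputLength hz)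
    (Nat.mul_le_mul_left _ (by omega))

end Time

end Upgrade

theorem theorem1 :
    -- every instance has an optimal vertex that is integral
    (∀ (I J : Type*) [Fintype I] [Fintype J] (Q : Upgrade.Problem ℝ I J),
      ∃ z, Q.IsOptimalVertex z ∧ Upgrade.IsIntegral z) ∧
    -- some instance also has an optimal vertex that is not integral
    (∃ (n : ℕ) (Q : Upgrade.Problem ℝ (Fin n) (Fin n)) (z : Upgrade.Point (Fin n) (Fin n)),
      Q.IsOptimalVertex z ∧ ¬ Upgrade.IsIntegral z) ∧
    -- one program computes an integral optimal vertex of every rational instance, in time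
    -- polynomial in the bit length of the instance
    (∃ (prog : Upgrade.Program) (bound : Polynomial ℕ),
      ∀ (n : ℕ) (Q : Upgrade.Problem ℚ (Fin n) (Fin n)),
        ∃ (t : ℕ) (s : Upgrade.Memory),
          Upgrade.Runs prog Q.inputMemory t s ∧
          t ≤ bound.eval Q.inputLength ∧
          Q.toReal.IsOptimalVertex (Upgrade.outputPoint n s) ∧
          Upgrade.IsIntegral (Upgrade.outputPoint n s)) := by
  refine ⟨fun I J _ _ Q => ?_, ⟨2, Upgrade.halfProblem, Upgrade.halfPoint,
    Upgrade.halfPoint_isOptimalVertex, Upgrade.not_isIntegral_halfPoint⟩,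
    Upgrade.exists_program_integral_optimalVertex⟩
  classical exact Q.exists_integral_optimalVertex
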